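/- An instance consists of a finite vertex set $V$ and non-negative edge weights $w$ on the complete undirected graph with vertex set $V$ that satisfy the triangle inequality $w(\{x,z\})\le w(\{x,y\})+w(\{y,z\})$ for all distinct $x,y,z\in V$ (weight $0$ is allowed). A subgraph means a spanning simple subgraph of this complete graph; its weight is the sum of its edge weights. On a given instance let - $\mathrm{MST}$ be a minimum-weight spanning tree, - $\mathrm{TSP}$ a minimum-weight Hamiltonian cycle, - $\mathrm{Fact}_d$ a minimum-weight $d$-factor ($d$-regular spanning subgraph), - $\mathrm{RCS}_d$ a minimum-weight connected $d$-factor, - $\mathrm{2RCS}_d$ a minimum-weight 2-edge-connected $d$-factor, where 2-edge-connected means connected and without bridge edges. An inequality $w(A)\le c\cdot w(B)$ is said to hold for all instances if, on every instance on which $B$ exists, $A$ exists too and the inequality holds. It is *tight* if for every $\varepsilon>0$ there is an instance on which $A$ and $B$ exist and $w(A)>(c-\varepsilon)\,w(B)$. Below, $d$ is a non-negative integer, and tightness is claimed for each single value of $d$ in the stated range. **Lemma.** 1. $w(\mathrm{MST})\le w(\mathrm{RCS}_d)\le w(\mathrm{2RCS}_d)$ for all $d$ and all instances. The first inequality is tight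 for every $d\ge 1$; the second inequality, and also $w(\mathrm{MST})\le w(\mathrm{2RCS}_d)$, are tight for every $d\ge 2$. 2. $w(\mathrm{Fact}_d)\le w(\mathrm{RCS}_d)$ for all $d$ and all instances, and this is tight for every $d\ge 1$. 3. $w(\mathrm{2RCS}_d)\le 3\,w(\mathrm{RCS}_d)$ for all odd $d\ge 3$ and all instances, and this is tight for every odd $d\ge 3$. 4. $w(\mathrm{TSP})\le w(\mathrm{RCS}_d)$ for all even $d\ge 2$ and all instances, and this is tight for every even $d\ge 2$. 5. $w(\mathrm{TSP})\le 2\,w(\mathrm{RCS}_d)$ for all odd $d\ge 3$ and all instances, and this is tight for every odd $d\ge 3$. 6. $w(\mathrm{TSP})\le \frac43\,w(\mathrm{2RCS}_3)$ for all instances, and this is tight. 7. For every odd $d\ge 3$ there are instances with $w(\mathrm{TSP})\ge(\frac43-o(1))\,w(\mathrm{2RCS}_d)$ as the number of vertices grows: for every $\varepsilon>0$ and every $N$ there is an instance with at least $N$ vertices on which both exist, $w(\mathrm{2RCS}_d)>0$ and $w(\mathrm{TSP})\ge(\frac43-\varepsilon)\,w(\mathrm{2RCS}_d)$. 8. For all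 even $d\ge 4$ and all instances, $w(\mathrm{Fact}_{d-2})\le\frac{d-2}{d}\,w(\mathrm{Fact}_d)$ and $w(\mathrm{RCS}_{d-2})\le w(\mathrm{RCS}_d)$, and both inequalities are tight for every even $d\ge 4$. 9. Monotonicity fails for odd $d$: for every odd $d\ge 5$ there is an instance on which $\mathrm{RCS}_{d-2}$ and $\mathrm{RCS}_d$ exist, $w(\mathrm{RCS}_d)>0$ and $w(\mathrm{RCS}_{d-2})\ge\frac{d+2}{d}\,w(\mathrm{RCS}_d)$. -/

import Mathlib

universe u

namespace FactorComparison

/-- Non-negative edge weights on the complete graph with vertex set `V` that satisfy the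
triangle inequality. The values of `w` on the diagonal of `Sym2 V` (loops) are irrelevant. -/
structure MetricInstance (V : Type*) where
  w : Sym2 V → ℝ
  nonneg : ∀ x y : V, x ≠ y → 0 ≤ w s(x, y)
  triangle : ∀ x y z : V, x ≠ y → y ≠ z → x ≠ z → w s(x, z) ≤ w s(x, y) + w s(y, z)

open Classical in
/-- The total weight of the edges of a spanning subgraph `H` of the complete graph on `V`. -/
noncomputable def MetricInstance.weight {V : Type*} [Fintype V] (I : MetricInstance V)
    (H : SimpleGraph V) : ℝ :=
  ∑ e ∈ H.edgeFinset, I.w e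

/-- An optimization problem, given by its feasible solutions: which spanning subgraphs of the
complete graph on `V` are admissible. -/
abbrev Problem := ∀ (V : Type u) [Fintype V], SimpleGraph V → Prop

/-- `MST`: spanning trees. -/
def MST : Problem := fun _ _ H => H.IsTree

open Classical in
/-- `TSP`: graphs formed by the edges of a Hamiltonian cycle. -/
def TSP : Problem := fun V _ H =>
  ∃ (v : V) (p : H.Walk v v), p.IsHamiltonianCycle ∧ ∀ e ∈ H.edgeSet, e ∈ p.edges

open Classical in
/-- `Factor d`: `d`-factors, i.e. `d`-regular spanning subgraphs. -/
def Factor (d : ℕ) : Problem := fun _ _ H => H.IsRegularOfDegree d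

/-- `RCS d`: connected `d`-factors. -/
def RCS (d : ℕ) : Problem := fun V _ H => Factor d V H ∧ H.Connected

/-- Connected and without bridge edges. -/
def TwoEdgeConnected {V : Type*} (H : SimpleGraph V) : Prop :=
  H.Connected ∧ ∀ e ∈ H.edgeSet, ¬ H.IsBridge e

/-- `RTwoCS d`: 2-edge-connected `d`-factors. -/
def RTwoCS (d : ℕ) : Problem := fun V _ H => Factor d V H ∧ TwoEdgeConnected H

/-- `a` is the weight of a minimum-weight solution of the problem `P` on the instance `I`
(in particular, `P` has a solution). -/
def IsOpt {V : Type*} [Fintype V] (I : MetricInstance V) (P : Problem) (a : ℝ) : Prop :=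
  IsLeast {x : ℝ | ∃ H : SimpleGraph V, P V H ∧ I.weight H = x} a

/-- The inequality `w(P) ≤ c * w(Q)` holds for all instances: whenever `Q` has an optimal
solution, so does `P`, and the optimal weights satisfy the inequality. -/
def BoundedBy (P Q : Problem) (c : ℝ) : Prop :=
  ∀ (V : Type*) [Fintype V] (I : MetricInstance V) (b : ℝ),
    IsOpt I Q b → ∃ a : ℝ, IsOpt I P a ∧ a ≤ c * b

/-- The inequality `w(P) ≤ c * w(Q)` is tight: for no `ε > 0` may `c` be replaced by `c - ε`. -/
def IsTight (P Q : Problem) (c : ℝ) : Prop :=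
  ∀ ε : ℝ, 0 < ε → ∃ (V : Type) (_ : Fintype V) (I : MetricInstance V) (a b : ℝ),
    IsOpt I P a ∧ IsOpt I Q b ∧ (c - ε) * b < a

end FactorComparison

namespace FactorComparison
open Classical Finset

/-! Upper bounds for tours: a connected multigraph with even degrees has a spanning closed walk, and
the triangle inequality shortcuts it to a Hamiltonian cycle. For even `d` the connected factor is
itself such a multigraph (constant 1); in general its edges are doubled (constant 2). To a
2-edge-connected cubic graph one adds a perfect matching of at most a third of its weight. This
exists because the value 1/3 on every edge lies in Edmonds' perfect matching polytope: cuts of odd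
sets have an odd number of edges, hence at least three.

Upper bounds for factors: the tool is `exists_cyclic_exchange`. Choose edges `{u, b u}` in different
blocks, list the `u` along a closed tour, and replace each `{u, b u}` by the edge from `b u` to the
next `u`. Degrees stay the same, the triangle inequality bounds the added weight by the length of
the tour, and a parity count shows that every cut either ends up with at least two edges or is
unchanged and has all exchanged vertices on one side. Exchanging along a shortcut doubled graph
through the blocks behind bridges gives the constant 3. For even `d`, Petersen's theorem splits off
a 2-factor. Deleting a heavy one gives the bound for `Factor`; deleting any one and then exchanging
along its own cycles restores connectivity at a cost of at most what was deleted, which gives the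
bound for `RCS`.

Tightness: in most examples the vertices form clusters of weight 0, so that only links between
clusters count. A ring of cliques gives the constants 1 for connected problems, unit weights on a
complete graph those for plain factors. Two odd clusters joined by a bridge give 3 and 2. A star of
odd clusters around one vertex, whose few short links a factor of smaller degree must abandon,
breaks monotonicity. A theta graph with three long paths gives 4/3: each path can be left open at
one place only, and parity forces one of the paths to be run through twice. -/

lemma MetricInstance.edge_nonneg {V : Type*} (I : MetricInstance V) {H : SimpleGraph V} {e : Sym2 V}
    (he : e ∈ H.edgeSet) : 0 ≤ I.w e := by
  induction e using Sym2.ind with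
  | _ a b => exact I.nonneg a b (H.ne_of_adj (by simpa using he))

/-! ### Weights as sums over ordered pairs, existence of optima, criteria for bounds and tightness.
-/

section Basic
variable {V : Type*} [Fintype V]

/-- The sum of `φ` over the ordered pairs of adjacent vertices. -/
noncomputable def pairSum {R : Type*} [AddCommMonoid R] (H : SimpleGraph V) (φ : V → V → R) : R :=
  ∑ x, ∑ y, if H.Adj x y then φ x y else 0

/-- Each edge comes from exactly two ordered pairs. Degrees and cuts are also sums over ordered
adjacent pairs, so one identity about `pairSum` serves for all three. -/
lemma weight_eq_pairSum (I : MetricInstance V) (H : SimpleGraph V) :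
    I.weight H = (1 / 2) * pairSum H fun x y => I.w s(x, y) := by
  have h1 : pairSum H (fun x y => I.w s(x, y)) =
      ∑ p ∈ (univ : Finset (V × V)).filter (fun p => H.Adj p.1 p.2), I.w s(p.1, p.2) := by
    rw [pairSum, ← Finset.sum_product', Finset.sum_filter]
    rfl
  have h2 : ∑ p ∈ (univ : Finset (V × V)).filter (fun p => H.Adj p.1 p.2), I.w s(p.1, p.2)
      = ∑ e ∈ H.edgeFinset, 2 * I.w e := by
    rw [← Finset.sum_fiberwise_of_maps_to (t := H.edgeFinset) (g := fun p : V × V => s(p.1, p.2))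
      (by intro p hp; simpa using hp)]
    refine Finset.sum_congr rfl fun e he => ?_
    induction e using Sym2.ind with
    | _ a b =>
      have hab : H.Adj a b := by simpa using he
      have : ((univ : Finset (V × V)).filter (fun p => H.Adj p.1 p.2)).filter
          (fun p => s(p.1, p.2) = s(a, b)) = {(a, b), (b, a)} := by
        ext ⟨x, y⟩
        simp only [mem_filter, mem_univ, true_and, Sym2.eq_iff, mem_insert, mem_singleton,
          Prod.mk.injEq]
        constructor
        · rintro ⟨_, h⟩; exact h
        · rintro (⟨rfl, rfl⟩ | ⟨rfl, rfl⟩)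
          · exact ⟨hab, by simp⟩
          · exact ⟨hab.symm, by simp⟩
      rw [this, Finset.sum_pair (by simp [hab.ne])]
      simp only [Sym2.eq_swap (a := b) (b := a)]
      ring
  rw [h1, h2, ← Finset.mul_sum, MetricInstance.weight]
  ring

lemma MetricInstance.weight_nonneg (I : MetricInstance V) (H : SimpleGraph V) :
    0 ≤ I.weight H :=
  Finset.sum_nonneg fun e he => I.edge_nonneg (H := H) (by simpa using he)

lemma MetricInstance.weight_mono (I : MetricInstance V) {H G : SimpleGraph V} (h : H ≤ G) :
    I.weight H ≤ I.weight G := by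
  refine Finset.sum_le_sum_of_subset_of_nonneg ?_
    fun e he _ => I.edge_nonneg (H := G) (by simpa using he)
  intro e he
  simp only [SimpleGraph.mem_edgeFinset] at *
  exact SimpleGraph.edgeSet_mono h he

lemma exists_isOpt (I : MetricInstance V) {P : Problem} {H : SimpleGraph V} (hH : P V H) :
    ∃ a, IsOpt I P a ∧ a ≤ I.weight H := by
  obtain ⟨a, ha⟩ : ∃ a, IsOpt I P a := by
    have hfin : {x : ℝ | ∃ H : SimpleGraph V, P V H ∧ I.weight H = x}.Finite := by
      refine (Set.toFinite (Set.range fun H : SimpleGraph V => I.weight H)).subset ?_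
      rintro x ⟨H, _, rfl⟩
      exact ⟨H, rfl⟩
    obtain ⟨a, ha, hmin⟩ := hfin.exists_minimalFor id _ ⟨_, H, hH, rfl⟩
    refine ⟨a, ha, fun x hx => ?_⟩
    rcases le_total a x with h | h
    · exact h
    · exact hmin hx h
  exact ⟨a, ha, ha.2 ⟨H, hH, rfl⟩⟩

end Basic

lemma boundedBy_of {P Q : Problem} {c : ℝ}
    (h : ∀ (V : Type*) [Fintype V] (I : MetricInstance V) (H : SimpleGraph V), Q V H →
      ∃ H', P V H' ∧ I.weight H' ≤ c * I.weight H) : BoundedBy P Q c := by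
  rintro V _ I b ⟨⟨H, hH, rfl⟩, -⟩
  obtain ⟨H', hP, hw⟩ := h V I H hH
  obtain ⟨a, ha, hle⟩ := exists_isOpt I hP
  exact ⟨a, ha, hle.trans hw⟩

/-- Optima need not be computed: a lower bound for all solutions of `P` and one cheap solution of
`Q` suffice. -/
lemma isTight_of {P Q : Problem} {c : ℝ}
    (h : ∀ ε : ℝ, 0 < ε → ∃ (V : Type) (_ : Fintype V) (I : MetricInstance V) (α β : ℝ),
      (∃ H, P V H) ∧ (∀ H, P V H → α ≤ I.weight H) ∧ (∃ H, Q V H ∧ I.weight H ≤ β) ∧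
        0 < α ∧ (c - ε) * β < α) : IsTight P Q c := by
  intro ε hε
  obtain ⟨V, _, I, α, β, ⟨H, hH⟩, hα, ⟨H', hH', hβ⟩, hpos, hlt⟩ := h ε hε
  obtain ⟨a, ha, -⟩ := exists_isOpt I hH
  obtain ⟨b, hb, hbl⟩ := exists_isOpt I hH'
  refine ⟨V, _, I, a, b, ha, hb, ?_⟩
  have hαa : α ≤ a := by
    obtain ⟨H'', h1, h2⟩ := ha.1
    exact h2 ▸ hα _ h1
  have hb0 : 0 ≤ b := by
    obtain ⟨H'', h1, h2⟩ := hb.1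
    exact h2 ▸ I.weight_nonneg _
  -- For negative `c - ε` the inequality `b ≤ β` points the wrong way; then `0 ≤ b` and `0 < α`
  -- decide.
  rcases le_total (c - ε) 0 with hc | hc
  · nlinarith
  · nlinarith

/-! ### Degrees, cuts and the parity of cuts in regular graphs. -/

section Degrees
variable {V : Type*} [Fintype V]

lemma factor_iff {d : ℕ} {H : SimpleGraph V} :
    Factor d V H ↔ ∀ x, (∑ y, if H.Adj x y then 1 else 0) = d := by
  unfold Factor SimpleGraph.IsRegularOfDegree
  refine forall_congr' fun x => ?_
  rw [← SimpleGraph.card_neighborFinset_eq_degree, SimpleGraph.neighborFinset_eq_filter,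
    Finset.card_filter]

lemma Factor.exists_adj {d : ℕ} {H : SimpleGraph V} (hH : Factor d V H) (hd : 0 < d) (x : V) :
    ∃ y, H.Adj x y := by
  by_contra! h
  have := factor_iff.1 hH x
  simp [h] at this
  omega

lemma Factor.lt_card {d : ℕ} {H : SimpleGraph V} (hH : Factor d V H) (x : V) :
    d < Fintype.card V := by
  rw [← hH x]
  exact H.degree_lt_card_verts x

/-- The ordered pairs of adjacent vertices that leave the set `S`. -/
noncomputable def cutPairs (H : SimpleGraph V) (S : Set V) : Finset (V × V) :=
  univ.filter fun p => p.1 ∈ S ∧ p.2 ∉ S ∧ H.Adj p.1 p.2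

@[simp] lemma mem_cutPairs {H : SimpleGraph V} {S : Set V} {x y : V} :
    (x, y) ∈ cutPairs H S ↔ x ∈ S ∧ y ∉ S ∧ H.Adj x y := by
  simp [cutPairs]

/-- The number of edges of `H` that leave the set `S`. -/
noncomputable def cut (H : SimpleGraph V) (S : Set V) : ℕ := (cutPairs H S).card

lemma cut_eq_pairSum (H : SimpleGraph V) (S : Set V) :
    cut H S = pairSum H fun x y => if x ∈ S ∧ y ∉ S then 1 else 0 := by
  rw [cut, cutPairs, Finset.card_filter, pairSum, ← Finset.sum_product']
  refine Finset.sum_congr rfl fun p _ => ?_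
  by_cases h1 : p.1 ∈ S <;> by_cases h2 : p.2 ∈ S <;> by_cases h3 : H.Adj p.1 p.2 <;>
    simp [h1, h2, h3]

lemma cut_compl (H : SimpleGraph V) (S : Set V) : cut H Sᶜ = cut H S := by
  refine Finset.card_bij (fun p _ => (p.2, p.1)) ?_ ?_ ?_
  · rintro ⟨x, y⟩ h
    simp only [mem_cutPairs, Set.mem_compl_iff, not_not] at h ⊢
    exact ⟨h.2.1, h.1, h.2.2.symm⟩
  · rintro ⟨x, y⟩ _ ⟨x', y'⟩ _ h
    simp only [Prod.mk.injEq] at h ⊢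
    exact ⟨h.2, h.1⟩
  · rintro ⟨x, y⟩ h
    simp only [mem_cutPairs] at h
    exact ⟨(y, x), by simpa using ⟨h.2.1, h.1, h.2.2.symm⟩, rfl⟩

lemma cut_pos_iff {H : SimpleGraph V} {S : Set V} :
    0 < cut H S ↔ ∃ x ∈ S, ∃ y ∉ S, H.Adj x y := by
  rw [cut, Finset.card_pos]
  constructor
  · rintro ⟨⟨x, y⟩, h⟩
    rw [mem_cutPairs] at h
    exact ⟨x, h.1, y, h.2.1, h.2.2⟩
  · rintro ⟨x, hx, y, hy, h⟩
    exact ⟨(x, y), by simp [hx, hy, h]⟩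

lemma two_le_cut_of {H : SimpleGraph V} {S : Set V} {x y x' y' : V} (hx : x ∈ S) (hy : y ∉ S)
    (h : H.Adj x y) (hx' : x' ∈ S) (hy' : y' ∉ S) (h' : H.Adj x' y') (hne : (x, y) ≠ (x', y')) :
    2 ≤ cut H S :=
  Finset.one_lt_card.2 ⟨(x, y), by simp [*], (x', y'), by simp [*], hne⟩

/-- Handshaking inside `S`. -/
lemma cut_add_even (H : SimpleGraph V) (S : Set V) :
    ∃ k, cut H S + 2 * k = ∑ x ∈ univ.filter (· ∈ S), ∑ y, if H.Adj x y then 1 else 0 := by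
  -- The subgraph induced on `S`; the degree sum over `S` counts its edges twice and the leaving
  -- edges once, so `k` is the number of its edges.
  let G : SimpleGraph V := SimpleGraph.mk (fun x y => x ∈ S ∧ y ∈ S ∧ H.Adj x y)
    ⟨fun x y h => ⟨h.2.1, h.1, h.2.2.symm⟩⟩ ⟨fun x h => H.irrefl h.2.2⟩
  refine ⟨G.edgeFinset.card, ?_⟩
  have h2 : 2 * G.edgeFinset.card = ∑ x, ∑ y, if G.Adj x y then 1 else 0 := by
    rw [← SimpleGraph.sum_degrees_eq_twice_card_edges]
    refine Finset.sum_congr rfl fun x _ => ?_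
    rw [← SimpleGraph.card_neighborFinset_eq_degree, SimpleGraph.neighborFinset_eq_filter,
      Finset.card_filter]
  rw [h2, cut_eq_pairSum, pairSum, ← Finset.sum_add_distrib, Finset.sum_filter]
  refine Finset.sum_congr rfl fun x _ => ?_
  rw [← Finset.sum_add_distrib]
  split_ifs with hx
  · refine Finset.sum_congr rfl fun y _ => ?_
    by_cases h1 : y ∈ S <;> by_cases h3 : H.Adj x y <;> simp [G, hx, h1, h3]
  · refine Finset.sum_eq_zero fun y _ => ?_
    simp [G, hx]

lemma Factor.cut_parity {d : ℕ} {H : SimpleGraph V} (hH : Factor d V H) (S : Set V) :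
    ∃ k, cut H S + 2 * k = (univ.filter (· ∈ S)).card * d := by
  obtain ⟨k, hk⟩ := cut_add_even H S
  refine ⟨k, hk.trans ?_⟩
  rw [Finset.sum_congr rfl fun x _ => factor_iff.1 hH x]
  simp

lemma Factor.even_cut {d : ℕ} {H : SimpleGraph V} (hH : Factor d V H) (hd : Even d) (S : Set V) :
    Even (cut H S) := by
  obtain ⟨k, hk⟩ := hH.cut_parity S
  have : Even (cut H S + 2 * k) := hk ▸ hd.mul_left _
  rwa [Nat.even_add, iff_true_right (even_two_mul k)] at this

lemma Factor.odd_cut {d : ℕ} {H : SimpleGraph V} (hH : Factor d V H) (hd : Odd d) (S : Set V)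
    (hS : Odd (univ.filter (· ∈ S)).card) : Odd (cut H S) := by
  obtain ⟨k, hk⟩ := hH.cut_parity S
  have : Odd (cut H S + 2 * k) := hk ▸ hS.mul hd
  rwa [Nat.odd_add, iff_true_right (even_two_mul k)] at this

end Degrees

/-! ### Connectivity and 2-edge-connectivity in terms of cuts. -/

section Connectivity
variable {V : Type*} [Fintype V]

lemma cut_pos_of_connected {H : SimpleGraph V} (hH : H.Connected) {S : Set V} {a b : V}
    (ha : a ∈ S) (hb : b ∉ S) : 0 < cut H S := by
  obtain ⟨p⟩ := hH.preconnected a b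
  obtain ⟨d, -, h1, h2⟩ := p.exists_boundary_dart S ha hb
  exact cut_pos_iff.2 ⟨d.fst, h1, d.snd, h2, d.adj⟩

lemma reachable_of_cut {H : SimpleGraph V} {a b : V}
    (h : ∀ S : Set V, a ∈ S → b ∉ S → 0 < cut H S) : H.Reachable a b := by
  by_contra hab
  obtain ⟨x, hx, y, hy, hxy⟩ := cut_pos_iff.1 (h {y | H.Reachable a y} (by simp) hab)
  exact hy (SimpleGraph.Reachable.trans hx hxy.reachable)

lemma connected_of_cut [Nonempty V] {H : SimpleGraph V}
    (h : ∀ S : Set V, ∀ a ∈ S, ∀ b ∉ S, 0 < cut H S) : H.Connected :=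
  ⟨fun _ _ => reachable_of_cut fun S ha hb => h S _ ha _ hb⟩

lemma twoEdgeConnected_of_cut [Nonempty V] {H : SimpleGraph V}
    (h : ∀ S : Set V, ∀ a ∈ S, ∀ b ∉ S, 2 ≤ cut H S) : TwoEdgeConnected H := by
  refine ⟨connected_of_cut fun S a ha b hb => by have := h S a ha b hb; omega, fun e he => ?_⟩
  induction e using Sym2.ind with
  | _ u v =>
    rw [SimpleGraph.isBridge_iff, not_not]
    refine reachable_of_cut fun S hu hv => ?_
    -- A second pair leaving `S` survives the deletion of `{u, v}`: it differs from `(u, v)` by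
    -- choice and from `(v, u)` because `v ∉ S`.
    obtain ⟨⟨x, y⟩, hp, hne⟩ := Finset.exists_mem_ne (h S u hu v hv) (u, v)
    rw [mem_cutPairs] at hp
    refine cut_pos_iff.2 ⟨x, hp.1, y, hp.2.1, ?_⟩
    rw [SimpleGraph.deleteEdges_adj]
    refine ⟨hp.2.2, ?_⟩
    simp only [Set.mem_singleton_iff, Sym2.eq_iff]
    rintro (⟨rfl, rfl⟩ | ⟨rfl, rfl⟩)
    · exact hne rfl
    · exact hv hp.1

/-- Some edge leaves `S`; it is not a bridge, so its ends are joined by a walk avoiding it, and this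
walk leaves `S` through another edge. -/
lemma TwoEdgeConnected.two_le_cut {H : SimpleGraph V} (hH : TwoEdgeConnected H) {S : Set V}
    {a b : V} (ha : a ∈ S) (hb : b ∉ S) : 2 ≤ cut H S := by
  obtain ⟨x, hx, y, hy, hxy⟩ := cut_pos_iff.1 (cut_pos_of_connected hH.1 ha hb)
  have hr := hH.2 s(x, y) hxy
  rw [SimpleGraph.isBridge_iff, not_not] at hr
  obtain ⟨p⟩ := hr
  obtain ⟨d, -, h1, h2⟩ := p.exists_boundary_dart S hx hy
  have had := d.adj
  rw [SimpleGraph.deleteEdges_adj] at had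
  refine two_le_cut_of hx hy hxy h1 h2 had.1 fun h => had.2 ?_
  simp only [Prod.mk.injEq] at h
  simp [← h.1, ← h.2]

/-- A connected graph has at least `|N| - 1` edges between the fibres of a map onto `N`. -/
lemma card_le_crossing {N : Type*} [Fintype N] {H : SimpleGraph V} (hH : H.Connected) (c : V → N)
    (hc : Function.Surjective c) :
    2 * (Fintype.card N : ℝ) ≤ pairSum H (fun x y => if c x = c y then (0 : ℝ) else 1) + 2 := by
  -- The quotient graph on the fibres is connected, so it has at least `|N| - 1` edges, and each of
  -- them lifts to a crossing edge of `H`.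
  let Q : SimpleGraph N := SimpleGraph.mk (fun a b => a ≠ b ∧ ∃ x y, c x = a ∧ c y = b ∧ H.Adj x y)
    ⟨fun a b ⟨h, x, y, hx, hy, hxy⟩ => ⟨h.symm, y, x, hy, hx, hxy.symm⟩⟩ ⟨fun a h => h.1 rfl⟩
  have hQ : Q.Connected := by
    have : Nonempty N := hH.nonempty.map c
    refine connected_of_cut fun S a ha b hb => ?_
    obtain ⟨x, rfl⟩ := hc a
    obtain ⟨y, rfl⟩ := hc b
    obtain ⟨u, hu, v, hv, huv⟩ :=
      cut_pos_iff.1 (cut_pos_of_connected hH (S := c ⁻¹' S) (a := x) (b := y) ha hb)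
    refine cut_pos_iff.2 ⟨c u, hu, c v, hv, ?_, u, v, rfl, rfl, huv⟩
    intro h
    exact hv (by simpa [h] using hu)
  have h1 := hQ.card_vert_le_card_edgeSet_add_one
  rw [Nat.card_eq_fintype_card, Nat.card_eq_fintype_card, ← SimpleGraph.edgeFinset_card] at h1
  have h2 : (univ.filter fun p : N × N => Q.Adj p.1 p.2).card = 2 * Q.edgeFinset.card := by
    rw [← SimpleGraph.sum_degrees_eq_twice_card_edges, Finset.card_filter,
      Fintype.sum_prod_type]
    refine Finset.sum_congr rfl fun x _ => ?_
    rw [← SimpleGraph.card_neighborFinset_eq_degree, SimpleGraph.neighborFinset_eq_filter,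
      Finset.card_filter]
  have h3 : (univ.filter fun p : N × N => Q.Adj p.1 p.2).card ≤
      (univ.filter fun p : V × V => H.Adj p.1 p.2 ∧ c p.1 ≠ c p.2).card := by
    refine Finset.card_le_card_of_surjOn (fun p => (c p.1, c p.2)) ?_
    rintro ⟨a, b⟩ h
    simp only [coe_filter, mem_univ, true_and, Set.mem_ofPred_eq] at h
    obtain ⟨hab, x, y, rfl, rfl, hxy⟩ := h
    exact ⟨(x, y), by simpa using ⟨hxy, hab⟩, rfl⟩
  have h4 : pairSum H (fun x y => if c x = c y then (0 : ℝ) else 1) =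
      ((univ.filter fun p : V × V => H.Adj p.1 p.2 ∧ c p.1 ≠ c p.2).card : ℝ) := by
    rw [Finset.card_filter, pairSum, Fintype.sum_prod_type]
    push_cast
    refine Finset.sum_congr rfl fun x _ => Finset.sum_congr rfl fun y _ => ?_
    by_cases h1 : H.Adj x y <;> by_cases h2 : c x = c y <;> simp [h1, h2]
  rw [h4]
  have : 2 * Fintype.card N ≤
      (univ.filter fun p : V × V => H.Adj p.1 p.2 ∧ c p.1 ≠ c p.2).card + 2 := by omega
  exact_mod_cast this

end Connectivity

/-! ### Closed walks in multigraphs with even degrees. -/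

section Euler
variable {V : Type*}

/-- A walk in a multigraph `M` is modelled as a walk in the complete graph whose edges, with
multiplicity, form a submultiset of `M`. -/
abbrev CWalk (u v : V) := (⊤ : SimpleGraph V).Walk u v

/-- Every passage through a vertex uses two edges, so only the two ends of an open walk are met an
odd number of times. Edges are counted with multiplicity, hence the walk may repeat them. -/
lemma even_countP_edges_iff {G : SimpleGraph V} {u v : V} (p : G.Walk u v) (x : V) :
    Even (p.edges.countP fun e => x ∈ e) ↔ u ≠ v → x ≠ u ∧ x ≠ v := by
  induction p with
  | nil => simp
  | cons huv p ih =>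
    simp only [List.countP_cons, Ne, SimpleGraph.Walk.edges_cons, Sym2.mem_iff]
    split_ifs with h
    · rw [decide_eq_true_eq] at h
      obtain (rfl | rfl) := h
      · rw [Nat.even_add_one, ih]
        simp only [huv.ne, imp_false, Ne, not_false_iff, true_and, not_forall,
          Classical.not_not, exists_prop, not_true, false_and,
          and_iff_right_iff_imp]
        rintro rfl rfl
        exact G.loopless.irrefl _ huv
      · have := huv.ne; grind
    · grind

/-- A multiset of edges on `V` without loops in which all degrees are even. -/
structure EvenEdges (M : Multiset (Sym2 V)) : Prop where
  not_isDiag : ∀ e ∈ M, ¬ e.IsDiag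
  even : ∀ x, Even (M.countP (x ∈ ·))

lemma EvenEdges.sub {M : Multiset (Sym2 V)} (hM : EvenEdges M) {v : V} {p : CWalk v v}
    (hp : (p.edges : Multiset (Sym2 V)) ≤ M) : EvenEdges (M - (p.edges : Multiset (Sym2 V))) := by
  refine ⟨fun e he => hM.not_isDiag e (Multiset.mem_of_le (Multiset.sub_le_self _ _) he),
    fun x => ?_⟩
  rw [Multiset.countP_sub hp]
  refine (hM.even x).tsub ?_
  have := (even_countP_edges_iff p x).2 (by simp)
  simpa using this

/-- An unused edge at the start of a walk prolongs it; this contradicts the choice of a longest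
walk. -/
lemma cons_edges_le {M : Multiset (Sym2 V)} (hM : ∀ e ∈ M, ¬ e.IsDiag) {u v : V} {p : CWalk u v}
    (hp : (p.edges : Multiset (Sym2 V)) ≤ M) {e : Sym2 V} (he : e ∈ M - p.edges) (hu : u ∈ e) :
    ∃ (w : V) (q : CWalk w v), (q.edges : Multiset (Sym2 V)) ≤ M ∧ q.length = p.length + 1 := by
  obtain ⟨y, rfl⟩ := Sym2.mem_iff_exists.1 hu
  have hne : y ≠ u := by
    rintro rfl
    exact hM _ (Multiset.mem_of_le (Multiset.sub_le_self _ _) he) (by simp)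
  refine ⟨y, SimpleGraph.Walk.cons (by simpa using hne) p, ?_, by simp⟩
  have h1 : ({s(u, y)} : Multiset (Sym2 V)) + p.edges ≤ M := by
    calc ({s(u, y)} : Multiset (Sym2 V)) + p.edges ≤ (M - p.edges) + p.edges :=
          add_le_add_left (Multiset.singleton_le.2 he) _
      _ = M := tsub_add_cancel_of_le hp
  rw [SimpleGraph.Walk.edges_cons, Sym2.eq_swap]
  exact h1

/-- A longest walk in an even multigraph is closed and saturated. -/
lemma EvenEdges.exists_saturated [Nonempty V] {M : Multiset (Sym2 V)} (hM : EvenEdges M) :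
    ∃ (v : V) (p : CWalk v v), (p.edges : Multiset (Sym2 V)) ≤ M ∧
      (∀ x ∈ p.support, ∀ e ∈ M - p.edges, x ∉ e) ∧ (M ≠ 0 → 0 < p.length) := by
  let P : ℕ → Prop := fun n => ∃ (u v : V) (p : CWalk u v),
    (p.edges : Multiset (Sym2 V)) ≤ M ∧ p.length = n
  have hbound : ∀ n, P n → n ≤ Multiset.card M := by
    rintro n ⟨u, v, p, hp, rfl⟩
    have := Multiset.card_le_card hp
    simpa using this
  have hP0 : P 0 := ⟨Classical.arbitrary V, _, SimpleGraph.Walk.nil, by simp, rfl⟩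
  obtain ⟨u, v, p, hp, hlen⟩ := Nat.findGreatest_spec (P := P) (Nat.zero_le _) hP0
  have hmax : ∀ {a b : V} (q : CWalk a b), (q.edges : Multiset (Sym2 V)) ≤ M →
      q.length ≤ p.length := by
    intro a b q hq
    rw [hlen]
    exact Nat.le_findGreatest (hbound _ ⟨a, b, q, hq, rfl⟩) ⟨a, b, q, hq, rfl⟩
  -- If the ends differ, the walk uses an odd number of the evenly many edges at `u`, so one is left
  -- over and prolongs the walk.
  have huv : u = v := by
    by_contra hne
    have h1 : ¬ Even (p.edges.countP fun e => u ∈ e) := by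
      rw [even_countP_edges_iff]
      simp [hne]
    have h2 : (M - p.edges).countP (u ∈ ·) ≠ 0 := by
      rw [Multiset.countP_sub hp]
      intro h0
      have h3 := Multiset.countP_le_of_le (u ∈ ·) hp
      have h4 : M.countP (u ∈ ·) = (p.edges : Multiset (Sym2 V)).countP (u ∈ ·) := by omega
      refine h1 ?_
      have := hM.even u
      rw [h4] at this
      simpa using this
    obtain ⟨e, he, hue⟩ := Multiset.countP_pos.1 (Nat.pos_of_ne_zero h2)
    obtain ⟨w, q, hq, hql⟩ := cons_edges_le hM.not_isDiag hp he hue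
    have := hmax q hq
    omega
  subst huv
  refine ⟨u, p, hp, fun x hx e he hxe => ?_, fun hM0 => ?_⟩
  -- A closed walk can be restarted at any of its vertices without changing its edges, so an unused
  -- edge at any of them would prolong it.
  · have hperm : ((p.rotate x hx).edges : Multiset (Sym2 V)) = p.edges :=
      Multiset.coe_eq_coe.2 (p.rotate_edges x hx).perm
    obtain ⟨w, q, hq, hql⟩ := cons_edges_le (p := p.rotate x hx) hM.not_isDiag (hperm ▸ hp)
      (hperm ▸ he) hxe
    have := hmax q hq
    rw [hql, SimpleGraph.Walk.length_rotate] at this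
    omega
  · obtain ⟨e, he⟩ := Multiset.exists_mem_of_ne_zero hM0
    induction e using Sym2.ind with
    | _ a b =>
      have hab : a ≠ b := by simpa using hM.not_isDiag _ he
      have := hmax (SimpleGraph.Walk.cons (show (⊤ : SimpleGraph V).Adj a b from hab)
        SimpleGraph.Walk.nil) (by simpa using he)
      simpa [Nat.one_le_iff_ne_zero, Nat.pos_iff_ne_zero] using this

/-- A connected even multigraph has a spanning closed walk. -/
lemma EvenEdges.exists_spanning_walk [Nonempty V] {M : Multiset (Sym2 V)} (hM : EvenEdges M)
    (hconn : ∀ S : Set V, ∀ a ∈ S, ∀ b ∉ S, ∃ x ∈ S, ∃ y ∉ S, s(x, y) ∈ M) :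
    ∃ (v : V) (p : CWalk v v), (p.edges : Multiset (Sym2 V)) ≤ M ∧ ∀ x, x ∈ p.support := by
  obtain ⟨v, p, hp, hsat, -⟩ := hM.exists_saturated
  refine ⟨v, p, hp, fun x => ?_⟩
  by_contra hx
  obtain ⟨a, ha, b, hb, hab⟩ := hconn {y | y ∈ p.support} v (by simp) x hx
  -- The edge leaving the support is not left over, by saturation, so the walk uses it and visits
  -- `b` after all.
  have h1 : s(a, b) ∉ M - (p.edges : Multiset (Sym2 V)) := fun h => hsat a ha _ h (by simp)
  have h2 : s(a, b) ∈ p.edges := by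
    by_contra h2
    refine h1 ?_
    rw [Multiset.mem_sub]
    rw [Multiset.coe_count, List.count_eq_zero_of_not_mem h2]
    exact Multiset.count_pos.2 hab
  exact hb (p.snd_mem_support_of_mem_edges h2)

/-- An even multigraph is a union of closed walks. -/
lemma EvenEdges.exists_decomposition {M : Multiset (Sym2 V)} (hM : EvenEdges M) :
    ∃ L : List (Σ v : V, CWalk v v), (L.map fun p => (p.2.edges : Multiset (Sym2 V))).sum = M := by
  induction h : Multiset.card M using Nat.strong_induction_on generalizing M with
  | _ n ih =>
    by_cases hM0 : M = 0
    · exact ⟨[], by simp [hM0]⟩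
    obtain ⟨e, he⟩ := Multiset.exists_mem_of_ne_zero hM0
    have : Nonempty V := ⟨e.out.1⟩
    obtain ⟨v, p, hp, -, hpos⟩ := hM.exists_saturated
    have hcard := Multiset.card_sub hp
    rw [Multiset.coe_card, SimpleGraph.Walk.length_edges] at hcard
    have hle := Multiset.card_le_card hp
    rw [Multiset.coe_card, SimpleGraph.Walk.length_edges] at hle
    have := hpos hM0
    obtain ⟨L, hL⟩ := ih _ (by omega) (hM.sub hp) rfl
    refine ⟨⟨v, p⟩ :: L, ?_⟩
    rw [List.map_cons, List.sum_cons, hL]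
    exact add_tsub_cancel_of_le hp

end Euler

/-! ### Lengths of tours and shortcutting. -/

section Shortcut
variable {V : Type*}

/-- The length of the path that starts in `a`, passes through the list and ends in `b`. -/
def pathLength (D : V → V → ℝ) : V → List V → V → ℝ
  | a, [], b => D a b
  | a, x :: t, b => D a x + pathLength D x t b

/-- The length of the closed tour through the list. -/
def tourLength (D : V → V → ℝ) : List V → ℝ
  | [] => 0
  | x :: t => pathLength D x t x

/-- The weight function of an instance, set to zero on the diagonal. -/
noncomputable def MetricInstance.dist (I : MetricInstance V) (x y : V) : ℝ :=
  if x = y then 0 else I.w s(x, y)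

lemma MetricInstance.dist_self (I : MetricInstance V) (x : V) : I.dist x x = 0 := by
  simp [MetricInstance.dist]

lemma MetricInstance.dist_of_ne (I : MetricInstance V) {x y : V} (h : x ≠ y) :
    I.dist x y = I.w s(x, y) := by
  simp [MetricInstance.dist, h]

lemma MetricInstance.dist_nonneg (I : MetricInstance V) (x y : V) : 0 ≤ I.dist x y := by
  unfold MetricInstance.dist
  split_ifs with h
  · exact le_rfl
  · exact I.nonneg _ _ h

lemma MetricInstance.dist_triangle (I : MetricInstance V) (x y z : V) :
    I.dist x z ≤ I.dist x y + I.dist y z := by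
  by_cases hxy : x = y
  · simp [hxy, I.dist_self]
  by_cases hyz : y = z
  · simp [hyz, I.dist_self]
  by_cases hxz : x = z
  · rw [hxz, I.dist_self]
    exact add_nonneg (I.dist_nonneg _ _) (I.dist_nonneg _ _)
  rw [I.dist_of_ne hxy, I.dist_of_ne hyz, I.dist_of_ne hxz]
  exact I.triangle x y z hxy hyz hxz

variable (I : MetricInstance V)

lemma pathLength_triangle (a x : V) (t : List V) (b : V) :
    pathLength I.dist a t b ≤ I.dist a x + pathLength I.dist x t b := by
  cases t with
  | nil => exact I.dist_triangle a x b
  | cons y t =>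
    have := I.dist_triangle a x y
    simp only [pathLength]
    linarith

lemma pathLength_triangle_right (a : V) (t : List V) (b c : V) :
    pathLength I.dist a t c ≤ pathLength I.dist a t b + I.dist b c := by
  induction t generalizing a with
  | nil => exact I.dist_triangle a b c
  | cons y t ih =>
    have := ih y
    simp only [pathLength]
    linarith

lemma dist_le_pathLength (a : V) (t : List V) (b : V) : I.dist a b ≤ pathLength I.dist a t b := by
  induction t generalizing a with
  | nil => exact le_rfl
  | cons y t ih =>
    have := ih y
    have := I.dist_triangle a y b
    simp only [pathLength]
    linarith

lemma pathLength_sublist {l' l : List V} (h : l'.Sublist l) (a b : V) :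
    pathLength I.dist a l' b ≤ pathLength I.dist a l b := by
  induction h generalizing a with
  | slnil => exact le_rfl
  | cons x h ih =>
    exact (ih a).trans (by simpa [pathLength] using pathLength_triangle I a x _ b)
  | cons_cons x h ih =>
    simp only [pathLength]
    linarith [ih x]

/-- Dropping vertices inside the tour is the triangle inequality for paths; the case needing care is
the loss of the first vertex. -/
lemma tourLength_sublist {l' l : List V} (h : l'.Sublist l) :
    tourLength I.dist l' ≤ tourLength I.dist l := by
  cases h with
  | slnil => exact le_rfl
  | @cons l' t x h =>
    cases l' with
    | nil =>
      have := dist_le_pathLength I x t x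
      rw [I.dist_self] at this
      exact this
    | cons y t' =>
      -- The shorter tour starts at `y` instead of `x`; the leg from `x` to `y` is moved from the
      -- beginning to the end.
      have h1 := pathLength_sublist I h x x
      have h2 := pathLength_triangle_right I y t' x y
      simp only [pathLength, tourLength] at *
      linarith
  | cons_cons x h => exact pathLength_sublist I h x x

lemma walk_pathLength {u v : V} (p : CWalk u v) :
    pathLength I.dist u p.support.tail v = (p.edges.map I.w).sum := by
  induction p with
  | nil => simp [pathLength, I.dist_self]
  | cons h p ih =>
    rw [SimpleGraph.Walk.support_cons, List.tail_cons, ← SimpleGraph.Walk.cons_tail_support p,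
      pathLength, ih, I.dist_of_ne (by simpa using h)]
    simp

lemma walk_tourLength {v : V} (p : CWalk v v) :
    tourLength I.dist p.support = (p.edges.map I.w).sum := by
  rw [← SimpleGraph.Walk.cons_tail_support p, tourLength, walk_pathLength]

/-- `formPerm` sends each vertex to its successor, so the list of images is the list rotated by one.
This form of the length fits the exchange of edges. -/
lemma sum_formPerm {l : List V} (h : l.Nodup) :
    ∑ u ∈ l.toFinset, I.dist u (l.formPerm u) = tourLength I.dist l := by
  have key : ∀ (t : List V) (a b : V),
      (List.zipWith I.dist (a :: t) (t ++ [b])).sum = pathLength I.dist a t b := by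
    intro t
    induction t with
    | nil => simp [pathLength]
    | cons y t ih =>
      intro a b
      simp only [List.cons_append, List.zipWith_cons_cons, List.sum_cons, pathLength, ih]
  have hmap : l.map (fun u => l.formPerm u) = l.rotate 1 := by
    refine List.ext_getElem (by simp) fun i h1 h2 => ?_
    rw [List.getElem_map, List.formPerm_apply_getElem _ h, List.getElem_rotate]
  rw [List.sum_toFinset _ h]
  have h2 : l.map (fun u => I.dist u (l.formPerm u)) = List.zipWith I.dist l (l.rotate 1) := by
    rw [← hmap, List.zipWith_map_right, List.zipWith_self]
  rw [h2]
  cases l with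
  | nil => simp [tourLength]
  | cons x t =>
    rw [tourLength, ← key]
    simp

/-- With `f = id` this removes repetitions from a closed walk; with the component map as `f` it
picks one representative per component met. -/
lemma exists_sublist_transversal {α β : Type*} (f : α → β) (l : List α) :
    ∃ l' : List α, l'.Sublist l ∧ (l'.map f).Nodup ∧ ∀ x ∈ l, f x ∈ l'.map f := by
  induction l with
  | nil => exact ⟨[], by simp⟩
  | cons x l ih =>
    obtain ⟨l', h1, h2, h3⟩ := ih
    by_cases hx : f x ∈ l'.map f
    · refine ⟨l', h1.cons x, h2, fun y hy => ?_⟩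
      rcases List.mem_cons.1 hy with rfl | hy
      · exact hx
      · exact h3 y hy
    · refine ⟨x :: l', h1.cons_cons x, ?_, fun y hy => ?_⟩
      · rw [List.map_cons]
        exact List.nodup_cons.2 ⟨hx, h2⟩
      · rcases List.mem_cons.1 hy with rfl | hy
        · simp
        · rw [List.map_cons]
          exact List.mem_cons_of_mem _ (h3 y hy)

lemma exists_walk_of_list (x : V) (t : List V) (h : (x :: t).Nodup) :
    ∃ (z : V) (q : CWalk x z), q.support = x :: t ∧
      ∀ b, pathLength I.dist x t b = (q.edges.map I.w).sum + I.dist z b := by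
  induction t generalizing x with
  | nil => exact ⟨x, SimpleGraph.Walk.nil, by simp, by simp [pathLength]⟩
  | cons y t ih =>
    obtain ⟨z, q, hq, hl⟩ := ih y (List.nodup_cons.1 h).2
    have hxy : x ≠ y := by
      rintro rfl
      simp at h
    refine ⟨z, SimpleGraph.Walk.cons (by simpa using hxy) q, by simp [hq], fun b => ?_⟩
    rw [pathLength, hl, I.dist_of_ne hxy]
    simp
    ring

/-- Shortcutting an Eulerian tour. -/
lemma EvenEdges.exists_tour [Nonempty V]
    {M : Multiset (Sym2 V)} (hM : EvenEdges M)
    (hconn : ∀ S : Set V, ∀ a ∈ S, ∀ b ∉ S, ∃ x ∈ S, ∃ y ∉ S, s(x, y) ∈ M) :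
    ∃ l : List V, l.Nodup ∧ (∀ x, x ∈ l) ∧ tourLength I.dist l ≤ (M.map I.w).sum := by
  obtain ⟨v, p, hp, hsupp⟩ := hM.exists_spanning_walk hconn
  obtain ⟨l, hl, hnd, hmem⟩ := exists_sublist_transversal id p.support
  rw [List.map_id] at hnd
  refine ⟨l, hnd, fun x => by simpa using hmem x (hsupp x), ?_⟩
  refine (tourLength_sublist I hl).trans ?_
  rw [walk_tourLength]
  obtain ⟨m, hm⟩ := Multiset.le_iff_exists_add.1 hp
  rw [hm, Multiset.map_add, Multiset.sum_add, Multiset.map_coe, Multiset.sum_coe]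
  refine le_add_of_nonneg_right (Multiset.sum_nonneg fun x hx => ?_)
  obtain ⟨e, he, rfl⟩ := Multiset.mem_map.1 hx
  have h1 := hM.not_isDiag e (by rw [hm]; exact Multiset.mem_add.2 (Or.inr he))
  exact I.edge_nonneg (H := ⊤) (by simpa using h1)

end Shortcut

/-! ### From even connected multigraphs to Hamiltonian cycles. -/

section Tour
variable {V : Type*} [Fintype V]

lemma weight_le_of_edges (I : MetricInstance V) {H : SimpleGraph V} {l : List (Sym2 V)}
    (h : ∀ e ∈ H.edgeSet, e ∈ l) (hl : ∀ e ∈ l, 0 ≤ I.w e) :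
    I.weight H ≤ (l.map I.w).sum := by
  have h1 : H.edgeFinset.val ≤ (l : Multiset (Sym2 V)) := by
    rw [Multiset.le_iff_subset H.edgeFinset.nodup]
    intro e he
    exact h e (by simpa using he)
  obtain ⟨m, hm⟩ := Multiset.le_iff_exists_add.1 h1
  have h2 : (l.map I.w).sum = ((l : Multiset (Sym2 V)).map I.w).sum := by simp
  rw [h2, hm, Multiset.map_add, Multiset.sum_add, MetricInstance.weight]
  have h3 : 0 ≤ (m.map I.w).sum := by
    refine Multiset.sum_nonneg fun x hx => ?_
    obtain ⟨e, he, rfl⟩ := Multiset.mem_map.1 hx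
    refine hl e ?_
    have : e ∈ (l : Multiset (Sym2 V)) := by rw [hm]; exact Multiset.mem_add.2 (Or.inr he)
    simpa using this
  exact le_add_of_nonneg_right h3

lemma exists_TSP_of_list (I : MetricInstance V) (hV : 3 ≤ Fintype.card V) {l : List V}
    (hl : l.Nodup) (hmem : ∀ x, x ∈ l) :
    ∃ H, TSP V H ∧ I.weight H ≤ tourLength I.dist l := by
  have hlen : l.length = Fintype.card V := by
    rw [← List.toFinset_card_of_nodup hl, ← Finset.card_univ]
    congr 1
    ext x
    simp [hmem]
  cases l with
  | nil => simp at hlen; omega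
  | cons x t =>
    obtain ⟨z, q, hq, hlq⟩ := exists_walk_of_list I x t hl
    have hpath : q.IsPath := by
      rw [SimpleGraph.Walk.isPath_def, hq]
      exact hl
    have hqlen : q.length + 1 = Fintype.card V := by
      rw [← hlen, ← hq, SimpleGraph.Walk.length_support]
    have hzx : z ≠ x := by
      rintro rfl
      rw [SimpleGraph.Walk.isPath_iff_nil, ← SimpleGraph.Walk.length_eq_zero_iff] at hpath
      omega
    -- Here three vertices are needed: on a path from `x` to `z` the edge `{x, z}` can only be the
    -- first one, and then the path has just two vertices.
    have hnot : s(z, x) ∉ q.edges := by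
      intro hmem
      cases q with
      | nil => exact hzx rfl
      | cons h q =>
        rw [SimpleGraph.Walk.cons_isPath_iff] at hpath
        rw [SimpleGraph.Walk.edges_cons, List.mem_cons] at hmem
        rcases hmem with h1 | h1
        · rw [Sym2.eq_iff] at h1
          rcases h1 with ⟨rfl, -⟩ | ⟨rfl, -⟩
          · exact hzx rfl
          · rw [SimpleGraph.Walk.isPath_iff_nil, ← SimpleGraph.Walk.length_eq_zero_iff] at hpath
            rw [SimpleGraph.Walk.length_cons, hpath.1] at hqlen
            omega
        · exact hpath.2 (q.snd_mem_support_of_mem_edges h1)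
    let c : CWalk z z := SimpleGraph.Walk.cons (by simpa using hzx) q
    have hc : c.IsCycle := (SimpleGraph.Walk.cons_isCycle_iff _ _).2 ⟨hpath, hnot⟩
    let H : SimpleGraph V := SimpleGraph.fromEdgeSet {e | e ∈ c.edges}
    have hcH : ∀ e ∈ c.edges, e ∈ H.edgeSet := by
      intro e he
      rw [SimpleGraph.edgeSet_fromEdgeSet]
      exact ⟨he, SimpleGraph.not_isDiag_of_mem_edgeSet _ (c.edges_subset_edgeSet he)⟩
    have hHc : ∀ e ∈ H.edgeSet, e ∈ c.edges := by
      intro e he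
      rw [SimpleGraph.edgeSet_fromEdgeSet] at he
      exact he.1
    refine ⟨H, ⟨z, c.transfer H hcH, ?_, fun e he => ?_⟩, ?_⟩
    · rw [SimpleGraph.Walk.isHamiltonianCycle_iff_isCycle_and_length_eq]
      refine ⟨hc.transfer hcH, ?_⟩
      rw [SimpleGraph.Walk.length_transfer, SimpleGraph.Walk.length_cons, hqlen]
    · rw [SimpleGraph.Walk.edges_transfer]
      exact hHc e he
    · refine (weight_le_of_edges I hHc fun e he => I.edge_nonneg (hcH e he)).trans ?_
      rw [tourLength, hlq, I.dist_of_ne hzx]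
      simp only [c, SimpleGraph.Walk.edges_cons, List.map_cons, List.sum_cons]
      linarith

lemma EvenEdges.exists_TSP (I : MetricInstance V) (hV : 3 ≤ Fintype.card V)
    {M : Multiset (Sym2 V)} (hM : EvenEdges M)
    (hconn : ∀ S : Set V, ∀ a ∈ S, ∀ b ∉ S, ∃ x ∈ S, ∃ y ∉ S, s(x, y) ∈ M) :
    ∃ H, TSP V H ∧ I.weight H ≤ (M.map I.w).sum := by
  have : Nonempty V := Fintype.card_pos_iff.1 (by omega)
  obtain ⟨l, h1, h2, h3⟩ := hM.exists_tour I hconn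
  obtain ⟨H, hH, hle⟩ := exists_TSP_of_list I hV h1 h2
  exact ⟨H, hH, hle.trans h3⟩

lemma countP_edgeFinset {d : ℕ} {H : SimpleGraph V} (hH : Factor d V H) (x : V) :
    H.edgeFinset.val.countP (x ∈ ·) = d := by
  have h1 : H.degree x = d := hH x
  rw [← h1, Multiset.countP_eq_card_filter, ← SimpleGraph.card_incidenceFinset_eq_degree,
    SimpleGraph.incidenceFinset_eq_filter]
  rfl

lemma not_isDiag_edgeFinset {H : SimpleGraph V} (e : Sym2 V) (he : e ∈ H.edgeFinset.val) :
    ¬ e.IsDiag :=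
  H.not_isDiag_of_mem_edgeSet (by simpa using he)

lemma connected_edgeFinset {H : SimpleGraph V} (hH : H.Connected) (S : Set V) (a : V) (ha : a ∈ S)
    (b : V) (hb : b ∉ S) : ∃ x ∈ S, ∃ y ∉ S, s(x, y) ∈ H.edgeFinset.val := by
  obtain ⟨x, hx, y, hy, h⟩ := cut_pos_iff.1 (cut_pos_of_connected hH ha hb)
  exact ⟨x, hx, y, hy, by simpa using h⟩

lemma EvenEdges.two_nsmul {H : SimpleGraph V} : EvenEdges (2 • H.edgeFinset.val) :=
  ⟨fun e he => not_isDiag_edgeFinset e (Multiset.mem_of_mem_nsmul he), fun x => by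
    rw [Multiset.countP_nsmul]; exact even_two_mul _⟩

lemma RCS.three_le_card {d : ℕ} {H : SimpleGraph V} (hH : RCS d V H) (hd : 2 ≤ d) :
    3 ≤ Fintype.card V := by
  obtain ⟨x⟩ := hH.2.nonempty
  have := hH.1.lt_card x
  omega

/-- A tour of at most twice the weight of a connected graph. -/
lemma exists_tour_two_mul (I : MetricInstance V) {H : SimpleGraph V} (hH : H.Connected) :
    ∃ l : List V, l.Nodup ∧ (∀ x, x ∈ l) ∧ tourLength I.dist l ≤ 2 * I.weight H := by
  have := hH.nonempty
  obtain ⟨l, h1, h2, h3⟩ := EvenEdges.two_nsmul.exists_tour I (M := 2 • H.edgeFinset.val)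
    fun S a ha b hb => by
      obtain ⟨x, hx, y, hy, h⟩ := connected_edgeFinset hH S a ha b hb
      exact ⟨x, hx, y, hy, (Multiset.mem_nsmul_of_ne_zero two_ne_zero).2 h⟩
  refine ⟨l, h1, h2, h3.trans_eq ?_⟩
  rw [Multiset.map_nsmul, Multiset.sum_nsmul, MetricInstance.weight, Finset.sum, nsmul_eq_mul]
  simp

end Tour

/-- A connected factor of even degree is already Eulerian. -/
theorem TSP_le_RCS_even {d : ℕ} (hd : Even d) (h2 : 2 ≤ d) : BoundedBy TSP (RCS d) 1 := by
  refine boundedBy_of fun V _ I H hH => ?_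
  obtain ⟨H', h1, h2⟩ := EvenEdges.exists_TSP I (RCS.three_le_card hH h2)
    ⟨not_isDiag_edgeFinset, fun x => by rw [countP_edgeFinset hH.1]; exact hd⟩
    (connected_edgeFinset hH.2)
  exact ⟨H', h1, h2.trans_eq (by rw [one_mul]; rfl)⟩

/-- Doubling all edges makes every degree even; the degree bound only ensures three vertices. -/
theorem TSP_le_two_mul_RCS {d : ℕ} (h2 : 2 ≤ d) : BoundedBy TSP (RCS d) 2 := by
  refine boundedBy_of fun V _ I H hH => ?_
  obtain ⟨l, h1, h2', h3⟩ := exists_tour_two_mul I hH.2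
  obtain ⟨H', hH', hle⟩ := exists_TSP_of_list I (RCS.three_le_card hH h2) h1 h2'
  exact ⟨H', hH', hle.trans h3⟩

/-! ### Balanced orientations of even multigraphs. -/

section Orientation
variable {V : Type*}

/-- How often a walk uses the arc from `x` to `y`. -/
noncomputable def arcCount {G : SimpleGraph V} {u v : V} (p : G.Walk u v) (x y : V) : ℕ :=
  p.darts.countP fun d => d.fst = x ∧ d.snd = y

lemma arcCount_add {G : SimpleGraph V} {u v : V} (p : G.Walk u v) {x y : V} (hxy : x ≠ y) :
    arcCount p x y + arcCount p y x = p.edges.count s(x, y) := by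
  induction p with
  | nil => simp [arcCount]
  | @cons a b c h p ih =>
    have h' : a ≠ b := h.ne
    simp only [arcCount, SimpleGraph.Walk.darts_cons, List.countP_cons,
      SimpleGraph.Walk.edges_cons, List.count_cons] at ih ⊢
    rw [← ih]
    by_cases h1 : a = x <;> by_cases h2 : b = y <;> by_cases h3 : a = y <;> by_cases h4 : b = x <;>
      simp_all <;> omega

lemma arcCount_sum [Fintype V] {G : SimpleGraph V} {u v : V} (p : G.Walk u v) (x : V) :
    (∑ y, arcCount p x y) + (if x = v then 1 else 0) =
      (∑ y, arcCount p y x) + if x = u then 1 else 0 := by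
  induction p with
  | nil => simp [arcCount]
  | @cons a b c h p ih =>
    have h' : a ≠ b := h.ne
    simp only [arcCount, SimpleGraph.Walk.darts_cons, List.countP_cons,
      Finset.sum_add_distrib] at ih ⊢
    have e1 : (∑ y, if decide (a = x ∧ b = y) = true then 1 else 0) = if x = a then 1 else 0 := by
      by_cases h1 : x = a <;> simp [h1, eq_comm]
    have e2 : (∑ y, if decide (a = y ∧ b = x) = true then 1 else 0) = if x = b then 1 else 0 := by
      by_cases h1 : x = b <;> simp [h1, eq_comm]
    rw [e1, e2]
    omega

/-- Orient each closed walk of a decomposition in its direction of travel: a closed walk enters each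
vertex as often as it leaves it. -/
lemma EvenEdges.exists_orientation [Fintype V] {M : Multiset (Sym2 V)} (hM : EvenEdges M) :
    ∃ A : V → V → ℕ, (∀ x y, x ≠ y → A x y + A y x = M.count s(x, y)) ∧
      ∀ x, ∑ y, A x y = ∑ y, A y x := by
  obtain ⟨L, rfl⟩ := hM.exists_decomposition
  clear hM
  induction L with
  | nil => exact ⟨0, by simp, by simp⟩
  | cons p L ih =>
    obtain ⟨A, h1, h2⟩ := ih
    refine ⟨fun x y => arcCount p.2 x y + A x y, fun x y hxy => ?_, fun x => ?_⟩
    · rw [List.map_cons, List.sum_cons, Multiset.count_add, ← h1 x y hxy, Multiset.coe_count,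
        ← arcCount_add p.2 hxy]
      dsimp only
      omega
    · have := arcCount_sum p.2 x
      simp only [Finset.sum_add_distrib, h2]
      omega

end Orientation

/-! ### Petersen's theorem through Birkhoff's theorem. -/

section TwoFactor
variable {V : Type*} [Fintype V]

/-- A permutation in the support of a doubly stochastic matrix of at least average value. -/
lemma exists_perm_of_doublyStochastic {P : Matrix V V ℝ} (hP : P ∈ doublyStochastic ℝ V)
    (c : V → V → ℝ) :
    ∃ σ : Equiv.Perm V, (∀ x, 0 < P x (σ x)) ∧ ∑ x, ∑ y, P x y * c x y ≤ ∑ x, c x (σ x) := by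
  obtain ⟨w, hw0, hw1, hwP⟩ := exists_eq_sum_perm_of_mem_doublyStochastic hP
  have hentry : ∀ x y, P x y = ∑ σ, w σ * if σ x = y then 1 else 0 := by
    intro x y
    rw [← hwP, Matrix.sum_apply]
    refine Finset.sum_congr rfl fun σ _ => ?_
    rw [Matrix.smul_apply, smul_eq_mul, Equiv.Perm.permMatrix, PEquiv.toMatrix_apply]
    simp [Equiv.toPEquiv_apply, eq_comm]
  -- The value of `P` is the average of the values of the permutations in its Birkhoff
  -- decomposition, so one of positive weight reaches it.
  have hval : ∑ x, ∑ y, P x y * c x y = ∑ σ, w σ * ∑ x, c x (σ x) := by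
    simp_rw [hentry, Finset.sum_mul, Finset.mul_sum]
    rw [Finset.sum_congr rfl fun x _ => Finset.sum_comm, Finset.sum_comm]
    refine Finset.sum_congr rfl fun σ _ => Finset.sum_congr rfl fun x _ => ?_
    rw [Finset.sum_eq_single (σ x)]
    · simp
    · intro y _ hy
      simp [hy.symm]
    · simp
  have hex : ∃ σ, 0 < w σ ∧ ∑ x, ∑ y, P x y * c x y ≤ ∑ x, c x (σ x) := by
    by_contra! hcon
    have hpos : ∃ σ, 0 < w σ := by
      by_contra! h
      have : ∑ σ, w σ ≤ 0 := Finset.sum_nonpos fun σ _ => h σ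
      linarith
    obtain ⟨τ, hτ⟩ := hpos
    have : ∑ σ, w σ * ∑ x, c x (σ x) < ∑ σ, w σ * ∑ x, ∑ y, P x y * c x y := by
      refine Finset.sum_lt_sum (fun σ _ => ?_) ⟨τ, mem_univ _, ?_⟩
      · rcases (hw0 σ).eq_or_lt with h | h
        · rw [← h]; simp
        · exact mul_le_mul_of_nonneg_left (hcon σ h).le (hw0 σ)
      · exact mul_lt_mul_of_pos_left (hcon τ hτ) hτ
    rw [← hval, ← Finset.sum_mul, hw1, one_mul] at this
    exact lt_irrefl _ this
  obtain ⟨σ, hσ, hle⟩ := hex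
  refine ⟨σ, fun x => ?_, hle⟩
  rw [hentry]
  refine Finset.sum_pos' (fun τ _ => mul_nonneg (hw0 τ) (by split_ifs <;> norm_num))
    ⟨σ, mem_univ _, by simpa using hσ⟩

/-- **Petersen's 2-factor theorem**, weighted version. -/
lemma Factor.exists_two_factor {d : ℕ} (hd : Even d) (hpos : 0 < d) {H : SimpleGraph V}
    (hH : Factor d V H) (I : MetricInstance V) :
    ∃ M, M ≤ H ∧ Factor 2 V M ∧ (2 / d : ℝ) * I.weight H ≤ I.weight M := by
  obtain ⟨A, hA, hbal⟩ := EvenEdges.exists_orientation (M := H.edgeFinset.val)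
    ⟨not_isDiag_edgeFinset, fun x => by rw [countP_edgeFinset hH]; exact hd⟩
  have hcount : ∀ x y, H.edgeFinset.val.count s(x, y) = if H.Adj x y then 1 else 0 := by
    intro x y
    rw [Multiset.count_eq_of_nodup H.edgeFinset.nodup]
    simp
  -- The orientation is not controlled on the diagonal, so the diagonal is erased. Each vertex then
  -- has `d / 2` outgoing and `d / 2` incoming arcs, and scaling by `2 / d` gives a doubly
  -- stochastic matrix.
  let B : V → V → ℕ := fun x y => if x = y then 0 else A x y
  have hB : ∀ x y, B x y + B y x = if H.Adj x y then 1 else 0 := by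
    intro x y
    by_cases hxy : x = y
    · subst hxy
      simp [B]
    · simp only [B, hxy, Ne.symm hxy, if_false]
      rw [hA x y hxy, hcount]
  have hBA : ∀ x y, A x y = B x y + if x = y then A x x else 0 := by
    intro x y
    by_cases hxy : x = y <;> simp [B, hxy]
  have hBbal : ∀ x, ∑ y, B x y = ∑ y, B y x := by
    intro x
    have := hbal x
    rw [Finset.sum_congr rfl fun y _ => hBA x y, Finset.sum_congr rfl fun y _ => hBA y x,
      Finset.sum_add_distrib, Finset.sum_add_distrib] at this
    simp only [Finset.sum_ite_eq, Finset.sum_ite_eq', mem_univ, if_true] at this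
    omega
  have hBsum : ∀ x, 2 * ∑ y, B x y = d := by
    intro x
    rw [two_mul]
    nth_rw 2 [hBbal]
    rw [← Finset.sum_add_distrib, ← factor_iff.1 hH x]
    exact Finset.sum_congr rfl fun y _ => hB x y
  have hd0 : (0 : ℝ) < d := by exact_mod_cast hpos
  let P : Matrix V V ℝ := fun x y => 2 / d * B x y
  have hrow : ∀ x, ∑ y, P x y = 1 := by
    intro x
    have : (2 : ℝ) * ∑ y, (B x y : ℝ) = d := by exact_mod_cast hBsum x
    simp only [P, ← Finset.mul_sum]
    field_simp
    linarith
  have hcol : ∀ x, ∑ y, P y x = 1 := by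
    intro x
    have h2 : ∑ y, (B y x : ℝ) = ∑ y, (B x y : ℝ) := by exact_mod_cast (hBbal x).symm
    rw [← hrow x]
    simp only [P, ← Finset.mul_sum, h2]
  have hP : P ∈ doublyStochastic ℝ V := by
    rw [mem_doublyStochastic_iff_sum]
    exact ⟨fun x y => by positivity, hrow, hcol⟩
  obtain ⟨σ, hσ, hle⟩ := exists_perm_of_doublyStochastic hP fun x y => I.w s(x, y)
  have hBpos : ∀ x, 0 < B x (σ x) := by
    intro x
    by_contra h
    have h0 : B x (σ x) = 0 := by omega
    have := hσ x
    simp [P, h0] at this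
  have hadj : ∀ x, H.Adj x (σ x) := by
    intro x
    by_contra h
    have := hB x (σ x)
    rw [if_neg h] at this
    have := hBpos x
    omega
  -- Each edge is oriented in one direction only, so the permutation has no 2-cycles and its arcs
  -- form a simple 2-regular graph.
  have hanti : ∀ x, σ (σ x) ≠ x := by
    intro x h
    have h1 := hB x (σ x)
    rw [if_pos (hadj x)] at h1
    have h2 := hBpos x
    have h3 := hBpos (σ x)
    rw [h] at h3
    omega
  obtain ⟨M, hM⟩ : ∃ M : SimpleGraph V, ∀ x y, M.Adj x y ↔ σ x = y ∨ σ y = x :=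
    ⟨SimpleGraph.mk (fun x y => σ x = y ∨ σ y = x) ⟨fun x y h => h.symm⟩
      ⟨fun x h => (hadj x).ne (by rcases h with h | h <;> exact h.symm)⟩, fun x y => Iff.rfl⟩
  have hind : ∀ x y (r : ℝ), (if M.Adj x y then r else 0) =
      (if σ x = y then r else 0) + if σ.symm x = y then r else 0 := by
    intro x y r
    have e : (σ.symm x = y) ↔ σ y = x := by rw [Equiv.symm_apply_eq, eq_comm]
    have : ¬ (σ x = y ∧ σ y = x) := by
      rintro ⟨rfl, h⟩
      exact hanti x h
    simp only [e, hM]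
    by_cases h1 : σ x = y <;> by_cases h2 : σ y = x
    · exact absurd ⟨h1, h2⟩ this
    · rw [if_pos (Or.inl h1), if_pos h1, if_neg h2, add_zero]
    · rw [if_pos (Or.inr h2), if_neg h1, if_pos h2, zero_add]
    · rw [if_neg (not_or.2 ⟨h1, h2⟩), if_neg h1, if_neg h2, add_zero]
  refine ⟨M, ?_, ?_, ?_⟩
  · intro x y hxy
    rcases (hM x y).1 hxy with h | h
    · exact h ▸ hadj x
    · exact h ▸ (hadj y).symm
  · rw [factor_iff]
    intro x
    have : (∑ y, if M.Adj x y then (1 : ℝ) else 0) = 2 := by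
      simp_rw [hind, Finset.sum_add_distrib]
      simp
      norm_num
    exact_mod_cast this
  · rw [weight_eq_pairSum I M, pairSum]
    simp_rw [hind, Finset.sum_add_distrib]
    simp only [Finset.sum_ite_eq, mem_univ, if_true]
    have h1 : ∑ x, I.w s(x, σ.symm x) = ∑ x, I.w s(x, σ x) := by
      rw [← Equiv.sum_comp σ]
      refine Finset.sum_congr rfl fun x _ => ?_
      rw [Equiv.symm_apply_apply, Sym2.eq_swap]
    have h2 : ∑ x, ∑ y, P x y * I.w s(x, y) = 2 / d * I.weight H := by
      have h3 : ∑ x, ∑ y, (B x y : ℝ) * I.w s(x, y) = ∑ x, ∑ y, (B y x : ℝ) * I.w s(x, y) := by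
        rw [Finset.sum_comm]
        refine Finset.sum_congr rfl fun x _ => Finset.sum_congr rfl fun y _ => ?_
        rw [Sym2.eq_swap]
      have h4 : pairSum H (fun x y => I.w s(x, y)) =
          ∑ x, ∑ y, (B x y : ℝ) * I.w s(x, y) + ∑ x, ∑ y, (B y x : ℝ) * I.w s(x, y) := by
        rw [pairSum, ← Finset.sum_add_distrib]
        refine Finset.sum_congr rfl fun x _ => ?_
        rw [← Finset.sum_add_distrib]
        refine Finset.sum_congr rfl fun y _ => ?_
        rw [← add_mul, ← Nat.cast_add, hB]
        split_ifs <;> simp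
      rw [weight_eq_pairSum, h4, ← h3]
      simp only [P, mul_assoc, ← Finset.mul_sum]
      ring
    rw [h1]
    linarith

lemma Factor.sdiff {d k : ℕ} {H M : SimpleGraph V} (hH : Factor d V H) (hM : Factor k V M)
    (hle : M ≤ H) : Factor (d - k) V (H \ M) := by
  rw [factor_iff] at *
  intro x
  have hadj : ∀ x y, (H \ M).Adj x y ↔ H.Adj x y ∧ ¬ M.Adj x y := fun _ _ => Iff.rfl
  generalize H \ M = K at hadj ⊢
  have : (∑ y, if K.Adj x y then 1 else 0) + (∑ y, if M.Adj x y then 1 else 0) =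
      ∑ y, if H.Adj x y then 1 else 0 := by
    rw [← Finset.sum_add_distrib]
    refine Finset.sum_congr rfl fun y _ => ?_
    have := @hle x y
    by_cases h1 : H.Adj x y <;> by_cases h2 : M.Adj x y <;> simp_all
  rw [hH, hM] at this
  omega

lemma weight_sdiff (I : MetricInstance V) {H M : SimpleGraph V} (hle : M ≤ H) :
    I.weight (H \ M) + I.weight M = I.weight H := by
  simp only [weight_eq_pairSum, ← mul_add, pairSum, ← Finset.sum_add_distrib]
  congr 1
  refine Finset.sum_congr rfl fun x _ => Finset.sum_congr rfl fun y _ => ?_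
  have := @hle x y
  by_cases h1 : H.Adj x y <;> by_cases h2 : M.Adj x y <;> simp_all

end TwoFactor

/-- Remove a 2-factor that carries at least the average share `2 / d` of the weight. -/
theorem Factor_sub_two_le {d : ℕ} (hd : Even d) (h4 : 4 ≤ d) :
    BoundedBy (Factor (d - 2)) (Factor d) (((d : ℝ) - 2) / d) := by
  refine boundedBy_of fun V _ I H hH => ?_
  obtain ⟨M, hle, hM, hw⟩ := hH.exists_two_factor hd (by omega) I
  refine ⟨H \ M, hH.sdiff hM hle, ?_⟩
  have := weight_sdiff I hle
  have hd0 : (d : ℝ) ≠ 0 := by positivity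
  have e : ((d : ℝ) - 2) / d = 1 - 2 / d := by field_simp
  rw [e]
  linarith

/-! ### Exchanging edges along a cyclic list. -/

section Swap
variable {V : Type*}

lemma pairSum_eq_sum_filter [Fintype V] {R : Type*} [AddCommMonoid R] (H : SimpleGraph V) (φ : V → V → R) :
    pairSum H φ = ∑ p ∈ univ.filter (fun p : V × V => H.Adj p.1 p.2), φ p.1 p.2 := by
  rw [pairSum, ← Finset.sum_product', Finset.sum_filter]
  rfl

lemma sum_image_symm {R : Type*} [AddCommMonoid R] (U : Finset V) (f g : V → V)
    (h : ∀ u ∈ U, ∀ v ∈ U, s(f u, g u) = s(f v, g v) → u = v) (hne : ∀ u ∈ U, f u ≠ g u)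
    (φ : V → V → R) :
    ∑ p ∈ U.image (fun u => (f u, g u)) ∪ U.image (fun u => (g u, f u)), φ p.1 p.2 =
      ∑ u ∈ U, (φ (f u) (g u) + φ (g u) (f u)) := by
  rw [Finset.sum_union, Finset.sum_image, Finset.sum_image, Finset.sum_add_distrib]
  · intro u hu v hv huv
    refine h u hu v hv ?_
    simp only [Prod.mk.injEq] at huv
    rw [huv.1, huv.2]
  · intro u hu v hv huv
    refine h u hu v hv ?_
    simp only [Prod.mk.injEq] at huv
    rw [huv.1, huv.2]
  · rw [Finset.disjoint_left]
    rintro ⟨x, y⟩ h1 h2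
    simp only [Finset.mem_image, Prod.mk.injEq] at h1 h2
    obtain ⟨u, hu, rfl, rfl⟩ := h1
    obtain ⟨v, hv, h3, h4⟩ := h2
    have : u = v := h u hu v hv (by rw [← h3, ← h4, Sym2.eq_swap])
    subst this
    exact hne _ hu h4

variable [Fintype V]

/-- Replacing the edges `{f u, g u}` by `{f' u, g' u}`. -/
lemma exists_exchange (F : SimpleGraph V) (U : Finset V) (f g f' g' : V → V)
    (h : ∀ u ∈ U, ∀ v ∈ U, s(f u, g u) = s(f v, g v) → u = v)
    (hadj : ∀ u ∈ U, F.Adj (f u) (g u))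
    (h' : ∀ u ∈ U, ∀ v ∈ U, s(f' u, g' u) = s(f' v, g' v) → u = v)
    (hne' : ∀ u ∈ U, f' u ≠ g' u) (hadj' : ∀ u ∈ U, ¬ F.Adj (f' u) (g' u)) :
    ∃ H : SimpleGraph V, ∀ φ : V → V → ℝ,
      pairSum H φ + ∑ u ∈ U, (φ (f u) (g u) + φ (g u) (f u)) =
        pairSum F φ + ∑ u ∈ U, (φ (f' u) (g' u) + φ (g' u) (f' u)) := by
  set Rm : Finset (V × V) := U.image (fun u => (f u, g u)) ∪ U.image (fun u => (g u, f u)) with hRm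
  set Ad : Finset (V × V) :=
    U.image (fun u => (f' u, g' u)) ∪ U.image (fun u => (g' u, f' u)) with hAd
  have hsymm : ∀ (f g : V → V) x y,
      (x, y) ∈ U.image (fun u => (f u, g u)) ∪ U.image (fun u => (g u, f u)) →
      (y, x) ∈ U.image (fun u => (f u, g u)) ∪ U.image (fun u => (g u, f u)) := by
    intro f g x y hxy
    simp only [mem_union, Finset.mem_image, Prod.mk.injEq] at hxy ⊢
    rcases hxy with ⟨u, hu, h1, h2⟩ | ⟨u, hu, h1, h2⟩
    · exact Or.inr ⟨u, hu, h2, h1⟩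
    · exact Or.inl ⟨u, hu, h2, h1⟩
  obtain ⟨H, hH⟩ : ∃ H : SimpleGraph V, ∀ x y, H.Adj x y ↔
      (F.Adj x y ∧ (x, y) ∉ Rm) ∨ (x, y) ∈ Ad := by
    refine ⟨SimpleGraph.mk (fun x y => (F.Adj x y ∧ (x, y) ∉ Rm) ∨ (x, y) ∈ Ad) ⟨?_⟩ ⟨?_⟩,
      fun x y => Iff.rfl⟩
    · rintro x y (⟨h1, h2⟩ | h1)
      · exact Or.inl ⟨h1.symm, fun h3 => h2 (hsymm _ _ _ _ h3)⟩
      · exact Or.inr (hsymm _ _ _ _ h1)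
    · rintro x (⟨h1, h2⟩ | h1)
      · exact F.irrefl h1
      · simp only [hAd, mem_union, Finset.mem_image, Prod.mk.injEq] at h1
        rcases h1 with ⟨u, hu, h1, h2⟩ | ⟨u, hu, h1, h2⟩
        · exact hne' u hu (h1.trans h2.symm)
        · exact hne' u hu (h2.trans h1.symm)
  -- The identity is proved for arbitrary `φ`, so that it yields degrees, weight and cuts of the new
  -- graph at once.
  refine ⟨H, fun φ => ?_⟩
  have hRF : Rm ⊆ univ.filter (fun p : V × V => F.Adj p.1 p.2) := by
    rintro ⟨x, y⟩ hxy
    simp only [hRm, mem_union, Finset.mem_image, Prod.mk.injEq] at hxy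
    rw [mem_filter]
    refine ⟨mem_univ _, ?_⟩
    rcases hxy with ⟨u, hu, rfl, rfl⟩ | ⟨u, hu, rfl, rfl⟩
    · exact hadj u hu
    · exact (hadj u hu).symm
  have hAF : Disjoint (univ.filter (fun p : V × V => F.Adj p.1 p.2) \ Rm) Ad := by
    rw [Finset.disjoint_left]
    rintro ⟨x, y⟩ h1 hxy
    have h2 : F.Adj x y := (mem_filter.1 (mem_sdiff.1 h1).1).2
    simp only [hAd, mem_union, Finset.mem_image, Prod.mk.injEq] at hxy
    rcases hxy with ⟨u, hu, rfl, rfl⟩ | ⟨u, hu, rfl, rfl⟩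
    · exact hadj' u hu h2
    · exact hadj' u hu h2.symm
  have hHF : univ.filter (fun p : V × V => H.Adj p.1 p.2) =
      (univ.filter (fun p : V × V => F.Adj p.1 p.2) \ Rm) ∪ Ad := by
    ext ⟨x, y⟩
    simp only [mem_filter, mem_univ, true_and, hH, mem_union, mem_sdiff]
  rw [pairSum_eq_sum_filter, pairSum_eq_sum_filter, hHF, Finset.sum_union hAF,
    ← Finset.sum_sdiff hRF, ← sum_image_symm U f g h (fun u hu => (hadj u hu).ne),
    ← sum_image_symm U f' g' h' hne']
  ring

lemma degree_eq_pairSum (H : SimpleGraph V) (v : V) :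
    ((∑ y, if H.Adj v y then 1 else 0 : ℕ) : ℝ) = pairSum H fun x _ => if x = v then 1 else 0 := by
  rw [pairSum]
  symm
  rw [Finset.sum_eq_single v]
  · push_cast
    simp
  · intro x _ hx
    simp [hx]
  · simp

/-- The cyclic exchange along a list `l` of vertices with distinct labels: the edges `{u, b u}`
with `u` in `l` are replaced by the edges from `b u` to the successor of `u` in `l`. -/
lemma exists_cyclic_exchange {β : Type*} (I : MetricInstance V) (F : SimpleGraph V) (l : List V)
    (b : V → V) (lab : V → β) (hlab : ∀ u ∈ l, ∀ v ∈ l, lab u = lab v → u = v) (hl : l.Nodup)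
    (hb : ∀ u ∈ l, lab (b u) = lab u) (hadj : ∀ u ∈ l, F.Adj u (b u))
    (hnadj : ∀ u ∈ l, ∀ v ∈ l, u ≠ v → ¬ F.Adj (b u) v) (h2 : 2 ≤ l.length)
    (hcut : ∀ u ∈ l, ∀ S : Set V, ¬ (u ∈ S ↔ b u ∈ S) →
      2 ≤ ((cutPairs F S).filter fun p => lab p.1 = lab u ∧ lab p.2 = lab u).card) :
    ∃ H : SimpleGraph V, (∀ d, Factor d V F → Factor d V H) ∧
      I.weight H ≤ I.weight F + tourLength I.dist l ∧
      ∀ S : Set V, 2 ≤ cut H S ∨ (cut H S = cut F S ∧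
        ∀ u ∈ l, (u ∈ S ↔ b u ∈ S) ∧ ∀ v ∈ l, u ∈ S ↔ v ∈ S) := by
  -- The old edges `{u, b u}` and the new edges `{b u, σ u}` together trace one closed walk through
  -- all of `l`.
  set σ := l.formPerm with hσ
  have hσl : ∀ u ∈ l, σ u ∈ l := fun u hu => List.formPerm_apply_mem_of_mem hu
  have hσU : ∀ (φ : V → ℝ), ∑ u ∈ l.toFinset, φ (σ u) = ∑ u ∈ l.toFinset, φ u := by
    intro φ
    refine Finset.sum_bij (fun u _ => σ u) (fun u hu => ?_) (fun u _ v _ h => σ.injective h)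
      (fun u hu => ?_) (fun _ _ => rfl)
    · rw [List.mem_toFinset] at *
      exact hσl u hu
    · rw [List.mem_toFinset] at hu
      obtain ⟨v, hv⟩ := σ.surjective u
      refine ⟨v, ?_, hv⟩
      rw [List.mem_toFinset, ← List.formPerm_mem_iff_mem (l := l)]
      rw [hσ] at hv
      rwa [hv]
  have hσne : ∀ u ∈ l, σ u ≠ u := fun u hu =>
    (List.formPerm_apply_mem_ne_self_iff l hl u hu).2 h2
  have hbne : ∀ u ∈ l, ∀ v ∈ l, b u ≠ v := by
    intro u hu v hv h
    have h1 : u = v := hlab u hu v hv (by rw [← h, hb u hu])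
    exact (hadj u hu).ne (h1.trans h.symm)
  obtain ⟨H, hH⟩ := exists_exchange F l.toFinset id b b σ
    (by
      intro u hu v hv huv
      rw [List.mem_toFinset] at hu hv
      rw [Sym2.eq_iff] at huv
      rcases huv with ⟨h, -⟩ | ⟨h, -⟩
      · exact h
      · exact absurd h.symm (hbne v hv u hu))
    (by
      intro u hu
      exact hadj u (List.mem_toFinset.1 hu))
    (by
      intro u hu v hv huv
      rw [List.mem_toFinset] at hu hv
      rw [Sym2.eq_iff] at huv
      rcases huv with ⟨h, -⟩ | ⟨h, -⟩
      · exact hlab u hu v hv (by rw [← hb u hu, ← hb v hv, h])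
      · exact absurd h (hbne u hu _ (hσl v hv)))
    (by
      intro u hu
      rw [List.mem_toFinset] at hu
      exact hbne u hu _ (hσl u hu))
    (by
      intro u hu
      rw [List.mem_toFinset] at hu
      exact hnadj u hu _ (hσl u hu) (hσne u hu).symm)
  simp only [id] at hH
  refine ⟨H, fun d hF => ?_, ?_, fun S => ?_⟩
  · rw [factor_iff] at *
    intro v
    have h1 := hH fun x _ => if x = v then 1 else 0
    have h3 := hσU fun x => if x = v then 1 else 0
    rw [← degree_eq_pairSum, ← degree_eq_pairSum, hF, Finset.sum_add_distrib,
      Finset.sum_add_distrib, h3] at h1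
    have h4 : ((∑ y, if H.Adj v y then 1 else 0 : ℕ) : ℝ) = d := by linarith
    exact_mod_cast h4
  · have h1 := hH fun x y => I.w s(x, y)
    -- By the triangle inequality over `u`, the new edge costs at most the old edge plus the leg of
    -- the tour from `u` to `σ u`.
    have h3 : ∑ u ∈ l.toFinset, (I.w s(b u, σ u) + I.w s(σ u, b u)) ≤
        ∑ u ∈ l.toFinset, (I.w s(u, b u) + I.w s(b u, u)) +
          2 * ∑ u ∈ l.toFinset, I.dist u (σ u) := by
      rw [Finset.mul_sum, ← Finset.sum_add_distrib]
      refine Finset.sum_le_sum fun u hu => ?_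
      rw [List.mem_toFinset] at hu
      have h4 := I.dist_triangle (b u) u (σ u)
      rw [I.dist_of_ne (hbne u hu _ (hσl u hu)), I.dist_of_ne (hbne u hu u hu)] at h4
      rw [Sym2.eq_swap (a := σ u), Sym2.eq_swap (a := u)]
      linarith
    rw [← sum_formPerm I hl, weight_eq_pairSum, weight_eq_pairSum]
    linarith
  · let χ : V → ℕ := fun x => if x ∈ S then 1 else 0
    -- `R x y` is 1 exactly if `S` separates `x` and `y`; the sums of `R` count the old and the new
    -- edges crossing `S`.
    let R : V → V → ℕ := fun x y => if (x ∈ S ↔ y ∈ S) then 0 else 1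
    have hφ : ∀ x y, (if x ∈ S ∧ y ∉ S then (1 : ℝ) else 0) + (if y ∈ S ∧ x ∉ S then 1 else 0) =
        (R x y : ℝ) := by
      intro x y
      by_cases h1 : x ∈ S <;> by_cases h3 : y ∈ S <;> simp [R, h1, h3]
    have h1 := hH fun x y => if x ∈ S ∧ y ∉ S then 1 else 0
    simp only [hφ] at h1
    have hcast : ∀ G : SimpleGraph V,
        pairSum G (fun x y => if x ∈ S ∧ y ∉ S then (1 : ℝ) else 0) = cut G S := by
      intro G
      rw [cut_eq_pairSum, pairSum, pairSum]
      push_cast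
      rfl
    rw [hcast, hcast] at h1
    have h3 : cut H S + ∑ u ∈ l.toFinset, R u (b u) =
        cut F S + ∑ u ∈ l.toFinset, R (b u) (σ u) := by exact_mod_cast h1
    -- A closed walk crosses `S` an even number of times.
    have hpar : Even (∑ u ∈ l.toFinset, R u (b u) + ∑ u ∈ l.toFinset, R (b u) (σ u)) := by
      have e1 : ∀ x y, ∃ k, R x y + 2 * k = χ x + χ y := by
        intro x y
        by_cases h1 : x ∈ S <;> by_cases h3 : y ∈ S
        · exact ⟨1, by simp [R, χ, h1, h3]⟩
        · exact ⟨0, by simp [R, χ, h1, h3]⟩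
        · exact ⟨0, by simp [R, χ, h1, h3]⟩
        · exact ⟨0, by simp [R, χ, h1, h3]⟩
      choose k hk using e1
      have e2 : ∑ u ∈ l.toFinset, χ (σ u) = ∑ u ∈ l.toFinset, χ u := by
        have := hσU fun u => (χ u : ℝ)
        exact_mod_cast this
      have e3 : (∑ u ∈ l.toFinset, R u (b u) + ∑ u ∈ l.toFinset, R (b u) (σ u)) +
          2 * (∑ u ∈ l.toFinset, (k u (b u) + k (b u) (σ u))) =
          2 * (∑ u ∈ l.toFinset, (χ u + χ (b u))) := by
        have e4 : ∑ u ∈ l.toFinset, (R u (b u) + 2 * k u (b u)) =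
            ∑ u ∈ l.toFinset, (χ u + χ (b u)) := Finset.sum_congr rfl fun u _ => hk _ _
        have e5 : ∑ u ∈ l.toFinset, (R (b u) (σ u) + 2 * k (b u) (σ u)) =
            ∑ u ∈ l.toFinset, (χ (b u) + χ (σ u)) := Finset.sum_congr rfl fun u _ => hk _ _
        simp only [Finset.sum_add_distrib, ← Finset.mul_sum, e2] at e4 e5 ⊢
        omega
      have := even_two_mul (∑ u ∈ l.toFinset, (χ u + χ (b u)))
      rw [← e3, Nat.even_add] at this
      exact this.2 (even_two_mul _)
    -- Each block whose exchanged edge crosses `S` contributes two cut edges, and different labels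
    -- give disjoint contributions.
    have hlow : 2 * ∑ u ∈ l.toFinset, R u (b u) ≤ cut F S := by
      have e1 : ∑ u ∈ l.toFinset,
          ((cutPairs F S).filter fun p => lab p.1 = lab u ∧ lab p.2 = lab u).card ≤ cut F S := by
        rw [← Finset.card_biUnion]
        · refine Finset.card_le_card ?_
          intro p hp
          obtain ⟨u, -, hp⟩ := Finset.mem_biUnion.1 hp
          exact (mem_filter.1 hp).1
        · intro u hu v hv huv
          rw [Function.onFun, Finset.disjoint_left]
          intro p hp hp'
          simp only [List.coe_toFinset, Set.mem_ofPred_eq] at hu hv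
          exact huv (hlab u hu v hv ((mem_filter.1 hp).2.1.symm.trans (mem_filter.1 hp').2.1))
      refine le_trans ?_ e1
      rw [Finset.mul_sum]
      refine Finset.sum_le_sum fun u hu => ?_
      by_cases h : (u ∈ S ↔ b u ∈ S)
      · simp [R, h]
      · have := hcut u (List.mem_toFinset.1 hu) S h
        simpa [R, h] using this
    -- If `p` old and `q` new edges cross, then `cut H S = cut F S - p + q ≥ p + q`, and `p + q` is
    -- even; so it is at least 2 unless nothing crosses.
    by_cases h0 : ∑ u ∈ l.toFinset, R u (b u) + ∑ u ∈ l.toFinset, R (b u) (σ u) = 0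
    · right
      obtain ⟨h4, h5⟩ := Nat.add_eq_zero_iff.1 h0
      have h6 : ∀ u ∈ l, (u ∈ S ↔ b u ∈ S) := by
        intro u hu
        have := Finset.sum_eq_zero_iff.1 h4 u (List.mem_toFinset.2 hu)
        by_contra h
        simp [R, h] at this
      have h7 : ∀ u ∈ l, (u ∈ S ↔ σ u ∈ S) := by
        intro u hu
        have := Finset.sum_eq_zero_iff.1 h5 u (List.mem_toFinset.2 hu)
        by_contra h
        rw [h6 u hu] at h
        simp [R, h] at this
      have h8 : ∀ n : ℕ, ∀ u ∈ l, (u ∈ S ↔ (σ ^ n) u ∈ S) := by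
        intro n
        induction n with
        | zero => simp
        | succ n ih =>
          intro u hu
          rw [pow_succ, Equiv.Perm.mul_apply, ← ih _ (hσl u hu)]
          exact h7 u hu
      refine ⟨by omega, fun u hu => ⟨h6 u hu, fun v hv => ?_⟩⟩
      have hc := List.Nodup.isCycleOn_formPerm hl
      have hc' : σ.IsCycleOn (l.toFinset : Set V) := by
        convert hc using 1
        ext
        simp
      obtain ⟨n, -, hn⟩ := hc'.exists_pow_eq (List.mem_toFinset.2 hu) (List.mem_toFinset.2 hv)
      rw [← hn]
      exact h8 n u hu
    · left
      obtain ⟨m, hm⟩ := hpar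
      omega

end Swap

/-! ### Merging components in even regular graphs, and monotonicity of `RCS` for even degree. -/

section Merge
variable {V : Type*} [Fintype V]

lemma mem_iff_of_cut_eq_zero {F : SimpleGraph V} {S : Set V} (h : cut F S = 0) {u v : V}
    (huv : F.Reachable u v) : u ∈ S ↔ v ∈ S := by
  have key : ∀ {u v : V}, F.Reachable u v → u ∈ S → v ∈ S := by
    rintro u v ⟨p⟩ hu
    by_contra hv
    obtain ⟨d, -, h1, h2⟩ := p.exists_boundary_dart S hu hv
    have := cut_pos_iff.2 ⟨d.fst, h1, d.snd, h2, d.adj⟩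
    omega
  exact ⟨key huv, key huv.symm⟩

/-- In a regular graph of positive even degree, the components met by a closed tour can be merged
into one at a cost of at most the length of the tour. -/
lemma Factor.exists_merge {k : ℕ} (hk : Even k) (hpos : 0 < k) (I : MetricInstance V)
    {F : SimpleGraph V} (hF : Factor k V F) (l₀ : List V) :
    ∃ H, Factor k V H ∧ I.weight H ≤ I.weight F + tourLength I.dist l₀ ∧
      ∀ S : Set V, cut H S = 0 → cut F S = 0 ∧ ∀ u ∈ l₀, ∀ v ∈ l₀, u ∈ S ↔ v ∈ S := by
  obtain ⟨l, hsub, hnd, hmem⟩ := exists_sublist_transversal F.connectedComponentMk l₀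
  have hrep : ∀ u ∈ l₀, ∃ u' ∈ l, F.Reachable u u' := by
    intro u hu
    obtain ⟨u', hu', h⟩ := List.mem_map.1 (hmem u hu)
    exact ⟨u', hu', (SimpleGraph.ConnectedComponent.eq.1 h).symm⟩
  have hfin : ∀ S : Set V, cut F S = 0 → (∀ u ∈ l, ∀ v ∈ l, (u ∈ S ↔ v ∈ S)) →
      ∀ u ∈ l₀, ∀ v ∈ l₀, u ∈ S ↔ v ∈ S := by
    intro S h0 h u hu v hv
    obtain ⟨u', hu', h1⟩ := hrep u hu
    obtain ⟨v', hv', h2⟩ := hrep v hv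
    rw [mem_iff_of_cut_eq_zero h0 h1, mem_iff_of_cut_eq_zero h0 h2]
    exact h u' hu' v' hv'
  have htour := tourLength_sublist I hsub
  have htour0 : 0 ≤ tourLength I.dist l := by
    rw [← sum_formPerm I (List.Nodup.of_map _ hnd)]
    exact Finset.sum_nonneg fun _ _ => I.dist_nonneg _ _
  rcases lt_or_ge l.length 2 with hlen | hlen
  · refine ⟨F, hF, by linarith, fun S h0 => ⟨h0, hfin S h0 fun u hu v hv => ?_⟩⟩
    have hpos := List.length_pos_of_mem hu
    obtain ⟨z, hz⟩ := List.length_eq_one_iff.1 (by omega : l.length = 1)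
    rw [hz] at hu hv
    rw [List.mem_singleton.1 hu, List.mem_singleton.1 hv]
  choose b hb using fun u => hF.exists_adj hpos u
  have hlabb : ∀ u, F.connectedComponentMk (b u) = F.connectedComponentMk u := fun u =>
    SimpleGraph.ConnectedComponent.eq.2 (hb u).symm.reachable
  have hinj : ∀ u ∈ l, ∀ v ∈ l, F.connectedComponentMk u = F.connectedComponentMk v → u = v :=
    fun u hu v hv h => List.inj_on_of_nodup_map hnd hu hv h
  obtain ⟨H, h1, h2, h3⟩ := exists_cyclic_exchange I F l b F.connectedComponentMk hinj
    (List.Nodup.of_map _ hnd) (fun u _ => hlabb u) (fun u _ => hb u)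
    (fun u hu v hv huv h => huv (hinj u hu v hv ((hlabb u).symm.trans
      (SimpleGraph.ConnectedComponent.eq.2 h.reachable)))) hlen
    (by
      intro u hu S hS
      -- Restricting `S` to the component of `u` isolates the cut edges in that component; their
      -- number is even because the degree is even, and positive because `u` and `b u` are
      -- separated.
      let T : Set V := {x | x ∈ S ∧ F.connectedComponentMk x = F.connectedComponentMk u}
      have hT : cutPairs F T ⊆ (cutPairs F S).filter fun p =>
          F.connectedComponentMk p.1 = F.connectedComponentMk u ∧
          F.connectedComponentMk p.2 = F.connectedComponentMk u := by
        rintro ⟨x, y⟩ hxy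
        rw [mem_cutPairs] at hxy
        obtain ⟨⟨hx, hxu⟩, hy, hadj⟩ := hxy
        have hyu : F.connectedComponentMk y = F.connectedComponentMk u := by
          rw [← hxu]
          exact SimpleGraph.ConnectedComponent.eq.2 hadj.symm.reachable
        rw [mem_filter, mem_cutPairs]
        exact ⟨⟨hx, fun h => hy ⟨h, hyu⟩, hadj⟩, hxu, hyu⟩
      refine le_trans ?_ (Finset.card_le_card hT)
      have hpos : 0 < cut F T := by
        rw [cut_pos_iff]
        by_cases hu' : u ∈ S
        · exact ⟨u, ⟨hu', rfl⟩, b u, fun h => hS (by simp [hu', h.1]), hb u⟩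
        · have : b u ∈ S := by
            by_contra h
            exact hS (by simp [hu', h])
          exact ⟨b u, ⟨this, hlabb u⟩, u, fun h => hu' h.1, (hb u).symm⟩
      obtain ⟨m, hm⟩ := hF.even_cut hk T
      change 2 ≤ cut F T
      omega)
  refine ⟨H, h1 k hF, by linarith, fun S h0 => ?_⟩
  rcases h3 S with h | ⟨h, hS⟩
  · omega
  · rw [h0] at h
    exact ⟨h.symm, hfin S h.symm fun u hu v hv => (hS u hu).2 v hv⟩

/-- The walks are treated one after another; an empty cut of the last graph is an empty cut of all
earlier ones, so no earlier merging is undone. -/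
lemma Factor.exists_merge_walks {k : ℕ} (hk : Even k) (hpos : 0 < k) (I : MetricInstance V)
    (L : List (Σ v : V, CWalk v v)) {F : SimpleGraph V} (hF : Factor k V F) :
    ∃ H, Factor k V H ∧ I.weight H ≤
        I.weight F + (((L.map fun p => (p.2.edges : Multiset (Sym2 V))).sum).map I.w).sum ∧
      ∀ S : Set V, cut H S = 0 → cut F S = 0 ∧
        ∀ p ∈ L, ∀ u ∈ p.2.support, ∀ v ∈ p.2.support, u ∈ S ↔ v ∈ S := by
  induction L generalizing F with
  | nil => exact ⟨F, hF, by simp, fun S h => ⟨h, by simp⟩⟩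
  | cons p L ih =>
    obtain ⟨H₁, h1, h2, h3⟩ := hF.exists_merge hk hpos I p.2.support
    obtain ⟨H, h4, h5, h6⟩ := ih h1
    rw [walk_tourLength] at h2
    refine ⟨H, h4, ?_, fun S h0 => ?_⟩
    · rw [List.map_cons, List.sum_cons, Multiset.map_add, Multiset.sum_add, Multiset.map_coe,
        Multiset.sum_coe]
      linarith
    · obtain ⟨h7, h8⟩ := h6 S h0
      obtain ⟨h9, h10⟩ := h3 S h7
      refine ⟨h9, fun q hq => ?_⟩
      rcases List.mem_cons.1 hq with rfl | hq
      · exact h10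
      · exact h8 q hq

end Merge

/-- Delete a 2-factor `M` and exchange along the closed walks that make up `M`. This costs at most
`I.weight M` and reconnects everything that `M` connected, so the total does not exceed the original
weight. -/
theorem RCS_sub_two_le {d : ℕ} (hd : Even d) (h4 : 4 ≤ d) :
    BoundedBy (RCS (d - 2)) (RCS d) 1 := by
  refine boundedBy_of fun V _ I G hG => ?_
  have := hG.2.nonempty
  obtain ⟨M, hle, hM, -⟩ := hG.1.exists_two_factor hd (by omega) I
  obtain ⟨L, hL⟩ := EvenEdges.exists_decomposition (M := M.edgeFinset.val)
    ⟨not_isDiag_edgeFinset, fun x => by rw [countP_edgeFinset hM]; exact even_two⟩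
  obtain ⟨H, h1, h2, h3⟩ := (hG.1.sdiff hM hle).exists_merge_walks
    (hd.tsub even_two) (by omega) I L
  refine ⟨H, ⟨h1, connected_of_cut fun S a ha b hb => ?_⟩, ?_⟩
  · by_contra hcut
    obtain ⟨h4, h5⟩ := h3 S (by omega)
    obtain ⟨x, hx, y, hy, hxy⟩ := cut_pos_iff.1 (cut_pos_of_connected hG.2 ha hb)
    -- An edge of `G` leaving `S` cannot survive in `G \ M`, whose cut is empty, nor lie in `M`,
    -- since each walk of `M` stays on one side of `S`.
    by_cases hxM : M.Adj x y
    · have hmem : s(x, y) ∈ (L.map fun p => (p.2.edges : Multiset (Sym2 V))).sum := by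
        rw [hL]
        simpa using hxM
      have : ∃ p ∈ L, s(x, y) ∈ p.2.edges := by
        clear hL h5 h3 h2
        induction L with
        | nil => simp at hmem
        | cons p L ih =>
          rw [List.map_cons, List.sum_cons, Multiset.mem_add] at hmem
          rcases hmem with h | h
          · exact ⟨p, by simp, by simpa using h⟩
          · obtain ⟨q, hq, h⟩ := ih h
            exact ⟨q, List.mem_cons_of_mem _ hq, h⟩
      obtain ⟨p, hp, hpe⟩ := this
      exact hy ((h5 p hp x (p.2.fst_mem_support_of_mem_edges hpe) y
        (p.2.snd_mem_support_of_mem_edges hpe)).1 hx)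
    · have := cut_pos_iff.2 ⟨x, hx, y, hy, show (G \ M).Adj x y from ⟨hxy, hxM⟩⟩
      omega
  · rw [hL] at h2
    have := weight_sdiff I hle
    have e : (M.edgeFinset.val.map I.w).sum = I.weight M := rfl
    rw [e] at h2
    linarith

/-! ### Making a connected factor 2-edge-connected. -/

section Augment
variable {V : Type*} [Fintype V]

lemma two_mul_cut (H : SimpleGraph V) (S : Set V) :
    2 * cut H S = pairSum H fun x y => if (x ∈ S ↔ y ∈ S) then 0 else 1 := by
  rw [two_mul]
  nth_rw 2 [← cut_compl]
  rw [cut_eq_pairSum, cut_eq_pairSum, pairSum, pairSum, pairSum, ← Finset.sum_add_distrib]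
  refine Finset.sum_congr rfl fun x _ => ?_
  rw [← Finset.sum_add_distrib]
  refine Finset.sum_congr rfl fun y _ => ?_
  by_cases h1 : x ∈ S <;> by_cases h2 : y ∈ S <;> by_cases h3 : H.Adj x y <;> simp [h1, h2, h3]

/-- Posimodularity of the cut function, checked pair by pair after counting both directions. -/
lemma cut_diff_add_cut_diff_le (H : SimpleGraph V) (S T : Set V) :
    cut H (S \ T) + cut H (T \ S) ≤ cut H S + cut H T := by
  have : 2 * cut H (S \ T) + 2 * cut H (T \ S) ≤ 2 * cut H S + 2 * cut H T := by
    simp only [two_mul_cut, pairSum, ← Finset.sum_add_distrib]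
    refine Finset.sum_le_sum fun x _ => Finset.sum_le_sum fun y _ => ?_
    by_cases h1 : x ∈ S <;> by_cases h2 : y ∈ S <;> by_cases h3 : x ∈ T <;> by_cases h4 : y ∈ T <;>
      by_cases h5 : H.Adj x y <;> simp [h1, h2, h3, h4, h5]
  omega

lemma Factor.exists_adj_ne {d : ℕ} {H : SimpleGraph V} (hH : Factor d V H) (hd : 2 ≤ d)
    (x z : V) : ∃ y, H.Adj x y ∧ y ≠ z := by
  have h1 : (H.neighborFinset x).card = d := by
    rw [SimpleGraph.card_neighborFinset_eq_degree]
    exact hH x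
  obtain ⟨y, hy, hne⟩ := Finset.exists_mem_ne (by omega : 1 < (H.neighborFinset x).card) z
  exact ⟨y, by simpa using hy, hne⟩

/-- Minimal sets that are left by a single edge. -/
def IsEndBlock (H : SimpleGraph V) (L : Set V) : Prop := Minimal (fun X => cut H X = 1) L

lemma exists_isEndBlock_subset {H : SimpleGraph V} {X : Set V} (h : cut H X = 1) :
    ∃ L ⊆ X, IsEndBlock H L :=
  exists_minimal_le_of_wellFoundedLT (fun X : Set V => cut H X = 1) X h

lemma IsEndBlock.nonempty {H : SimpleGraph V} {L : Set V} (hL : IsEndBlock H L) : L.Nonempty := by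
  obtain ⟨x, hx, -⟩ := cut_pos_iff.1 (hL.prop.symm ▸ one_pos : 0 < cut H L)
  exact ⟨x, hx⟩

lemma IsEndBlock.two_le_cut {H : SimpleGraph V} (hH : H.Connected) {L X : Set V}
    (hL : IsEndBlock H L) (hX : X.Nonempty) (hXL : X ⊂ L) : 2 ≤ cut H X := by
  obtain ⟨a, ha⟩ := hX
  obtain ⟨b, -, hb⟩ := Set.exists_of_ssubset hXL
  have h1 := cut_pos_of_connected hH ha hb
  have h2 : cut H X ≠ 1 := fun h => hXL.2 (hL.2 h hXL.1)
  omega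

/-- Two different end blocks that meet would have differences that are proper nonempty subsets, each
left by at least two edges; posimodularity allows only `1 + 1` in total. -/
lemma IsEndBlock.eq_of_mem {H : SimpleGraph V} (hH : H.Connected) {L L' : Set V}
    (hL : IsEndBlock H L) (hL' : IsEndBlock H L') {x : V} (hx : x ∈ L) (hx' : x ∈ L') : L = L' := by
  by_contra hne
  have h1 : ¬ L ⊆ L' := fun h => hne (le_antisymm h (hL'.2 hL.prop h))
  have h2 : ¬ L' ⊆ L := fun h => hne (le_antisymm (hL.2 hL'.prop h) h)
  have h3 := hL.two_le_cut hH (X := L \ L') (Set.sdiff_nonempty.2 h1)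
    ⟨Set.sdiff_subset, fun h => (h hx).2 hx'⟩
  have h4 := hL'.two_le_cut hH (X := L' \ L) (Set.sdiff_nonempty.2 h2)
    ⟨Set.sdiff_subset, fun h => (h hx').2 hx⟩
  have h5 := cut_diff_add_cut_diff_le H L L'
  have h6 : cut H L = 1 := hL.prop
  have h7 : cut H L' = 1 := hL'.prop
  omega

/-- The only leaving edge starts at one vertex `z`. The block has a vertex `b ≠ z`, since otherwise
all of the at least two edges at `z` would leave. All neighbours of `b` lie in the block, so the
exchange never adds an edge that is already present. -/
lemma IsEndBlock.exists_inner_edge {d : ℕ} {H : SimpleGraph V} (hH : Factor d V H) (hd : 2 ≤ d)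
    {L : Set V} (hL : IsEndBlock H L) :
    ∃ u b, u ∈ L ∧ b ∈ L ∧ H.Adj u b ∧ ∀ v ∉ L, ¬ H.Adj b v := by
  obtain ⟨⟨z, y⟩, hz⟩ := Finset.card_eq_one.1 hL.prop
  have hzy : ∀ x v, x ∈ L → v ∉ L → H.Adj x v → x = z := by
    intro x v hx hv hxv
    have : (x, v) ∈ cutPairs H L := by simp [hx, hv, hxv]
    rw [hz, mem_singleton, Prod.mk.injEq] at this
    exact this.1
  obtain ⟨b, hb, hbz⟩ : ∃ x ∈ L, x ≠ z := by
    by_contra! h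
    obtain ⟨x, hx⟩ := hL.nonempty
    obtain rfl := h x hx
    obtain ⟨y₁, h1, -⟩ := hH.exists_adj_ne hd x x
    obtain ⟨y₂, h2, h3⟩ := hH.exists_adj_ne hd x y₁
    have hn : ∀ y, H.Adj x y → y ∉ L := fun y hy hyL => hy.ne (h y hyL).symm
    have := two_le_cut_of hx (hn _ h1) h1 hx (hn _ h2) h2 (by simpa using h3.symm)
    have h6 : cut H L = 1 := hL.prop
    omega
  obtain ⟨u, hu, -⟩ := hH.exists_adj_ne hd b z
  refine ⟨u, b, ?_, hb, hu.symm, fun v hv hbv => hbz (hzy b v hb hv hbv)⟩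
  by_contra huL
  exact hbz (hzy b u hb huL hu)

lemma IsEndBlock.two_le_inner_cut {H : SimpleGraph V} (hH : H.Connected)
    {L : Set V} (hL : IsEndBlock H L) {S : Set V} {u b : V} (hu : u ∈ L) (hb : b ∈ L)
    (hS : ¬ (u ∈ S ↔ b ∈ S)) :
    2 ≤ ((cutPairs H S).filter fun p => p.1 ∈ L ∧ p.2 ∈ L).card := by
  obtain ⟨⟨z, y⟩, hz⟩ := Finset.card_eq_one.1 hL.prop
  have hzy : ∀ x v, x ∈ L → v ∉ L → H.Adj x v → x = z := by
    intro x v hx hv hxv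
    have : (x, v) ∈ cutPairs H L := by simp [hx, hv, hxv]
    rw [hz, mem_singleton, Prod.mk.injEq] at this
    exact this.1
  have hne : (L ∩ S).Nonempty ∧ (L \ S).Nonempty := by
    by_cases h1 : u ∈ S
    · exact ⟨⟨u, hu, h1⟩, ⟨b, hb, fun h => hS (by simp [h1, h])⟩⟩
    · refine ⟨⟨b, hb, ?_⟩, ⟨u, hu, h1⟩⟩
      by_contra h
      exact hS (by simp [h1, h])
  obtain ⟨⟨p, hp, hpS⟩, ⟨q, hq, hqS⟩⟩ := hne
  -- Take the side of `S` in `L` that does not contain `z`: all edges leaving it stay in `L`, and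
  -- minimality of `L` gives two of them. If `z ∈ S`, that side is `L \ S` and the pairs are
  -- reversed.
  by_cases hzS : z ∈ S
  · have h2 := hL.two_le_cut hH (X := L \ S) ⟨q, hq, hqS⟩ ⟨Set.sdiff_subset, fun h => (h hp).2 hpS⟩
    refine h2.trans (Finset.card_le_card_of_injOn Prod.swap ?_ Prod.swap_injective.injOn)
    rintro ⟨x, v⟩ h
    rw [mem_coe, mem_cutPairs] at h
    obtain ⟨⟨hx, hxS⟩, hv, hadj⟩ := h
    have hvL : v ∈ L := by
      by_contra hvL
      exact hxS ((hzy x v hx hvL hadj) ▸ hzS)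
    have hvS : v ∈ S := by
      by_contra h
      exact hv ⟨hvL, h⟩
    simp [hx, hxS, hvL, hvS, hadj.symm]
  · have h2 := hL.two_le_cut hH (X := L ∩ S) ⟨p, hp, hpS⟩
      ⟨Set.inter_subset_left, fun h => hqS (h hq).2⟩
    refine h2.trans (Finset.card_le_card ?_)
    rintro ⟨x, v⟩ h
    rw [mem_cutPairs] at h
    obtain ⟨⟨hx, hxS⟩, hv, hadj⟩ := h
    have hvL : v ∈ L := by
      by_contra hvL
      exact hzS ((hzy x v hx hvL hadj) ▸ hxS)
    have hvS : v ∉ S := fun h => hv ⟨hvL, h⟩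
    simp [hx, hxS, hvL, hvS, hadj]

/-- A cyclic exchange with one inner edge from each end block, in the order of a tour of length at
most `2 * I.weight G` from edge doubling. A cut with a single edge has end blocks on both sides, so
the exchange raises it to at least two. -/
lemma RCS.exists_twoEdgeConnected {d : ℕ} (hd : 2 ≤ d) (I : MetricInstance V) {G : SimpleGraph V}
    (hG : RCS d V G) : ∃ H, RTwoCS d V H ∧ I.weight H ≤ 3 * I.weight G := by
  obtain ⟨hF, hconn⟩ := hG
  have := hconn.nonempty
  by_cases hbr : ∀ X : Set V, cut G X ≠ 1
  · refine ⟨G, ⟨hF, twoEdgeConnected_of_cut fun S a ha b hb => ?_⟩, ?_⟩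
    · have := cut_pos_of_connected hconn ha hb
      have := hbr S
      omega
    · have := I.weight_nonneg G
      linarith
  push Not at hbr
  obtain ⟨X, hX⟩ := hbr
  have hexL : ∀ L : Set V, ∃ u b, IsEndBlock G L →
      u ∈ L ∧ b ∈ L ∧ G.Adj u b ∧ ∀ v ∉ L, ¬ G.Adj b v := by
    intro L
    by_cases hL : IsEndBlock G L
    · obtain ⟨u, b, h⟩ := hL.exists_inner_edge hF hd
      exact ⟨u, b, fun _ => h⟩
    · exact ⟨Classical.arbitrary V, Classical.arbitrary V, fun h => absurd h hL⟩
  choose u b hub using hexL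
  -- The label of a vertex is the end block containing it, unique by disjointness, and `∅` outside
  -- all end blocks.
  have hlab : ∃ lab : V → Set V, ∀ L, IsEndBlock G L → ∀ x ∈ L, lab x = L := by
    refine ⟨fun x => if h : ∃ L, IsEndBlock G L ∧ x ∈ L then h.choose else ∅, ?_⟩
    intro L hL x hx
    have h : ∃ L, IsEndBlock G L ∧ x ∈ L := ⟨L, hL, hx⟩
    dsimp only
    rw [dif_pos h]
    exact h.choose_spec.1.eq_of_mem hconn hL h.choose_spec.2 hx
  obtain ⟨lab, hlab⟩ := hlab
  obtain ⟨l₀, hnd, hall, htour⟩ := exists_tour_two_mul I hconn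
  set l := l₀.filter fun x => IsEndBlock G (lab x) ∧ u (lab x) = x with hl
  have hmem : ∀ {x}, x ∈ l ↔ IsEndBlock G (lab x) ∧ u (lab x) = x := by
    intro x
    simp [hl, hall x]
  have humem : ∀ {L}, IsEndBlock G L → u L ∈ l := by
    intro L hL
    rw [hmem, hlab L hL _ (hub L hL).1]
    exact ⟨hL, rfl⟩
  have hxL : ∀ {x}, x ∈ l → x ∈ lab x ∧ b (lab x) ∈ lab x ∧ G.Adj x (b (lab x)) ∧
      ∀ v ∉ lab x, ¬ G.Adj (b (lab x)) v := by
    intro x hx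
    obtain ⟨h1, h2⟩ := hmem.1 hx
    have := hub _ h1
    rwa [h2] at this
  have hinj : ∀ x ∈ l, ∀ y ∈ l, lab x = lab y → x = y := by
    intro x hx y hy h
    rw [← (hmem.1 hx).2, ← (hmem.1 hy).2, h]
  -- Both `S` and its complement are left by one edge, so each contains an end block.
  have hsep : ∀ S : Set V, cut G S = 1 → ∃ x ∈ l, ∃ y ∈ l, x ∈ S ∧ y ∉ S := by
    intro S hS
    obtain ⟨L₁, hs₁, hL₁⟩ := exists_isEndBlock_subset hS
    obtain ⟨L₂, hs₂, hL₂⟩ := exists_isEndBlock_subset ((cut_compl G S).trans hS)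
    exact ⟨u L₁, humem hL₁, u L₂, humem hL₂, hs₁ (hub L₁ hL₁).1, hs₂ (hub L₂ hL₂).1⟩
  have hlnd : l.Nodup := hnd.filter _
  have hlen : 2 ≤ l.length := by
    obtain ⟨x, hx, y, hy, hxS, hyS⟩ := hsep X hX
    rw [← List.toFinset_card_of_nodup hlnd]
    exact Finset.one_lt_card.2 ⟨x, by simpa using hx, y, by simpa using hy,
      fun h => hyS (h ▸ hxS)⟩
  obtain ⟨H, h1, h2, h3⟩ := exists_cyclic_exchange I G l (fun x => b (lab x)) lab hinj hlnd
    (fun x hx => hlab _ (hmem.1 hx).1 _ (hxL hx).2.1) (fun x hx => (hxL hx).2.2.1)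
    (fun x hx y hy hxy => by
      refine (hxL hx).2.2.2 y fun hyx => hxy (hinj x hx y hy ?_)
      exact (hlab _ (hmem.1 hx).1 _ hyx).symm) hlen
    (fun x hx S hS => by
      have hL := (hmem.1 hx).1
      refine (hL.two_le_inner_cut hconn (hxL hx).1 (hxL hx).2.1 hS).trans
        (Finset.card_le_card fun p hp => ?_)
      rw [mem_filter] at hp ⊢
      exact ⟨hp.1, hlab _ hL _ hp.2.1, hlab _ hL _ hp.2.2⟩)
  refine ⟨H, ⟨h1 d hF, twoEdgeConnected_of_cut fun S p hp q hq => ?_⟩, ?_⟩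
  · rcases h3 S with h | ⟨h, hS⟩
    · exact h
    · have hpos := cut_pos_of_connected hconn hp hq
      by_contra hlt
      obtain ⟨x, hx, y, hy, hxS, hyS⟩ := hsep S (by omega)
      exact hyS (((hS x hx).2 y hy).1 hxS)
  · have := tourLength_sublist I (List.filter_sublist : l.Sublist l₀)
    linarith

end Augment

theorem RTwoCS_le_three_mul_RCS {d : ℕ} (hd : 2 ≤ d) : BoundedBy (RTwoCS d) (RCS d) 3 :=
  boundedBy_of fun _ _ I _ hH => RCS.exists_twoEdgeConnected hd I hH

/-! ### The perfect matching polytope: contraction and gluing along tight cuts. -/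

section FractionalMatching
variable {V : Type*} [Fintype V]

/-- The total value of `x` on the pairs that leave the set `S`. -/
noncomputable def cutValue (x : V → V → ℝ) (S : Set V) : ℝ :=
  ∑ u, ∑ v, if u ∈ S ∧ v ∉ S then x u v else 0

/-- Points of the perfect matching polytope of the complete graph on `V`. -/
structure IsFractionalMatching (x : V → V → ℝ) : Prop where
  symm : ∀ u v, x u v = x v u
  nonneg : ∀ u v, 0 ≤ x u v
  diag : ∀ u, x u u = 0
  row : ∀ u, ∑ v, x u v = 1
  odd : ∀ S : Set V, Odd S.ncard → 1 ≤ cutValue x S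

lemma cutValue_compl {x : V → V → ℝ} (hx : ∀ u v, x u v = x v u) (S : Set V) :
    cutValue x Sᶜ = cutValue x S := by
  rw [cutValue, cutValue, Finset.sum_comm]
  refine Finset.sum_congr rfl fun u _ => Finset.sum_congr rfl fun v _ => ?_
  rw [hx v u]
  by_cases h1 : u ∈ S <;> by_cases h2 : v ∈ S <;> simp [h1, h2]

lemma cutValue_singleton {x : V → V → ℝ} (hd : ∀ u, x u u = 0) (hr : ∀ u, ∑ v, x u v = 1) (s : V) :
    cutValue x {s} = 1 := by
  rw [cutValue, Finset.sum_eq_single s]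
  · rw [← hr s]
    refine Finset.sum_congr rfl fun v _ => ?_
    by_cases h : v = s
    · simp [h, hd]
    · simp [h]
  · intro u _ hu
    simp [hu]
  · simp

lemma cutValue_sub_mul (x y : V → V → ℝ) (t r : ℝ) (S : Set V) :
    cutValue (fun u v => (x u v - t * y u v) / r) S = (cutValue x S - t * cutValue y S) / r := by
  simp only [cutValue, Finset.mul_sum, ← Finset.sum_sub_distrib, Finset.sum_div]
  refine Finset.sum_congr rfl fun u _ => Finset.sum_congr rfl fun v _ => ?_
  split_ifs <;> simp

lemma sum_eq_sum_subtype_add (B : Set V) (φ : V → ℝ) :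
    ∑ v, φ v = (∑ v : {v // v ∈ B}, φ v) + ∑ v, if v ∈ B then 0 else φ v := by
  have h1 : ∑ v : {v // v ∈ B}, φ v = ∑ v, if v ∈ B then φ v else 0 := by
    rw [← Finset.sum_filter]
    exact (Finset.sum_subtype (univ.filter (· ∈ B)) (by simp) φ).symm
  rw [h1, ← Finset.sum_add_distrib]
  refine Finset.sum_congr rfl fun v _ => ?_
  split_ifs <;> simp

lemma sum_subtype_eq (B : Set V) (φ : V → ℝ) :
    ∑ v : {v // v ∈ B}, φ v = ∑ v, if v ∈ B then φ v else 0 := by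
  rw [← Finset.sum_filter]
  exact (Finset.sum_subtype (univ.filter (· ∈ B)) (by simp) φ).symm

/-- `h` pairs up the elements of `W`. -/
def IsMatchingOn (W : Set V) (h : V → V) : Prop := ∀ u ∈ W, h u ∈ W ∧ h u ≠ u ∧ h (h u) = u

/-- The cost of a matching of `W`, where each pair is counted in both directions. -/
noncomputable def matchingCost (c : V → V → ℝ) (W : Set V) (h : V → V) : ℝ :=
  ∑ u, if u ∈ W then c u (h u) else 0

lemma exists_isMatchingOn {W : Set V} (hW : Even W.ncard) : ∃ h, IsMatchingOn W h := by
  obtain ⟨k, hk⟩ := hW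
  have hcard : Fintype.card W = Fintype.card (Fin k × Bool) := by
    rw [Fintype.card_eq_nat_card, Nat.card_coe_set_eq, hk]
    simp
    omega
  -- Arrange the elements in `k` couples and swap the members of each couple.
  let e : W ≃ Fin k × Bool := Fintype.equivOfCardEq hcard
  refine ⟨fun u => if hu : u ∈ W then (e.symm ((e ⟨u, hu⟩).1, !(e ⟨u, hu⟩).2)).1 else u,
    fun u hu => ?_⟩
  have hmem : (e.symm ((e ⟨u, hu⟩).1, !(e ⟨u, hu⟩).2)).1 ∈ W :=
    (e.symm ((e ⟨u, hu⟩).1, !(e ⟨u, hu⟩).2)).2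
  simp only [dif_pos hu, dif_pos hmem, Subtype.coe_eta, Equiv.apply_symm_apply, Bool.not_not,
    Prod.mk.eta, Equiv.symm_apply_apply, and_true]
  refine ⟨hmem, fun h => ?_⟩
  have h2 : e.symm ((e ⟨u, hu⟩).1, !(e ⟨u, hu⟩).2) = ⟨u, hu⟩ := Subtype.ext h
  rw [Equiv.symm_apply_eq] at h2
  have := congrArg Prod.snd h2
  simp at this

lemma exists_min_isMatchingOn (c : V → V → ℝ) {W : Set V} (hW : Even W.ncard) :
    ∃ h, IsMatchingOn W h ∧ ∀ h', IsMatchingOn W h' → matchingCost c W h ≤ matchingCost c W h' := by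
  obtain ⟨h, h1, h2⟩ := Set.exists_min_image {h : V → V | IsMatchingOn W h} (matchingCost c W)
    (Set.toFinite _) (exists_isMatchingOn hW)
  exact ⟨h, h1, fun h' hh' => h2 h' hh'⟩

/-- The statement that a fractional matching is a convex combination of matchings. -/
def MatchingProperty (V : Type*) [Fintype V] : Prop :=
  ∀ x : V → V → ℝ, IsFractionalMatching x → ∀ c : V → V → ℝ,
    ∃ f : V → V, IsMatchingOn Set.univ f ∧ matchingCost c Set.univ f ≤ ∑ u, ∑ v, x u v * c u v

/-- The contraction of the complement of `B` to the point `none`. -/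
noncomputable def contract (x : V → V → ℝ) (B : Set V) :
    Option {v // v ∈ B} → Option {v // v ∈ B} → ℝ
  | none, none => 0
  | none, some v => ∑ a, if a ∈ B then 0 else x v a
  | some v, none => ∑ a, if a ∈ B then 0 else x v a
  | some u, some v => x u v

lemma cutValue_contract {x : V → V → ℝ} {B : Set V} {T : Set (Option {v // v ∈ B})}
    (hT : none ∉ T) :
    cutValue (contract x B) T = cutValue x {v | ∃ h : v ∈ B, some ⟨v, h⟩ ∈ T} := by
  generalize hS : {v | ∃ h : v ∈ B, some ⟨v, h⟩ ∈ T} = S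
  have hmem : ∀ v : {v // v ∈ B}, some v ∈ T ↔ (v : V) ∈ S := by
    intro v
    rw [← hS]
    constructor
    · intro h
      exact ⟨v.2, h⟩
    · rintro ⟨_, h⟩
      exact h
  have hSB : ∀ v, v ∈ S → v ∈ B := by
    rw [← hS]
    exact fun v h => h.1
  rw [cutValue, Fintype.sum_option, cutValue,
    sum_eq_sum_subtype_add B fun u => ∑ v, if u ∈ S ∧ v ∉ S then x u v else 0]
  have e1 : (∑ v, if none ∈ T ∧ v ∉ T then contract x B none v else 0) = 0 :=
    Finset.sum_eq_zero fun v _ => by simp [hT]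
  have e2 : (∑ u, if u ∈ B then 0 else ∑ v, if u ∈ S ∧ v ∉ S then x u v else 0) = 0 := by
    refine Finset.sum_eq_zero fun u _ => ?_
    split_ifs with h
    · rfl
    · refine Finset.sum_eq_zero fun v _ => ?_
      rw [if_neg]
      exact fun h' => h (hSB u h'.1)
  rw [e1, e2, zero_add, add_zero]
  refine Finset.sum_congr rfl fun u _ => ?_
  rw [Fintype.sum_option, sum_eq_sum_subtype_add B, add_comm]
  congr 1
  · refine Finset.sum_congr rfl fun v _ => ?_
    simp only [hmem, contract]
  · by_cases hu : (u : V) ∈ S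
    · simp only [hmem, hu, hT, not_false_eq_true, and_self, if_true, contract, true_and]
      refine Finset.sum_congr rfl fun v _ => ?_
      by_cases hv : v ∈ B
      · simp [hv]
      · have : v ∉ S := fun h => hv (hSB v h)
        simp [hv, this]
    · simp [hmem, hu]

/-- Tightness of the cut is what gives the contracted point total value 1. -/
lemma isFractionalMatching_contract {x : V → V → ℝ} (hx : IsFractionalMatching x) {B : Set V}
    (hB : Odd B.ncard) (hcut : cutValue x B = 1) : IsFractionalMatching (contract x B) := by
  have hsymm : ∀ u v, contract x B u v = contract x B v u := by
    rintro (_ | u) (_ | v)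
    · rfl
    · rfl
    · rfl
    · exact hx.symm u v
  have hnone : ∀ T : Set (Option {v // v ∈ B}), none ∉ T → Odd T.ncard →
      1 ≤ cutValue (contract x B) T := by
    intro T hT hodd
    rw [cutValue_contract hT]
    refine hx.odd _ ?_
    have e1 : T = some '' (some ⁻¹' T) := by
      rw [Set.image_preimage_eq_inter_range, eq_comm, Set.inter_eq_left]
      rintro (_ | v) hv
      · exact absurd hv hT
      · exact ⟨v, rfl⟩
    have e2 : {v | ∃ h : v ∈ B, some ⟨v, h⟩ ∈ T} = Subtype.val '' (some ⁻¹' T) := by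
      ext v
      simp
    rw [e2, Set.ncard_image_of_injective _ Subtype.val_injective]
    rwa [e1, Set.ncard_image_of_injective _ (Option.some_injective _)] at hodd
  refine ⟨hsymm, ?_, ?_, ?_, fun T hodd => ?_⟩
  · rintro (_ | u) (_ | v)
    · exact le_rfl
    · exact Finset.sum_nonneg fun a _ => by split_ifs; exacts [le_rfl, hx.nonneg _ _]
    · exact Finset.sum_nonneg fun a _ => by split_ifs; exacts [le_rfl, hx.nonneg _ _]
    · exact hx.nonneg _ _
  · rintro (_ | u)
    · rfl
    · exact hx.diag u
  · rintro (_ | u)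
    · rw [Fintype.sum_option]
      simp only [contract, zero_add]
      rw [← hcut, cutValue, sum_subtype_eq B fun v => ∑ a, if a ∈ B then 0 else x v a]
      refine Finset.sum_congr rfl fun u _ => ?_
      by_cases hu : u ∈ B
      · simp only [hu, if_true, true_and, ite_not]
      · simp [hu]
    · rw [Fintype.sum_option, ← hx.row u, sum_eq_sum_subtype_add B, add_comm]
      rfl
  -- The contracted set has the even size `B.ncard + 1`, so an odd set containing `none` can be
  -- replaced by its complement.
  · by_cases hT : none ∈ T
    · rw [← cutValue_compl hsymm]
      refine hnone _ (by simpa using hT) ?_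
      have h1 := Set.ncard_add_ncard_compl T
      have h2 : Nat.card (Option {v // v ∈ B}) = B.ncard + 1 := by
        rw [Finite.card_option]
        rfl
      rw [h2] at h1
      rcases hB with ⟨m, hm⟩
      rcases hodd with ⟨m', hm'⟩
      exact ⟨m - m', by omega⟩
    · exact hnone T hT hodd

/-- Half of the gluing step along a tight cut. -/
lemma exists_side_costs {x : V → V → ℝ} (hx : IsFractionalMatching x) (c : V → V → ℝ) {B : Set V}
    (hB : Odd B.ncard) (hcut : cutValue x B = 1) (hprop : MatchingProperty (Option {v // v ∈ B})) :
    ∃ g : V → ℝ, (∀ v ∈ B, ∃ h, IsMatchingOn (B \ {v}) h ∧ matchingCost c (B \ {v}) h = g v) ∧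
      (∑ v, if v ∈ B then (∑ a, if a ∈ B then 0 else x v a) * g v else 0) ≤
        ∑ u, ∑ v, if u ∈ B ∧ v ∈ B then x u v * c u v else 0 := by
  have heven : ∀ v ∈ B, Even (B \ {v}).ncard := by
    intro v hv
    rw [Set.ncard_sdiff_singleton_of_mem hv]
    obtain ⟨m, hm⟩ := hB
    exact ⟨m, by omega⟩
  have hex : ∀ v, ∃ h, v ∈ B → IsMatchingOn (B \ {v}) h ∧ ∀ h', IsMatchingOn (B \ {v}) h' →
      matchingCost c (B \ {v}) h ≤ matchingCost c (B \ {v}) h' := by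
    intro v
    by_cases hv : v ∈ B
    · obtain ⟨h, hh⟩ := exists_min_isMatchingOn c (heven v hv)
      exact ⟨h, fun _ => hh⟩
    · exact ⟨id, fun h => absurd h hv⟩
  choose hm hhm using hex
  refine ⟨fun v => matchingCost c (B \ {v}) (hm v), fun v hv => ⟨hm v, (hhm v hv).1, rfl⟩, ?_⟩
  set g : V → ℝ := fun v => matchingCost c (B \ {v}) (hm v) with hg
  -- Matching `none` with `v` is rewarded by `g v`, the least cost of matching the rest of `B`.
  -- Hence every perfect matching has cost at least 0, and so has the contracted fractional
  -- matching. The reward sits on one direction only because both directions are summed.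
  let c' : Option {v // v ∈ B} → Option {v // v ∈ B} → ℝ := fun a b =>
    match a, b with
    | none, none => 0
    | none, some v => - g v
    | some _, none => 0
    | some u, some v => c u v
  obtain ⟨f, hf, hcost⟩ := hprop _ (isFractionalMatching_contract hx hB hcut) c'
  obtain ⟨v₀, hv₀⟩ : ∃ v, f none = some v := by
    have := (hf none trivial).2.1
    exact Option.ne_none_iff_exists'.1 this
  have hf₀ : f (some v₀) = none := by
    rw [← hv₀]
    exact (hf none trivial).2.2
  have hfs : ∀ u : {v // v ∈ B}, u ≠ v₀ → ∃ w, f (some u) = some w := by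
    intro u hu
    refine Option.ne_none_iff_exists'.1 fun h => hu ?_
    have := (hf (some u) trivial).2.2
    rw [h, hv₀] at this
    exact (Option.some_injective _ this).symm
  let h : V → V := fun u => if hu : u ∈ B then ((f (some ⟨u, hu⟩)).map Subtype.val).getD u else u
  have hh : ∀ u w : {v // v ∈ B}, f (some u) = some w → h u = w := by
    intro u w huw
    simp [h, u.2, huw]
  have hmatch : IsMatchingOn (B \ {(v₀ : V)}) h := by
    rintro u ⟨huB, hu⟩
    obtain ⟨w, hw⟩ := hfs ⟨u, huB⟩ (fun h => hu (by rw [← h]; rfl))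
    have h2 := (hf (some ⟨u, huB⟩) trivial).2
    rw [hw] at h2
    rw [hh ⟨u, huB⟩ w hw, hh w ⟨u, huB⟩ h2.2]
    refine ⟨⟨w.2, fun hw0 => ?_⟩, fun h3 => h2.1 ?_, rfl⟩
    · have : w = v₀ := Subtype.ext hw0
      rw [this, hf₀] at h2
      simp at h2
    · exact congrArg some (Subtype.ext h3)
  have hmin := (hhm v₀ v₀.2).2 h hmatch
  have e1 : matchingCost c' Set.univ f = - g v₀ + matchingCost c (B \ {(v₀ : V)}) h := by
    simp only [matchingCost, Set.mem_univ, if_true]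
    rw [Fintype.sum_option, hv₀]
    congr 1
    obtain ⟨W, hW⟩ : ∃ W, W = B \ {(v₀ : V)} := ⟨_, rfl⟩
    rw [← hW]
    have : ∀ u, (if u ∈ W then c u (h u) else 0) =
        if u ∈ B then (if u = v₀ then 0 else c u (h u)) else 0 := by
      intro u
      by_cases h1 : u ∈ B <;> by_cases h2 : u = v₀ <;> simp [hW, h1, h2]
    simp_rw [this]
    rw [← sum_subtype_eq B fun u => if u = v₀ then 0 else c u (h u)]
    refine Finset.sum_congr rfl fun u _ => ?_
    by_cases hu : u = v₀
    · rw [hu, hf₀]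
      simp [c']
    · obtain ⟨w, hw⟩ := hfs u hu
      rw [hw, hh u w hw, if_neg fun h => hu (Subtype.ext h)]
  have e2 : ∑ a, ∑ b, contract x B a b * c' a b =
      (∑ u, ∑ v, if u ∈ B ∧ v ∈ B then x u v * c u v else 0) -
      ∑ v, if v ∈ B then (∑ a, if a ∈ B then 0 else x v a) * g v else 0 := by
    rw [Fintype.sum_option, Fintype.sum_option,
      ← sum_subtype_eq B fun v => (∑ a, if a ∈ B then 0 else x v a) * g v]
    have e3 : ∀ u, (∑ v, if u ∈ B ∧ v ∈ B then x u v * c u v else 0) =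
        if u ∈ B then ∑ v : {v // v ∈ B}, x u v * c u v else 0 := by
      intro u
      rw [sum_subtype_eq B fun v => x u v * c u v]
      by_cases hu : u ∈ B <;> simp [hu]
    simp_rw [e3]
    rw [← sum_subtype_eq B fun u => ∑ v : {v // v ∈ B}, x u v * c u v]
    simp only [Fintype.sum_option, contract, c', mul_zero, zero_add, mul_neg,
      Finset.sum_neg_distrib]
    ring
  rw [e1, e2] at hcost
  change g v₀ ≤ _ at hmin
  linarith

/-- The gluing step along a tight cut. -/
lemma exists_matching_of_tight {x : V → V → ℝ} (hx : IsFractionalMatching x) (c : V → V → ℝ)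
    {B B' : Set V} (hBB' : B' = Bᶜ) (hB : Odd B.ncard) (hB' : Odd B'.ncard) (hcut : cutValue x B = 1)
    (hprop : MatchingProperty (Option {v // v ∈ B}))
    (hprop' : MatchingProperty (Option {v // v ∈ B'})) :
    ∃ f : V → V, IsMatchingOn Set.univ f ∧
      matchingCost c Set.univ f ≤ ∑ u, ∑ v, x u v * c u v := by
  obtain ⟨g, hg, hgle⟩ := exists_side_costs hx c hB hcut hprop
  obtain ⟨g', hg', hgle'⟩ := exists_side_costs hx c hB'
    (by rw [hBB', cutValue_compl hx.symm, hcut]) hprop'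
  have hmem' : ∀ v, v ∈ B' ↔ v ∉ B := fun v => by rw [hBB', Set.mem_compl_iff]
  clear hBB'
  set T := ∑ u, ∑ v, x u v * c u v with hT
  -- The values of `x` on the tight cut are probabilities. On average over a random crossing pair,
  -- the pair together with optimal matchings of both remainders costs at most `T`.
  have hkey : ∑ u, ∑ v, (if u ∈ B ∧ v ∉ B then x u v * (g u + g' v + c u v + c v u) else 0) ≤ T := by
    have e1 : (∑ v, if v ∈ B then (∑ a, if a ∈ B then 0 else x v a) * g v else 0) =
        ∑ u, ∑ v, if u ∈ B ∧ v ∉ B then x u v * g u else 0 := by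
      refine Finset.sum_congr rfl fun u _ => ?_
      by_cases hu : u ∈ B
      · simp only [hu, if_true, true_and, Finset.sum_mul]
        refine Finset.sum_congr rfl fun v _ => ?_
        by_cases hv : v ∈ B <;> simp [hv]
      · simp [hu]
    have e2 : (∑ v, if v ∈ B' then (∑ a, if a ∈ B' then 0 else x v a) * g' v else 0) =
        ∑ u, ∑ v, if u ∈ B ∧ v ∉ B then x u v * g' v else 0 := by
      rw [Finset.sum_comm]
      refine Finset.sum_congr rfl fun v _ => ?_
      by_cases hv : v ∈ B
      · simp [hmem', hv]
      · simp only [hmem', hv, not_false_eq_true, if_true, and_true, Finset.sum_mul]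
        refine Finset.sum_congr rfl fun u _ => ?_
        rw [hx.symm]
        by_cases hu : u ∈ B <;> simp [hu]
    have e3 : ∑ u, ∑ v, (if u ∈ B ∧ v ∉ B then x u v * c v u else 0) =
        ∑ u, ∑ v, if u ∉ B ∧ v ∈ B then x u v * c u v else 0 := by
      rw [Finset.sum_comm]
      refine Finset.sum_congr rfl fun v _ => Finset.sum_congr rfl fun u _ => ?_
      rw [hx.symm]
      by_cases hu : u ∈ B <;> by_cases hv : v ∈ B <;> simp [hu, hv]
    have e4 : ∑ u, ∑ v, (if u ∈ B ∧ v ∉ B then x u v * (g u + g' v + c u v + c v u) else 0) =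
        (∑ u, ∑ v, if u ∈ B ∧ v ∉ B then x u v * g u else 0) +
        (∑ u, ∑ v, if u ∈ B ∧ v ∉ B then x u v * g' v else 0) +
        (∑ u, ∑ v, if u ∈ B ∧ v ∉ B then x u v * c u v else 0) +
        ∑ u, ∑ v, if u ∈ B ∧ v ∉ B then x u v * c v u else 0 := by
      simp only [← Finset.sum_add_distrib]
      refine Finset.sum_congr rfl fun u _ => Finset.sum_congr rfl fun v _ => ?_
      split_ifs <;> ring
    have e5 : T = (∑ u, ∑ v, if u ∈ B ∧ v ∈ B then x u v * c u v else 0) +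
        (∑ u, ∑ v, if u ∈ B' ∧ v ∈ B' then x u v * c u v else 0) +
        (∑ u, ∑ v, if u ∈ B ∧ v ∉ B then x u v * c u v else 0) +
        ∑ u, ∑ v, if u ∉ B ∧ v ∈ B then x u v * c u v else 0 := by
      simp only [hT, ← Finset.sum_add_distrib]
      refine Finset.sum_congr rfl fun u _ => Finset.sum_congr rfl fun v _ => ?_
      by_cases hu : u ∈ B <;> by_cases hv : v ∈ B <;> simp [hmem', hu, hv]
    rw [e1] at hgle
    rw [e2] at hgle'
    rw [e4, e5, e3]
    linarith
  -- Hence some crossing pair does not exceed the average; it is glued with the optimal matchings of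
  -- the two sides.
  obtain ⟨a, b, ha, hb, hab⟩ : ∃ a b, a ∈ B ∧ b ∉ B ∧ g a + g' b + c a b + c b a ≤ T := by
    by_contra! hcon
    have h1 : ∑ u, ∑ v, (if u ∈ B ∧ v ∉ B then x u v * T else 0) = T := by
      have : ∀ u v, (if u ∈ B ∧ v ∉ B then x u v * T else 0) =
          (if u ∈ B ∧ v ∉ B then x u v else 0) * T := by
        intro u v
        split_ifs <;> simp
      simp_rw [this, ← Finset.sum_mul]
      rw [← cutValue, hcut, one_mul]
    have h2 : ∃ u v, u ∈ B ∧ v ∉ B ∧ 0 < x u v := by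
      by_contra! h
      have : cutValue x B ≤ 0 := by
        refine Finset.sum_nonpos fun u _ => Finset.sum_nonpos fun v _ => ?_
        split_ifs with huv
        · exact h u v huv.1 huv.2
        · exact le_rfl
      linarith
    obtain ⟨u, v, hu, hv, huv⟩ := h2
    have hle : ∀ u v, (if u ∈ B ∧ v ∉ B then x u v * T else 0) ≤
        if u ∈ B ∧ v ∉ B then x u v * (g u + g' v + c u v + c v u) else 0 := by
      intro u v
      split_ifs with h
      · exact mul_le_mul_of_nonneg_left (hcon u v h.1 h.2).le (hx.nonneg _ _)
      · exact le_rfl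
    have : ∑ u, ∑ v, (if u ∈ B ∧ v ∉ B then x u v * T else 0) <
        ∑ u, ∑ v, (if u ∈ B ∧ v ∉ B then x u v * (g u + g' v + c u v + c v u) else 0) := by
      refine Finset.sum_lt_sum (fun u _ => Finset.sum_le_sum fun v _ => hle u v)
        ⟨u, mem_univ _, Finset.sum_lt_sum (fun v _ => hle u v) ⟨v, mem_univ _, ?_⟩⟩
      rw [if_pos ⟨hu, hv⟩, if_pos ⟨hu, hv⟩]
      exact mul_lt_mul_of_pos_left (hcon u v hu hv) huv
    linarith
  obtain ⟨h, hh, hhc⟩ := hg a ha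
  obtain ⟨h', hh', hhc'⟩ := hg' b ((hmem' b).2 hb)
  have hne : a ≠ b := fun h => hb (h ▸ ha)
  let f : V → V := fun u => if u = a then b else if u = b then a else if u ∈ B then h u else h' u
  have fa : f a = b := by simp [f]
  have fb : f b = a := by simp [f, hne.symm]
  have fB : ∀ u, u ∈ B \ {a} → f u = h u := by
    rintro u ⟨hu, hua⟩
    have hua' : u ≠ a := hua
    have hub : u ≠ b := fun h => hb (h ▸ hu)
    simp [f, hua', hub, hu]
  have fB' : ∀ u, u ∈ B' \ {b} → f u = h' u := by
    rintro u ⟨hu, hub⟩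
    have hub' : u ≠ b := hub
    have hua : u ≠ a := fun h => (hmem' u).1 hu (h ▸ ha)
    have hu' : u ∉ B := (hmem' u).1 hu
    simp [f, hub', hua, hu']
  have hcases : ∀ u, u = a ∨ u = b ∨ u ∈ B \ {a} ∨ u ∈ B' \ {b} := by
    intro u
    by_cases h1 : u = a
    · exact Or.inl h1
    by_cases h2 : u = b
    · exact Or.inr (Or.inl h2)
    by_cases h3 : u ∈ B
    · exact Or.inr (Or.inr (Or.inl ⟨h3, h1⟩))
    · exact Or.inr (Or.inr (Or.inr ⟨(hmem' u).2 h3, h2⟩))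
  refine ⟨f, fun u _ => ⟨trivial, ?_⟩, ?_⟩
  · rcases hcases u with rfl | rfl | hu | hu
    · rw [fa, fb]
      exact ⟨hne.symm, rfl⟩
    · rw [fb, fa]
      exact ⟨hne, rfl⟩
    · obtain ⟨h1, h2, h3⟩ := hh u hu
      rw [fB u hu, fB _ h1]
      exact ⟨h2, h3⟩
    · obtain ⟨h1, h2, h3⟩ := hh' u hu
      rw [fB' u hu, fB' _ h1]
      exact ⟨h2, h3⟩
  · have e : matchingCost c Set.univ f = c a b + c b a + matchingCost c (B \ {a}) h +
        matchingCost c (B' \ {b}) h' := by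
      have e1 : c a b = ∑ u, if u = a then c a b else 0 := by simp
      have e2 : c b a = ∑ u, if u = b then c b a else 0 := by simp
      rw [e1, e2]
      simp only [matchingCost, ← Finset.sum_add_distrib, Set.mem_univ, if_true]
      refine Finset.sum_congr rfl fun u _ => ?_
      rcases hcases u with rfl | rfl | hu | hu
      · simp [fa, hmem', hne, ha]
      · simp [fb, hmem', hne.symm, hb]
      · have h1 : u ≠ a := hu.2
        have h2 : u ≠ b := fun h => hb (h ▸ hu.1)
        rw [fB u hu, if_neg h1, if_neg h2, if_pos hu, if_neg fun h => (hmem' u).1 h.1 hu.1]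
        ring
      · have h1 : u ≠ b := hu.2
        have h2 : u ≠ a := fun h => (hmem' u).1 hu.1 (h ▸ ha)
        rw [fB' u hu, if_neg h1, if_neg h2, if_pos hu, if_neg fun h => (hmem' u).1 hu.1 h.1]
        ring
    rw [e, hhc, hhc']
    linarith

end FractionalMatching

/-! ### Edmonds' theorem by Tutte's theorem, perturbation and induction. -/

section FractionalMatching
variable {V : Type*} [Fintype V]

/-- The support of a fractional matching has a perfect matching, by Tutte's theorem. -/
lemma IsFractionalMatching.exists_support_matching {x : V → V → ℝ} (hx : IsFractionalMatching x) :
    ∃ f : V → V, ∀ v, f (f v) = v ∧ f v ≠ v ∧ 0 < x v (f v) := by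
  let G : SimpleGraph V := SimpleGraph.mk (fun u v => 0 < x u v)
    ⟨fun u v h => by rw [hx.symm]; exact h⟩ ⟨fun u h => by rw [hx.diag] at h; exact lt_irrefl _ h⟩
  obtain ⟨M, hM⟩ : ∃ M : G.Subgraph, M.IsPerfectMatching := by
    rw [SimpleGraph.tutte]
    intro U hU
    unfold SimpleGraph.IsTutteViolator at hU
    set K := ((⊤ : G.Subgraph).deleteVerts U).coe with hK
    let S : K.ConnectedComponent → Set V := fun C => Subtype.val '' C.supp
    have hSU : ∀ C, ∀ v ∈ S C, v ∉ U := by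
      rintro C _ ⟨v, hv, rfl⟩
      have := v.2
      simp only [SimpleGraph.Subgraph.deleteVerts_verts] at this
      exact this.2
    have hSdisj : ∀ C C', ∀ v, v ∈ S C → v ∈ S C' → C = C' := by
      rintro C C' _ ⟨v, hv, rfl⟩ ⟨v', hv', h⟩
      have : v' = v := Subtype.ext h
      subst this
      rw [SimpleGraph.ConnectedComponent.mem_supp_iff] at hv hv'
      exact hv.symm.trans hv'
    -- Support edges leaving a component of the graph without `U` end in `U`.
    have hSadj : ∀ C, ∀ u ∈ S C, ∀ v, v ∉ S C → v ∉ U → x u v = 0 := by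
      rintro C _ ⟨u, hu, rfl⟩ v hv hvU
      by_contra hne
      have hpos : 0 < x u v := lt_of_le_of_ne (hx.nonneg _ _) (Ne.symm hne)
      have hmem : v ∈ ((⊤ : G.Subgraph).deleteVerts U).verts := by
        simp [hvU]
      refine hv ⟨⟨v, hmem⟩, ?_, rfl⟩
      rw [SimpleGraph.ConnectedComponent.mem_supp_iff] at hu ⊢
      rw [← hu]
      refine SimpleGraph.ConnectedComponent.eq.2 (SimpleGraph.Adj.reachable ?_)
      rw [hK, SimpleGraph.Subgraph.coe_adj, SimpleGraph.Subgraph.deleteVerts_adj]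
      refine ⟨trivial, hvU, trivial, hSU C u ⟨u, hu, rfl⟩, ?_⟩
      rw [SimpleGraph.Subgraph.top_adj]
      change 0 < x v u
      rwa [hx.symm]
    have hcomp : ∀ C ∈ K.oddComponents, 1 ≤ ∑ u, ∑ v, if u ∈ S C ∧ v ∈ U then x u v else 0 := by
      intro C hC
      have h1 : Odd (S C).ncard := by
        rw [Set.ncard_image_of_injective _ Subtype.val_injective]
        exact hC
      refine (hx.odd _ h1).trans_eq ?_
      refine Finset.sum_congr rfl fun u _ => Finset.sum_congr rfl fun v _ => ?_
      by_cases hu : u ∈ S C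
      · by_cases hv : v ∈ S C
        · simp [hu, hv, hSU C v hv]
        · by_cases hvU : v ∈ U
          · simp [hu, hv, hvU]
          · simp [hu, hv, hvU, hSadj C u hu v hv hvU]
      · simp [hu]
    -- Each odd component sends total value at least 1 into `U`, while `U` receives at most `|U|`;
    -- so Tutte's condition holds.
    have hsum : ((K.oddComponents).ncard : ℝ) ≤ U.ncard := by
      calc ((K.oddComponents).ncard : ℝ)
          = ∑ C ∈ K.oddComponents.toFinset, (1 : ℝ) := by
            rw [Set.ncard_eq_toFinset_card']
            simp
        _ ≤ ∑ C ∈ K.oddComponents.toFinset, ∑ u, ∑ v, (if u ∈ S C ∧ v ∈ U then x u v else 0) :=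
            Finset.sum_le_sum fun C hC => hcomp C (by simpa using hC)
        _ = ∑ u, ∑ v, ∑ C ∈ K.oddComponents.toFinset, (if u ∈ S C ∧ v ∈ U then x u v else 0) := by
            rw [Finset.sum_comm]
            exact Finset.sum_congr rfl fun u _ => Finset.sum_comm
        _ ≤ ∑ u, ∑ v, (if v ∈ U then x u v else 0) := by
            refine Finset.sum_le_sum fun u _ => Finset.sum_le_sum fun v _ => ?_
            by_cases hv : v ∈ U
            · simp only [hv, and_true, if_true]
              by_cases hex : ∃ C, u ∈ S C
              · obtain ⟨C, hC⟩ := hex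
                calc ∑ C' ∈ K.oddComponents.toFinset, (if u ∈ S C' then x u v else 0)
                    ≤ ∑ C', (if u ∈ S C' then x u v else 0) :=
                      Finset.sum_le_sum_of_subset_of_nonneg (Finset.subset_univ _)
                        fun C' _ _ => by split_ifs; exacts [hx.nonneg _ _, le_rfl]
                  _ = x u v := by
                      rw [Finset.sum_eq_single C]
                      · simp [hC]
                      · intro C' _ hne
                        rw [if_neg]
                        exact fun h => hne (hSdisj _ _ _ h hC)
                      · simp
              · push Not at hex
                rw [Finset.sum_eq_zero fun C _ => by rw [if_neg (hex C)]]
                exact hx.nonneg _ _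
            · simp [hv]
        _ = U.ncard := by
            rw [Finset.sum_comm]
            have : ∀ v, (∑ u, if v ∈ U then x u v else 0) = if v ∈ U then 1 else 0 := by
              intro v
              by_cases hv : v ∈ U
              · simp only [hv, if_true]
                rw [← hx.row v]
                exact Finset.sum_congr rfl fun u _ => hx.symm u v
              · simp [hv]
            rw [Finset.sum_congr rfl fun v _ => this v, Set.ncard_eq_toFinset_card',
              Finset.sum_boole]
            congr 2
            ext
            simp
    have : K.oddComponents.ncard ≤ U.ncard := by exact_mod_cast hsum
    omega
  rw [SimpleGraph.Subgraph.isPerfectMatching_iff] at hM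
  choose f hf hfu using fun v => (hM v).exists.imp fun w hw => (⟨hw, fun w' hw' =>
    (hM v).unique hw' hw⟩ : M.Adj v w ∧ ∀ w', M.Adj v w' → w' = w)
  refine ⟨f, fun v => ⟨(hfu (f v) v (hf v).symm).symm, (hf v).ne.symm, ?_⟩⟩
  exact M.adj_sub (hf v)

lemma isCompact_fractionalMatching : IsCompact {x : V → V → ℝ | IsFractionalMatching x} := by
  have hclosed : IsClosed {x : V → V → ℝ | IsFractionalMatching x} := by
    have : {x : V → V → ℝ | IsFractionalMatching x} =
        (⋂ u, ⋂ v, {x | x u v = x v u}) ∩ ((⋂ u, ⋂ v, {x | 0 ≤ x u v}) ∩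
        ((⋂ u, {x | x u u = 0}) ∩ ((⋂ u, {x | ∑ v, x u v = 1}) ∩
        ⋂ S : {S : Set V // Odd S.ncard}, {x | 1 ≤ cutValue x S}))) := by
      ext x
      simp only [Set.mem_inter_iff, Set.mem_iInter]
      constructor
      · rintro ⟨h1, h2, h3, h4, h5⟩
        exact ⟨h1, h2, h3, h4, fun S => h5 S S.2⟩
      · rintro ⟨h1, h2, h3, h4, h5⟩
        exact ⟨h1, h2, h3, h4, fun S hS => h5 ⟨S, hS⟩⟩
    rw [this]
    refine (isClosed_iInter fun u => isClosed_iInter fun v => isClosed_eq ?_ ?_).inter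
      ((isClosed_iInter fun u => isClosed_iInter fun v => isClosed_le ?_ ?_).inter
      ((isClosed_iInter fun u => isClosed_eq ?_ ?_).inter
      ((isClosed_iInter fun u => isClosed_eq ?_ ?_).inter
      (isClosed_iInter fun S => isClosed_le ?_ ?_)))) <;> try fun_prop
    unfold cutValue
    refine continuous_finsetSum _ fun u _ => continuous_finsetSum _ fun v _ => ?_
    split_ifs <;> fun_prop
  refine IsCompact.of_isClosed_subset (isCompact_univ_pi fun _ : V =>
    isCompact_univ_pi fun _ : V => isCompact_Icc (a := (0 : ℝ)) (b := 1)) hclosed ?_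
  intro x hx u _ v _
  refine ⟨hx.nonneg u v, ?_⟩
  rw [← hx.row u]
  exact Finset.single_le_sum (f := fun v => x u v) (fun v _ => hx.nonneg u v) (mem_univ v)

/-- A minimizer that lies on no facet of a nontrivial odd set is matched by a perfect matching. -/
lemma exists_matching_of_not_tight (c : V → V → ℝ) {x : V → V → ℝ}
    (hx : IsFractionalMatching x)
    (hmin : ∀ y, IsFractionalMatching y → ∑ u, ∑ v, x u v * c u v ≤ ∑ u, ∑ v, y u v * c u v)
    (htight : ∀ S : Set V, Odd S.ncard → S.ncard ≠ 1 → Sᶜ.ncard ≠ 1 → cutValue x S ≠ 1) :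
    ∃ f : V → V, IsMatchingOn Set.univ f ∧
      matchingCost c Set.univ f ≤ ∑ u, ∑ v, x u v * c u v := by
  obtain ⟨f, hf⟩ := hx.exists_support_matching
  refine ⟨f, fun u _ => ⟨trivial, (hf u).2.1, (hf u).1⟩, ?_⟩
  -- Write `x = t χ + (1 - t) y` with the indicator of the matching. For small `t > 0` the point `y`
  -- is still a fractional matching, and minimality of `x` then gives `χ` at most the cost of `x`.
  let χ : V → V → ℝ := fun u v => if f u = v then 1 else 0
  have hχs : ∀ u v, χ u v = χ v u := by
    intro u v
    have : f u = v ↔ f v = u :=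
      ⟨fun h => by rw [← h, (hf u).1], fun h => by rw [← h, (hf v).1]⟩
    simp only [χ, this]
  have hχd : ∀ u, χ u u = 0 := fun u => by simp [χ, (hf u).2.1]
  have hχr : ∀ u, ∑ v, χ u v = 1 := fun u => by simp [χ]
  have ev1 : ∀ᶠ t : ℝ in nhdsWithin 0 (Set.Ioi 0), ∀ u, t < x u (f u) := by
    rw [Filter.eventually_all]
    intro u
    exact nhdsWithin_le_nhds (Iio_mem_nhds (hf u).2.2)
  have ev2 : ∀ᶠ t : ℝ in nhdsWithin 0 (Set.Ioi 0), ∀ S : {S : Set V // 1 < cutValue x S},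
      1 - t < cutValue x S - t * cutValue χ S := by
    rw [Filter.eventually_all]
    intro S
    refine nhdsWithin_le_nhds ?_
    have h1 : Continuous fun t : ℝ => cutValue x S - t * cutValue χ S - (1 - t) := by fun_prop
    have h2 := h1.continuousAt.eventually_mem (Ioi_mem_nhds (a := (0 : ℝ))
      (b := cutValue x S - 0 * cutValue χ S - (1 - 0)) (by linarith [S.2]))
    filter_upwards [h2] with t ht
    have : 0 < cutValue x S - t * cutValue χ S - (1 - t) := ht
    linarith
  have ev3 : ∀ᶠ t : ℝ in nhdsWithin 0 (Set.Ioi 0), t < 1 :=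
    nhdsWithin_le_nhds (Iio_mem_nhds one_pos)
  obtain ⟨t, h1, h2, h3, h0⟩ :=
    (ev1.and (ev2.and (ev3.and (eventually_mem_nhdsWithin)))).exists
  have ht0 : 0 < t := h0
  have h1t : 0 < 1 - t := by linarith
  let y : V → V → ℝ := fun u v => (x u v - t * χ u v) / (1 - t)
  have hys : ∀ u v, y u v = y v u := fun u v => by simp only [y, hx.symm u v, hχs u v]
  have hyd : ∀ u, y u u = 0 := fun u => by simp [y, hx.diag, hχd]
  have hyr : ∀ u, ∑ v, y u v = 1 := by
    intro u
    simp only [y, ← Finset.sum_div, Finset.sum_sub_distrib, ← Finset.mul_sum, hx.row, hχr, mul_one]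
    exact div_self h1t.ne'
  have hy : IsFractionalMatching y := by
    refine ⟨hys, fun u v => div_nonneg ?_ h1t.le, hyd, hyr, fun S hS => ?_⟩
    · by_cases h : f u = v
      · have := h1 u
        subst h
        simp only [χ, if_true]
        linarith
      · simp [χ, h, hx.nonneg]
    -- Cuts around one point, on either side, have value 1 by the row sums; all other odd cuts have
    -- slack by assumption.
    · by_cases hS1 : S.ncard = 1
      · obtain ⟨s, rfl⟩ := Set.ncard_eq_one.1 hS1
        exact (cutValue_singleton hyd hyr s).ge
      by_cases hS2 : Sᶜ.ncard = 1
      · obtain ⟨s, hs⟩ := Set.ncard_eq_one.1 hS2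
        rw [← cutValue_compl hys, hs]
        exact (cutValue_singleton hyd hyr s).ge
      · have h4 : 1 < cutValue x S := lt_of_le_of_ne (hx.odd S hS) (htight S hS hS1 hS2).symm
        have h5 := h2 ⟨S, h4⟩
        rw [cutValue_sub_mul, le_div_iff₀ h1t]
        linarith
  have h4 := hmin y hy
  have h5 : ∑ u, ∑ v, χ u v * c u v = matchingCost c Set.univ f := by
    simp [matchingCost, χ]
  have h6 : (1 - t) * ∑ u, ∑ v, y u v * c u v =
      (∑ u, ∑ v, x u v * c u v) - t * ∑ u, ∑ v, χ u v * c u v := by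
    simp only [Finset.mul_sum, ← Finset.sum_sub_distrib]
    refine Finset.sum_congr rfl fun u _ => Finset.sum_congr rfl fun v _ => ?_
    simp only [y]
    field_simp
  rw [← h5]
  have h7 := mul_le_mul_of_nonneg_left h4 h1t.le
  rw [h6] at h7
  by_contra! hlt
  nlinarith

end FractionalMatching

/-- **Edmonds' perfect matching polytope theorem** for complete graphs. -/
theorem matchingProperty_of_even (n : ℕ) :
    ∀ (V : Type*) [Fintype V], Nat.card V = n → Even n → MatchingProperty V := by
  induction n using Nat.strong_induction_on with
  | _ n ih =>
    intro V _ hn heven x₀ hx₀ c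
    have hcont : Continuous fun x : V → V → ℝ => ∑ u, ∑ v, x u v * c u v := by fun_prop
    obtain ⟨x, hx, hmin⟩ := (isCompact_fractionalMatching (V := V)).exists_isMinOn ⟨x₀, hx₀⟩
      hcont.continuousOn
    suffices h : ∃ f : V → V, IsMatchingOn Set.univ f ∧
        matchingCost c Set.univ f ≤ ∑ u, ∑ v, x u v * c u v by
      obtain ⟨f, h1, h2⟩ := h
      exact ⟨f, h1, h2.trans (hmin hx₀)⟩
    by_cases htight : ∀ S : Set V, Odd S.ncard → S.ncard ≠ 1 → Sᶜ.ncard ≠ 1 → cutValue x S ≠ 1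
    · exact exists_matching_of_not_tight c hx (fun y hy => hmin hy) htight
    push Not at htight
    obtain ⟨S, h1, h2, h3, h4⟩ := htight
    have hcard := Set.ncard_add_ncard_compl S
    have hodd : Odd Sᶜ.ncard := by
      rw [hn] at hcard
      rw [← hcard, Nat.even_add'] at heven
      exact heven.1 h1
    have hopt : ∀ B : Set V, Nat.card (Option {v // v ∈ B}) = B.ncard + 1 := by
      intro B
      rw [Finite.card_option]
      rfl
    obtain ⟨k, hk⟩ := h1
    obtain ⟨k', hk'⟩ := hodd
    obtain ⟨B', hB'⟩ : ∃ B', B' = Sᶜ := ⟨_, rfl⟩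
    rw [← hB'] at hk' h3 hcard
    -- Both sides are odd and not singletons, so they have at least three points and each
    -- contraction is even and smaller than `n`.
    exact exists_matching_of_tight hx c hB' ⟨k, hk⟩ ⟨k', hk'⟩ h4
      (ih _ (by omega) _ (hopt S) ⟨k + 1, by omega⟩)
      (ih _ (by omega) _ (hopt B') ⟨k' + 1, by omega⟩)

/-! ### The bound 4/3 for cubic graphs, and the bounds that hold by inclusion. -/

section Cubic
variable {V : Type*} [Fintype V]

/-- The value 1/3 on the edges of `H` is a fractional matching: an odd set has an odd cut, and
without bridges this is at least 3. The factor 2/3 instead of 1/3 arises because the sum counts each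
pair twice. -/
lemma exists_matching_third (I : MetricInstance V) {H : SimpleGraph V} (hH : RTwoCS 3 V H) :
    ∃ f : V → V, (∀ v, f (f v) = v ∧ f v ≠ v) ∧
      ∑ v, I.w s(v, f v) ≤ (2 / 3) * I.weight H := by
  have hcard : ∀ S : Set V, (univ.filter (· ∈ S)).card = S.ncard := by
    intro S
    rw [Set.ncard_eq_toFinset_card']
    congr 1
    ext
    simp
  have heven : Even (Nat.card V) := by
    obtain ⟨k, hk⟩ := hH.1.cut_parity Set.univ
    rw [hcard, Set.ncard_univ] at hk
    have h0 : cut H Set.univ = 0 := by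
      by_contra h
      obtain ⟨x, -, y, hy, -⟩ := cut_pos_iff.1 (Nat.pos_of_ne_zero h)
      exact hy trivial
    by_contra hodd
    obtain ⟨m, hm⟩ := Nat.not_even_iff_odd.1 hodd
    omega
  let x : V → V → ℝ := fun u v => (1 / 3) * if H.Adj u v then 1 else 0
  have hx : IsFractionalMatching x := by
    refine ⟨fun u v => by simp only [x, H.adj_comm], fun u v => ?_, fun u => by simp [x], fun u => ?_,
      fun S hS => ?_⟩
    · simp only [x]
      split_ifs <;> norm_num
    · have h1 := factor_iff.1 hH.1 u
      have h2 : ∑ v, (if H.Adj u v then (1 : ℝ) else 0) = 3 := by exact_mod_cast h1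
      rw [← Finset.mul_sum, h2]
      norm_num
    · have h1 : cutValue x S = (1 / 3) * cut H S := by
        rw [cut_eq_pairSum, pairSum, cutValue]
        push_cast
        rw [Finset.mul_sum]
        refine Finset.sum_congr rfl fun u _ => ?_
        rw [Finset.mul_sum]
        refine Finset.sum_congr rfl fun v _ => ?_
        by_cases h1 : u ∈ S <;> by_cases h2 : v ∈ S <;> by_cases h3 : H.Adj u v <;>
          simp [x, h1, h2, h3]
      have hodd := hH.1.odd_cut (by decide : Odd 3) S (by rwa [hcard])
      have hne : ∃ a, a ∈ S := by
        by_contra! h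
        rw [Set.eq_empty_of_forall_notMem h] at hS
        simp at hS
      have hne' : ∃ b, b ∉ S := by
        by_contra! h
        rw [Set.eq_univ_of_forall h, Set.ncard_univ] at hS
        exact Nat.not_even_iff_odd.2 hS heven
      obtain ⟨a, ha⟩ := hne
      obtain ⟨b, hb⟩ := hne'
      have h2 := hH.2.two_le_cut ha hb
      have h3 : 3 ≤ cut H S := by
        obtain ⟨m, hm⟩ := hodd
        omega
      have h4 : (3 : ℝ) ≤ cut H S := by exact_mod_cast h3
      rw [h1]
      linarith
  obtain ⟨f, hf, hcost⟩ := matchingProperty_of_even _ V rfl heven x hx fun u v => I.w s(u, v)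
  refine ⟨f, fun v => ⟨(hf v trivial).2.2, (hf v trivial).2.1⟩, ?_⟩
  have h1 : ∑ u, ∑ v, x u v * I.w s(u, v) = (2 / 3) * I.weight H := by
    rw [weight_eq_pairSum, pairSum]
    simp only [x, mul_assoc, ← Finset.mul_sum, ite_mul, one_mul, zero_mul]
    ring
  rw [← h1]
  simpa [matchingCost] using hcost

/-- The edges of the matching given by a fixed point free involution. -/
lemma exists_matching_edges (f : V → V) (hf : ∀ v, f (f v) = v ∧ f v ≠ v) :
    ∃ J : SimpleGraph V, Factor 1 V J ∧ ∀ I : MetricInstance V,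
      2 * I.weight J = ∑ v, I.w s(v, f v) := by
  obtain ⟨J, hJ⟩ : ∃ J : SimpleGraph V, ∀ u v, J.Adj u v ↔ f u = v :=
    ⟨SimpleGraph.mk (fun u v => f u = v) ⟨fun u v h => by rw [← h, (hf u).1]⟩
      ⟨fun u h => (hf u).2 h⟩, fun _ _ => Iff.rfl⟩
  refine ⟨J, factor_iff.2 fun v => by simp [hJ], fun I => ?_⟩
  rw [weight_eq_pairSum, pairSum]
  simp [hJ]

end Cubic

/-- The graph and the matching together have all degrees 4; parallel edges are harmless in a
multiset. -/
theorem TSP_le_RTwoCS_three : BoundedBy TSP (RTwoCS 3) (4 / 3) := by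
  refine boundedBy_of fun V _ I H hH => ?_
  obtain ⟨f, hf, hw⟩ := exists_matching_third I hH
  obtain ⟨J, hJ, hJw⟩ := exists_matching_edges f hf
  have hM : EvenEdges (H.edgeFinset.val + J.edgeFinset.val) := by
    refine ⟨fun e he => ?_, fun x => ?_⟩
    · rcases Multiset.mem_add.1 he with h | h
      · exact not_isDiag_edgeFinset e h
      · exact not_isDiag_edgeFinset e h
    · rw [Multiset.countP_add, countP_edgeFinset hH.1, countP_edgeFinset hJ]
      decide
  obtain ⟨T, hT, hle⟩ := hM.exists_TSP I (RCS.three_le_card (d := 3) ⟨hH.1, hH.2.1⟩ (by norm_num))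
    fun S a ha b hb => by
      obtain ⟨x, hx, y, hy, h⟩ := connected_edgeFinset hH.2.1 S a ha b hb
      exact ⟨x, hx, y, hy, Multiset.mem_add.2 (Or.inl h)⟩
  refine ⟨T, hT, hle.trans ?_⟩
  rw [Multiset.map_add, Multiset.sum_add]
  change I.weight H + I.weight J ≤ _
  have := hJw I
  linarith

theorem MST_le_RCS (d : ℕ) : BoundedBy MST (RCS d) 1 := by
  refine boundedBy_of fun V _ I H hH => ?_
  obtain ⟨T, hle, hT⟩ := hH.2.exists_isTree_le
  exact ⟨T, hT, by rw [one_mul]; exact I.weight_mono hle⟩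

theorem RCS_le_RTwoCS (d : ℕ) : BoundedBy (RCS d) (RTwoCS d) 1 :=
  boundedBy_of fun _ _ _ H hH => ⟨H, ⟨hH.1, hH.2.1⟩, by rw [one_mul]⟩

theorem Factor_le_RCS (d : ℕ) : BoundedBy (Factor d) (RCS d) 1 :=
  boundedBy_of fun _ _ _ H hH => ⟨H, hH.1, by rw [one_mul]⟩

/-! ### Basic instances, and tightness from complete graphs. -/

section Instances

/-- The instance given by a pseudometric. -/
def MetricInstance.ofDist {V : Type*} (D : V → V → ℝ) (hs : ∀ x y, D x y = D y x)
    (h0 : ∀ x y, 0 ≤ D x y) (ht : ∀ x y z, D x z ≤ D x y + D y z) : MetricInstance V where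
  w := Sym2.lift ⟨D, hs⟩
  nonneg x y _ := h0 x y
  triangle x y z _ _ _ := ht x y z

/-- Weight `0` inside the fibres of `c` and weight `1` between them. -/
noncomputable def fibreInstance {V N : Type*} (c : V → N) : MetricInstance V :=
  MetricInstance.ofDist (fun x y => if c x = c y then 0 else 1) (fun x y => by simp only [eq_comm])
    (fun x y => by split_ifs <;> norm_num)
    (fun x y z => by
      by_cases h1 : c x = c y <;> by_cases h2 : c y = c z <;> by_cases h3 : c x = c z <;>
        simp_all)

lemma fibreInstance_w {V N : Type*} (c : V → N) (x y : V) :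
    (fibreInstance c).w s(x, y) = if c x = c y then 0 else 1 := rfl

lemma card_sub_one_le_weight {V N : Type*} [Fintype V] [Fintype N] {H : SimpleGraph V}
    (hH : H.Connected) {c : V → N} (hc : Function.Surjective c) (I : MetricInstance V)
    (hI : ∀ x y, c x ≠ c y → 1 ≤ I.w s(x, y)) : (Fintype.card N : ℝ) - 1 ≤ I.weight H := by
  have h1 := card_le_crossing hH c hc
  have h2 : pairSum H (fun x y => if c x = c y then (0 : ℝ) else 1) ≤
      pairSum H fun x y => I.w s(x, y) := by
    refine Finset.sum_le_sum fun x _ => Finset.sum_le_sum fun y _ => ?_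
    by_cases h : H.Adj x y
    · rw [if_pos h, if_pos h]
      dsimp only
      split_ifs with hxy
      · exact I.nonneg x y h.ne
      · exact hI x y hxy
    · rw [if_neg h, if_neg h]
  rw [weight_eq_pairSum]
  linarith

/-- Applied to the instance of weight zero, a bound transfers solvability from `Q` to `P`; this
supplies the solutions that tightness requires. -/
lemma BoundedBy.exists {P Q : Problem} {c : ℝ} (h : BoundedBy P Q c) {V : Type*} [Fintype V]
    {H : SimpleGraph V} (hH : Q V H) : ∃ H', P V H' := by
  obtain ⟨b, hb, -⟩ := exists_isOpt (fibreInstance (fun _ : V => ())) hH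
  obtain ⟨a, ha, -⟩ := h V _ b hb
  obtain ⟨H', hH', -⟩ := ha.1
  exact ⟨H', hH'⟩

lemma TSP.twoEdgeConnected {V : Type*} [Fintype V] {H : SimpleGraph V} (hH : TSP V H) :
    TwoEdgeConnected H := by
  obtain ⟨v, p, hp, -⟩ := hH
  have hham : H.IsHamiltonian := fun _ => ⟨v, p, hp⟩
  exact ⟨hham.connected, fun e _ he => he.not_isHamiltonian hham⟩

lemma Factor.weight_of_const {V : Type*} [Fintype V] {d : ℕ} {H : SimpleGraph V}
    (hH : Factor d V H) : (fibreInstance (id : V → V)).weight H = Fintype.card V * d / 2 := by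
  rw [weight_eq_pairSum]
  have h1 : pairSum H (fun x y => (fibreInstance (id : V → V)).w s(x, y)) =
      ∑ x : V, ((∑ y, if H.Adj x y then 1 else 0 : ℕ) : ℝ) := by
    rw [pairSum]
    push_cast
    refine Finset.sum_congr rfl fun x _ => Finset.sum_congr rfl fun y _ => ?_
    by_cases h : H.Adj x y
    · simp [fibreInstance_w, h, h.ne]
    · simp [h]
  rw [h1, Finset.sum_congr rfl fun x _ => by rw [factor_iff.1 hH x]]
  simp
  ring

lemma RCS_top (d : ℕ) : RCS d (Fin (d + 1)) ⊤ := by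
  refine ⟨factor_iff.2 fun x => ?_, SimpleGraph.connected_top⟩
  simp [Finset.sum_ite, Finset.filter_ne]

/-- With unit weights all `d`-factors have the same weight, and the complete graph on `d + 1`
vertices is a connected one. -/
theorem isTight_Factor_RCS {d : ℕ} (hd : 1 ≤ d) : IsTight (Factor d) (RCS d) 1 := by
  refine isTight_of fun ε hε => ⟨Fin (d + 1), inferInstance, fibreInstance id,
    Fintype.card (Fin (d + 1)) * d / 2, Fintype.card (Fin (d + 1)) * d / 2, ⟨⊤, (RCS_top d).1⟩,
    fun H hH => hH.weight_of_const.ge, ⟨⊤, RCS_top d, (RCS_top d).1.weight_of_const.le⟩, ?_, ?_⟩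
  · rw [Fintype.card_fin]
    positivity
  · have : (0 : ℝ) < Fintype.card (Fin (d + 1)) * d / 2 := by
      rw [Fintype.card_fin]
      positivity
    nlinarith

theorem isTight_Factor_sub_two {d : ℕ} (hd : Even d) (h4 : 4 ≤ d) :
    IsTight (Factor (d - 2)) (Factor d) (((d : ℝ) - 2) / d) := by
  have hd' : (4 : ℝ) ≤ d := by exact_mod_cast h4
  refine isTight_of fun ε hε => ⟨Fin (d + 1), inferInstance, fibreInstance id,
    (d + 1) * (d - 2) / 2, (d + 1) * d / 2, (Factor_sub_two_le hd h4).exists (RCS_top d).1,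
    fun H hH => ?_, ⟨⊤, (RCS_top d).1, ?_⟩, ?_, ?_⟩
  · rw [hH.weight_of_const, Fintype.card_fin, Nat.cast_sub (by omega)]
    push_cast
    exact le_rfl
  · rw [(RCS_top d).1.weight_of_const, Fintype.card_fin]
    push_cast
    exact le_rfl
  · have : (0 : ℝ) < d - 2 := by linarith
    positivity
  · have e : (((d : ℝ) - 2) / d - ε) * ((d + 1) * d / 2) =
        (d + 1) * (d - 2) / 2 - ε * ((d + 1) * d / 2) := by field_simp
    rw [e]
    have : 0 < ε * (((d : ℝ) + 1) * d / 2) := by positivity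
    linarith

lemma isTight_MST_RCS_one : IsTight MST (RCS 1) 1 := by
  refine isTight_of fun ε hε => ⟨Fin 2, inferInstance, fibreInstance id, 1, 1,
    (MST_le_RCS 1).exists (RCS_top 1), fun H hH => ?_, ⟨⊤, RCS_top 1, ?_⟩, one_pos, by linarith⟩
  · have := card_sub_one_le_weight hH.connected (c := (id : Fin 2 → Fin 2)) Function.surjective_id
      (fibreInstance id) fun x y h => by
        rw [fibreInstance_w, if_neg h]
    rw [Fintype.card_fin] at this
    norm_num at this
    exact this
  · rw [(RCS_top 1).1.weight_of_const (V := Fin 2)]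
    norm_num

end Instances

/-! ### Rings of cliques: tightness of the constants 1. -/

section Clusters

lemma tourLength_le_length {V : Type*} (I : MetricInstance V) (h : ∀ x y, I.dist x y ≤ 1)
    (l : List V) : tourLength I.dist l ≤ l.length := by
  have key : ∀ (t : List V) (a b : V), pathLength I.dist a t b ≤ t.length + 1 := by
    intro t
    induction t with
    | nil =>
      intro a b
      simpa [pathLength] using h a b
    | cons x t ih =>
      intro a b
      have h1 := ih x b
      have h2 := h a x
      rw [pathLength, List.length_cons]
      push_cast
      linarith
  cases l with
  | nil => simp [tourLength]
  | cons x t =>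
    rw [tourLength, List.length_cons]
    push_cast
    exact key t x x

/-- The disjoint union of `n` complete graphs on `d + 1` vertices. -/
def cliques (n d : ℕ) : SimpleGraph (Fin n × Fin (d + 1)) where
  Adj x y := x ≠ y ∧ x.1 = y.1
  symm := ⟨fun _ _ h => ⟨h.1.symm, h.2.symm⟩⟩
  loopless := ⟨fun _ h => h.1 rfl⟩

lemma cliques_factor (n d : ℕ) : Factor d _ (cliques n d) := by
  rw [factor_iff]
  rintro ⟨i, a⟩
  rw [Fintype.sum_prod_type, Finset.sum_eq_single i]
  · have : ∀ b, (cliques n d).Adj (i, a) (i, b) ↔ b ≠ a := by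
      intro b
      simp [cliques, eq_comm]
    simp only [this]
    simp [Finset.sum_ite, Finset.filter_ne']
  · intro j _ hj
    refine Finset.sum_eq_zero fun b _ => ?_
    rw [if_neg]
    exact fun h => hj h.2.symm
  · simp

/-- A third vertex of the clique lies on one side of `S` and gives a second cut edge to the other
end. -/
lemma two_le_cut_cliques {n d : ℕ} (hd : 2 ≤ d) {x y : Fin n × Fin (d + 1)}
    (hxy : (cliques n d).Adj x y) {S : Set (Fin n × Fin (d + 1))} (hx : x ∈ S) (hy : y ∉ S) :
    2 ≤ ((cutPairs (cliques n d) S).filter fun p => p.1.1 = x.1 ∧ p.2.1 = x.1).card := by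
  obtain ⟨r, hr⟩ : ∃ r : Fin (d + 1), r ∉ ({x.2, y.2} : Finset (Fin (d + 1))) := by
    by_contra! h
    have h1 := Finset.card_le_card (fun r _ => h r : univ ⊆ ({x.2, y.2} : Finset (Fin (d + 1))))
    have h2 := Finset.card_le_two (a := x.2) (b := y.2)
    rw [Finset.card_univ, Fintype.card_fin] at h1
    omega
  simp only [mem_insert, mem_singleton, not_or] at hr
  have h1 : (x, y) ∈ (cutPairs (cliques n d) S).filter fun p => p.1.1 = x.1 ∧ p.2.1 = x.1 := by
    simp [hx, hy, hxy, hxy.2.symm]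
  have hne1 : ((x.1, r) : Fin n × Fin (d + 1)) ≠ x := fun h => hr.1 (congrArg Prod.snd h)
  have hne2 : ((x.1, r) : Fin n × Fin (d + 1)) ≠ y := fun h => hr.2 (congrArg Prod.snd h)
  by_cases hrS : (x.1, r) ∈ S
  · refine Finset.one_lt_card.2 ⟨_, h1, ((x.1, r), y), ?_, fun h => hne1 (congrArg Prod.fst h).symm⟩
    have : (cliques n d).Adj (x.1, r) y := ⟨hne2, hxy.2⟩
    simp [hrS, hy, this, hxy.2.symm]
  · refine Finset.one_lt_card.2 ⟨_, h1, (x, (x.1, r)), ?_, fun h => hne2 (congrArg Prod.snd h).symm⟩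
    have : (cliques n d).Adj x (x.1, r) := ⟨hne1.symm, rfl⟩
    simp [hrS, hx, this]

/-- A cyclic exchange through one edge of each clique joins them into a ring. The cliques are free,
and the tour has `n` legs of length at most 1; any connected graph needs `n - 1` such links. -/
lemma exists_RTwoCS_of_cliques {n d : ℕ} (hn : 2 ≤ n) (hd : 2 ≤ d) :
    ∃ H : SimpleGraph (Fin n × Fin (d + 1)), RTwoCS d _ H ∧
      (fibreInstance (Prod.fst : Fin n × Fin (d + 1) → Fin n)).weight H ≤ n := by
  set I := fibreInstance (Prod.fst : Fin n × Fin (d + 1) → Fin n) with hI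
  let l : List (Fin n × Fin (d + 1)) := (List.finRange n).map fun i => (i, 0)
  have hmem : ∀ x ∈ l, x.2 = 0 := by
    intro x hx
    obtain ⟨i, -, rfl⟩ := List.mem_map.1 hx
    rfl
  have h01 : (1 : Fin (d + 1)) ≠ 0 := by
    rw [Ne, Fin.ext_iff, Fin.val_one', Fin.val_zero, Nat.mod_eq_of_lt (by omega)]
    exact one_ne_zero
  have hadj : ∀ x ∈ l, (cliques n d).Adj x (x.1, 1) := fun x hx =>
    ⟨fun h => h01 ((congrArg Prod.snd h).symm.trans (hmem x hx)), rfl⟩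
  have hlen : l.length = n := by simp [l]
  have hnd : l.Nodup := (List.nodup_finRange n).map fun i j h => congrArg Prod.fst h
  obtain ⟨H, h1, h2, h3⟩ := exists_cyclic_exchange I (cliques n d) l (fun x => (x.1, 1)) Prod.fst
    (fun x hx y hy h => Prod.ext h ((hmem x hx).trans (hmem y hy).symm)) hnd (fun _ _ => rfl) hadj
    (fun x hx y hy hxy h => hxy (Prod.ext h.2 ((hmem x hx).trans (hmem y hy).symm)))
    (by rw [hlen]; exact hn)
    (fun x hx S hS => by
      by_cases hxS : x ∈ S
      · convert two_le_cut_cliques hd (hadj x hx) hxS fun h => hS (by simp [hxS, h])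
      · have : (x.1, (1 : Fin (d + 1))) ∈ S := by
          by_contra h
          exact hS (by simp [hxS, h])
        convert two_le_cut_cliques hd (hadj x hx).symm this hxS)
  have hne : Nonempty (Fin n × Fin (d + 1)) := ⟨(⟨0, by omega⟩, 0)⟩
  refine ⟨H, ⟨h1 d (cliques_factor n d), twoEdgeConnected_of_cut fun S a ha b hb => ?_⟩, ?_⟩
  · rcases h3 S with h | ⟨h, hS⟩
    · exact h
    · rw [h]
      by_contra hlt
      have hsame : ∀ x y : Fin n × Fin (d + 1), x.1 = y.1 → x ∈ S → y ∈ S := by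
        intro x y hxy hx
        by_contra hy
        have hadj' : (cliques n d).Adj x y := ⟨fun h => hy (h ▸ hx), hxy⟩
        exact hlt ((two_le_cut_cliques hd hadj' hx hy).trans
          (Finset.card_le_card (Finset.filter_subset _ _)))
      have hl : ∀ i, (i, (0 : Fin (d + 1))) ∈ l := fun i => by simp [l]
      have h4 := hsame a (a.1, 0) rfl ha
      have h5 := ((hS _ (hl a.1)).2 _ (hl b.1)).1 h4
      exact hb (hsame (b.1, 0) b rfl h5)
  · have h4 : I.weight (cliques n d) = 0 := by
      rw [weight_eq_pairSum, pairSum]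
      have : ∀ x y, (if (cliques n d).Adj x y then I.w s(x, y) else 0) = 0 := by
        intro x y
        split_ifs with h
        · rw [hI, fibreInstance_w, if_pos h.2]
        · rfl
      simp [this]
    have h5 := tourLength_le_length I (fun x y => by
      unfold MetricInstance.dist
      rw [hI, fibreInstance_w]
      split_ifs <;> norm_num) l
    rw [hlen] at h5
    linarith

/-- Problems that force connectedness are tight against problems that `RTwoCS d` satisfies. -/
lemma isTight_one_of {P Q : Problem} {d : ℕ} (hd : 2 ≤ d)
    (hP : ∀ (V : Type) [Fintype V] (H : SimpleGraph V), P V H → H.Connected)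
    (hQ : ∀ (V : Type) [Fintype V] (H : SimpleGraph V), RTwoCS d V H → Q V H)
    (hPQ : BoundedBy P Q 1) : IsTight P Q 1 := by
  refine isTight_of fun ε hε => ?_
  -- With `k + 2` cliques the ratio is at least `(k + 1) / (k + 2)`, and `1 < ε * k` makes this
  -- exceed `1 - ε`.
  obtain ⟨k, hk⟩ := exists_nat_gt (1 / ε)
  obtain ⟨H, hH, hw⟩ := exists_RTwoCS_of_cliques (n := k + 2) (by omega) hd
  refine ⟨Fin (k + 2) × Fin (d + 1), inferInstance, fibreInstance Prod.fst, (k : ℝ) + 1,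
    (k : ℝ) + 2, hPQ.exists (hQ _ H hH), fun H' hH' => ?_,
    ⟨H, hQ _ H hH, by exact_mod_cast hw⟩, by positivity, ?_⟩
  · have := card_sub_one_le_weight (hP _ H' hH')
      (c := (Prod.fst : Fin (k + 2) × Fin (d + 1) → Fin (k + 2))) Prod.fst_surjective
      (fibreInstance Prod.fst) fun x y h => by rw [fibreInstance_w, if_neg h]
    rw [Fintype.card_fin] at this
    push_cast at this
    linarith
  · rw [div_lt_iff₀ hε] at hk
    nlinarith

end Clusters

theorem isTight_MST_RCS {d : ℕ} (hd : 1 ≤ d) : IsTight MST (RCS d) 1 := by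
  rcases hd.eq_or_lt with rfl | hd
  · exact isTight_MST_RCS_one
  · exact isTight_one_of hd (fun _ _ _ h => h.connected) (fun _ _ _ h => ⟨h.1, h.2.1⟩)
      (MST_le_RCS d)

theorem isTight_RCS_RTwoCS {d : ℕ} (hd : 2 ≤ d) : IsTight (RCS d) (RTwoCS d) 1 :=
  isTight_one_of hd (fun _ _ _ h => h.2) (fun _ _ _ h => h) (RCS_le_RTwoCS d)

theorem isTight_MST_RTwoCS {d : ℕ} (hd : 2 ≤ d) : IsTight MST (RTwoCS d) 1 := by
  refine isTight_one_of hd (fun _ _ _ h => h.connected) (fun _ _ _ h => h)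
    (boundedBy_of fun V _ I H hH => ?_)
  obtain ⟨T, hle, hT⟩ := hH.2.1.exists_isTree_le
  exact ⟨T, hT, by rw [one_mul]; exact I.weight_mono hle⟩

theorem isTight_TSP_RCS_even {d : ℕ} (hd : Even d) (h2 : 2 ≤ d) : IsTight TSP (RCS d) 1 :=
  isTight_one_of h2 (fun _ _ _ h => h.twoEdgeConnected.1) (fun _ _ _ h => ⟨h.1, h.2.1⟩)
    (TSP_le_RCS_even hd h2)

theorem isTight_RCS_sub_two {d : ℕ} (hd : Even d) (h4 : 4 ≤ d) :
    IsTight (RCS (d - 2)) (RCS d) 1 :=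
  isTight_one_of (by omega) (fun _ _ _ h => h.2) (fun _ _ _ h => ⟨h.1, h.2.1⟩)
    (RCS_sub_two_le hd h4)

lemma two_le_cut_of_four_cycle {V : Type*} [Fintype V] {H : SimpleGraph V} {S : Set V}
    {x y p q : V} (hx : x ∈ S) (hy : y ∉ S) (hxy : H.Adj x y) (hxp : H.Adj x p) (hpq : H.Adj p q)
    (hqy : H.Adj q y) (hpy : p ≠ y) (hxq : x ≠ q) : 2 ≤ cut H S := by
  by_cases hp : p ∈ S
  · by_cases hq : q ∈ S
    · exact two_le_cut_of hx hy hxy hq hy hqy fun h => hxq (congrArg Prod.fst h)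
    · exact two_le_cut_of hx hy hxy hp hq hpq fun h => hxp.ne (congrArg Prod.fst h)
  · exact two_le_cut_of hx hy hxy hx hp hxp fun h => hpy (congrArg Prod.snd h).symm

/-! ### Clusters that turn a small pattern of links into a factor of odd degree. -/

section Gadget
variable {T N : Type*} {m : ℕ}

/-- Attach to each `n : N` a cluster of `2 * m` further vertices, arranged as `m` couples, that are
joined to all ports `a` of `n` (the `a : T` with `c a = some n`). Vertices of a cluster are adjacent
if they lie in different couples; the couples of `n` are themselves joined if `two n`. -/
def gadget (m : ℕ) (Y : SimpleGraph T) (c : T → Option N) (two : N → Prop) :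
    SimpleGraph (T ⊕ N × Fin m × Bool) where
  Adj x y := match x, y with
    | Sum.inl a, Sum.inl b => Y.Adj a b
    | Sum.inl a, Sum.inr q => c a = some q.1
    | Sum.inr q, Sum.inl a => c a = some q.1
    | Sum.inr q, Sum.inr r => q.1 = r.1 ∧ (q.2.1 ≠ r.2.1 ∨ (two q.1 ∧ q.2.2 ≠ r.2.2))
  symm := ⟨by
    rintro (a | q) (b | r) h
    · exact Y.adj_symm h
    · exact h
    · exact h
    · obtain ⟨h1, h2⟩ := h
      refine ⟨h1.symm, h2.imp Ne.symm fun h => ⟨h1 ▸ h.1, h.2.symm⟩⟩⟩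
  loopless := ⟨by
    rintro (a | q) h
    · exact Y.loopless.irrefl a h
    · rcases h.2 with h | h
      · exact h rfl
      · exact h.2 rfl⟩

/-- The cluster to which a vertex of a gadget belongs. -/
def clusterOf (m : ℕ) (c : T → Option N) : T ⊕ N × Fin m × Bool → Option N :=
  Sum.elim c fun q => some q.1

variable {Y : SimpleGraph T} {c : T → Option N} {two : N → Prop}

lemma gadget_inl_inl {a b : T} :
    (gadget m Y c two).Adj (Sum.inl a) (Sum.inl b) ↔ Y.Adj a b := Iff.rfl

lemma gadget_inl_inr {a : T} {q : N × Fin m × Bool} :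
    (gadget m Y c two).Adj (Sum.inl a) (Sum.inr q) ↔ c a = some q.1 := Iff.rfl

lemma gadget_inr_inl {a : T} {q : N × Fin m × Bool} :
    (gadget m Y c two).Adj (Sum.inr q) (Sum.inl a) ↔ c a = some q.1 := Iff.rfl

lemma gadget_inr_inr {q r : N × Fin m × Bool} :
    (gadget m Y c two).Adj (Sum.inr q) (Sum.inr r) ↔
      q.1 = r.1 ∧ (q.2.1 ≠ r.2.1 ∨ (two q.1 ∧ q.2.2 ≠ r.2.2)) := Iff.rfl

variable [Fintype T] [Fintype N]

/-- A port sees the `2 * m` vertices of its cluster and one link. A cluster vertex sees `2 * m - 2`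
vertices of other couples and three more: three ports, or two ports and its partner. -/
lemma gadget_factor
    (h1 : ∀ a, (∑ b, if Y.Adj a b then 1 else 0) = if (c a).isSome then 1 else 2 * m + 1)
    (h2 : ∀ n, (∑ a, if c a = some n then 1 else 0) = if two n then 2 else 3) :
    Factor (2 * m + 1) _ (gadget m Y c two) := by
  rw [factor_iff]
  rintro (a | ⟨n, i, s⟩)
  · simp only [Fintype.sum_sum_type, gadget_inl_inl, gadget_inl_inr, h1 a]
    rcases h : c a with _ | n
    · simp
    · have : ∑ q : N × Fin m × Bool, (if some n = some q.1 then 1 else 0) = 2 * m := by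
        rw [Fintype.sum_prod_type, Finset.sum_eq_single n]
        · simp
          ring
        · intro n' _ hn
          simp [hn.symm]
        · simp
      rw [this]
      simp
      ring
  · simp only [Fintype.sum_sum_type, gadget_inr_inl, gadget_inr_inr, h2 n]
    have h3 : ∑ q : N × Fin m × Bool, (if n = q.1 ∧ (i ≠ q.2.1 ∨ two n ∧ s ≠ q.2.2) then 1 else 0)
        + 2 = 2 * m + if two n then 1 else 0 := by
      rw [Fintype.sum_prod_type, Finset.sum_eq_single n, Fintype.sum_prod_type,
        ← Finset.add_sum_erase _ _ (mem_univ i)]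
      · have h4 : ∑ j ∈ univ.erase i, ∑ t : Bool,
            (if n = (n, j, t).1 ∧ (i ≠ (n, j, t).2.1 ∨ two n ∧ s ≠ (n, j, t).2.2) then 1 else 0) =
            ∑ j ∈ univ.erase i, 2 := by
          refine Finset.sum_congr rfl fun j hj => ?_
          have := (Finset.ne_of_mem_erase hj).symm
          simp [this]
        rw [h4]
        have hm : 0 < m := i.pos
        have h5 : ∑ t : Bool, (if n = (n, i, t).1 ∧
            (i ≠ (n, i, t).2.1 ∨ two n ∧ s ≠ (n, i, t).2.2) then 1 else 0) =
            if two n then 1 else 0 := by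
          by_cases ht : two n <;> cases s <;> simp [ht]
        rw [h5]
        simp only [Finset.sum_const, Finset.card_erase_of_mem (mem_univ i), Finset.card_univ,
          Fintype.card_fin, smul_eq_mul]
        omega
      · intro n' _ hn
        simp [hn.symm]
      · simp
    by_cases ht : two n
    · rw [if_pos ht] at h3 ⊢
      omega
    · rw [if_neg ht] at h3 ⊢
      omega

/-- A cut of a gadget with at most one edge splits no cluster. -/
lemma mem_iff_of_clusterOf_eq (hm : 0 < m) {S : Set (T ⊕ N × Fin m × Bool)}
    (h2 : ∀ n, ∃ a b, a ≠ b ∧ c a = some n ∧ c b = some n)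
    (hS : cut (gadget m Y c two) S < 2) {x y : T ⊕ N × Fin m × Bool} {n : N}
    (hx : clusterOf m c x = some n) (hy : clusterOf m c y = some n) : x ∈ S ↔ y ∈ S := by
  -- A port and a cluster vertex lie on a four-cycle with the partner and a second port, and a cut
  -- that meets a cycle has at least two of its edges.
  have key : ∀ a : T, ∀ q : N × Fin m × Bool, c a = some n → q.1 = n →
      (Sum.inl a ∈ S ↔ Sum.inr q ∈ S) := by
    rintro a ⟨n', i, s⟩ ha rfl
    obtain ⟨b, hb, hab⟩ : ∃ b, c b = some n' ∧ b ≠ a := by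
      obtain ⟨b, b', hbb, hb, hb'⟩ := h2 n'
      by_cases h : b = a
      · exact ⟨b', hb', fun h' => hbb (h.trans h'.symm)⟩
      · exact ⟨b, hb, h⟩
    have hr : (Sum.inr (n', i, s) : T ⊕ N × Fin m × Bool) ≠ Sum.inr (n', i, !s) := by simp
    have hl : (Sum.inl a : T ⊕ N × Fin m × Bool) ≠ Sum.inl b := fun h => hab (Sum.inl_injective h).symm
    by_contra hne
    by_cases haS : Sum.inl a ∈ S
    · have hqS : (Sum.inr (n', i, s) : T ⊕ N × Fin m × Bool) ∉ S := fun h => hne (by simp [haS, h])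
      exact absurd (two_le_cut_of_four_cycle (H := gadget m Y c two) haS hqS (p := Sum.inr (n', i, !s)) (q := Sum.inl b)
        ha ha hb hb hr.symm hl) (by omega)
    · have hqS : (Sum.inr (n', i, s) : T ⊕ N × Fin m × Bool) ∈ S := by
        by_contra h
        exact hne (by simp [haS, h])
      exact absurd (two_le_cut_of_four_cycle (H := gadget m Y c two) hqS haS (p := Sum.inl b) (q := Sum.inr (n', i, !s))
        ha hb hb ha hl.symm hr) (by omega)
  obtain ⟨a, -, -, ha, -⟩ := h2 n
  have h3 : ∀ z, clusterOf m c z = some n → (z ∈ S ↔ Sum.inl a ∈ S) := by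
    rintro (b | q) hz
    · exact (key b (n, ⟨0, hm⟩, false) hz rfl).trans (key a (n, ⟨0, hm⟩, false) ha rfl).symm
    · exact (key a q ha (Option.some_injective _ hz)).symm
  exact (h3 x hx).trans (h3 y hy).symm

/-- All edges other than the links of `Y` lie inside a cluster, where `φ` vanishes. -/
lemma pairSum_gadget {R : Type*} [AddCommMonoid R]
    (φ : T ⊕ N × Fin m × Bool → T ⊕ N × Fin m × Bool → R)
    (hφ : ∀ x y n, clusterOf m c x = some n → clusterOf m c y = some n → φ x y = 0) :
    pairSum (gadget m Y c two) φ = pairSum Y fun a b => φ (Sum.inl a) (Sum.inl b) := by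
  simp only [pairSum, Fintype.sum_sum_type, gadget_inl_inl, gadget_inl_inr, gadget_inr_inl,
    gadget_inr_inr]
  have h1 : ∀ a, ∑ q : N × Fin m × Bool,
      (if c a = some q.1 then φ (Sum.inl a) (Sum.inr q) else 0) = 0 := by
    refine fun a => Finset.sum_eq_zero fun q _ => ?_
    split_ifs with h
    · exact hφ _ _ q.1 h rfl
    · rfl
  have h2 : ∀ q : N × Fin m × Bool, ∑ a,
      (if c a = some q.1 then φ (Sum.inr q) (Sum.inl a) else 0) = 0 := by
    refine fun q => Finset.sum_eq_zero fun a _ => ?_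
    split_ifs with h
    · exact hφ _ _ q.1 rfl h
    · rfl
  have h3 : ∀ q : N × Fin m × Bool, ∑ r : N × Fin m × Bool,
      (if q.1 = r.1 ∧ (q.2.1 ≠ r.2.1 ∨ two q.1 ∧ q.2.2 ≠ r.2.2) then
        φ (Sum.inr q) (Sum.inr r) else 0) = 0 := by
    refine fun q => Finset.sum_eq_zero fun r _ => ?_
    split_ifs with h
    · exact hφ _ _ q.1 rfl (congrArg some h.1.symm)
    · rfl
  simp [h1, h2, h3]

end Gadget

/-! ### Two odd clusters joined by a bridge: tightness of the constants 3 and 2. -/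

section Bridge

/-- Two triangles' worth of ports: one link between the two sides, one inside each side. -/
def bridgePorts : SimpleGraph (Bool × Fin 3) where
  Adj x y := (x.2 = 0 ∧ y.2 = 0 ∧ x.1 ≠ y.1) ∨ (x.1 = y.1 ∧ x.2 ≠ 0 ∧ y.2 ≠ 0 ∧ x.2 ≠ y.2)
  symm := ⟨by
    rintro x y (h | h)
    · exact Or.inl ⟨h.2.1, h.1, h.2.2.symm⟩
    · exact Or.inr ⟨h.1.symm, h.2.2.1, h.2.1, h.2.2.2.symm⟩⟩
  loopless := ⟨by
    rintro x (h | h)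
    · exact h.2.2 rfl
    · exact h.2.2.2 rfl⟩

/-- A connected `(2 * m + 1)`-factor with a bridge. -/
def bridgeGraph (m : ℕ) : SimpleGraph (Bool × Fin 3 ⊕ Bool × Fin m × Bool) :=
  gadget m bridgePorts (fun t => some t.1) fun _ => False

/-- The side of a vertex of `bridgeGraph`. -/
def bridgeSide (m : ℕ) : Bool × Fin 3 ⊕ Bool × Fin m × Bool → Bool := Sum.elim Prod.fst Prod.fst

lemma clusterOf_bridge (m : ℕ) (x : Bool × Fin 3 ⊕ Bool × Fin m × Bool) :
    clusterOf m (fun t : Bool × Fin 3 => some t.1) x = some (bridgeSide m x) := by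
  cases x <;> rfl

lemma bridgeGraph_weight (m : ℕ) : (fibreInstance (bridgeSide m)).weight (bridgeGraph m) = 1 := by
  rw [weight_eq_pairSum, bridgeGraph, pairSum_gadget]
  · simp [pairSum, fibreInstance_w, bridgeSide, bridgePorts, Fintype.sum_prod_type,
      Fin.sum_univ_three]
    norm_num
  · intro x y n hx hy
    rw [clusterOf_bridge] at hx hy
    rw [fibreInstance_w, if_pos (Option.some_injective _ (hx.trans hy.symm))]

lemma bridgeGraph_RCS {m : ℕ} (hm : 0 < m) : RCS (2 * m + 1) _ (bridgeGraph m) := by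
  have hne : Nonempty (Bool × Fin 3 ⊕ Bool × Fin m × Bool) := ⟨Sum.inl (false, 0)⟩
  refine ⟨gadget_factor ?_ ?_, connected_of_cut fun S a ha b hb => ?_⟩
  · rintro ⟨s, i⟩
    rw [Fintype.sum_prod_type]
    cases s <;> fin_cases i <;> simp [bridgePorts, Fin.sum_univ_three, -Finset.sum_boole]
  · rintro s
    rw [Fintype.sum_prod_type]
    cases s <;> simp [-Finset.sum_boole]
  · by_contra h0
    have hu : ∀ {x y n}, _ → _ → (x ∈ S ↔ y ∈ S) := fun {x y n} =>
      mem_iff_of_clusterOf_eq hm (Y := bridgePorts) (c := fun t : Bool × Fin 3 => some t.1)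
        (two := fun _ => False) (S := S) (x := x) (y := y) (n := n)
        (fun n => ⟨(n, 0), (n, 1), by simp, rfl, rfl⟩) (by
          change cut (bridgeGraph m) S < 2
          omega)
    have h1 : ∀ s, (Sum.inl (s, 0) ∈ S ↔ Sum.inl (!s, 0) ∈ S) := by
      intro s
      have hadj : (bridgeGraph m).Adj (Sum.inl (s, 0)) (Sum.inl (!s, 0)) :=
        Or.inl ⟨rfl, rfl, by simp⟩
      by_contra hne
      by_cases hs : (Sum.inl (s, 0) : Bool × Fin 3 ⊕ Bool × Fin m × Bool) ∈ S
      · have hs' : (Sum.inl (!s, 0) : Bool × Fin 3 ⊕ Bool × Fin m × Bool) ∉ S :=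
          fun h => hne (by simp only [hs, h])
        exact h0 (cut_pos_iff.2 ⟨_, hs, _, hs', hadj⟩)
      · have hs' : (Sum.inl (!s, 0) : Bool × Fin 3 ⊕ Bool × Fin m × Bool) ∈ S := by
          by_contra h
          exact hne (by simp only [hs, h])
        exact h0 (cut_pos_iff.2 ⟨_, hs', _, hs, hadj.symm⟩)
    have h2 : ∀ x, (x ∈ S ↔ Sum.inl (bridgeSide m x, 0) ∈ S) := fun x =>
      hu (clusterOf_bridge m x) rfl
    have h3 : ∀ x, (x ∈ S ↔ Sum.inl (false, 0) ∈ S) := by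
      intro x
      rw [h2 x]
      cases bridgeSide m x
      · rfl
      · exact h1 true
    exact hb ((h3 b).2 ((h3 a).1 ha))

lemma fibreInstance_bool_weight {V : Type*} [Fintype V] (ℓ : V → Bool) (H : SimpleGraph V) :
    (fibreInstance ℓ).weight H = cut H {x | ℓ x = true} := by
  have h := two_mul_cut H {x | ℓ x = true}
  have h' : (2 : ℝ) * cut H {x | ℓ x = true} = pairSum H fun x y => (fibreInstance ℓ).w s(x, y) := by
    rw [← Nat.cast_two, ← Nat.cast_mul, h]
    simp only [pairSum]
    push_cast
    refine Finset.sum_congr rfl fun x _ => Finset.sum_congr rfl fun y _ => ?_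
    rw [fibreInstance_w]
    by_cases hx : ℓ x = true <;> by_cases hy : ℓ y = true <;> simp [hx, hy]
  rw [weight_eq_pairSum, ← h']
  ring

lemma two_le_cut_bridgeSide {m : ℕ} {H : SimpleGraph (Bool × Fin 3 ⊕ Bool × Fin m × Bool)}
    (hH : TwoEdgeConnected H) : 2 ≤ cut H {x | bridgeSide m x = true} :=
  hH.two_le_cut (a := Sum.inl (true, 0)) (b := Sum.inl (false, 0)) rfl (by simp [bridgeSide])

/-- Each side has the odd number `2 * m + 3` of vertices, so the links between the sides are odd in
number; 2-edge-connectivity excludes a single one, and the graph with the bridge has weight 1. -/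
theorem isTight_RTwoCS_RCS {d : ℕ} (hd : Odd d) (h3 : 3 ≤ d) : IsTight (RTwoCS d) (RCS d) 3 := by
  obtain ⟨m, rfl⟩ := hd
  refine isTight_of fun ε hε => ⟨_, inferInstance, fibreInstance (bridgeSide m), 3, 1,
    (RTwoCS_le_three_mul_RCS (by omega)).exists (bridgeGraph_RCS (by omega)), fun H hH => ?_,
    ⟨_, bridgeGraph_RCS (by omega), (bridgeGraph_weight m).le⟩, by norm_num, by linarith⟩
  have h1 := two_le_cut_bridgeSide hH.2
  have hodd : Odd (univ.filter (· ∈ {x | bridgeSide m x = true})).card := by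
    rw [Finset.card_filter, Fintype.sum_sum_type]
    simp [bridgeSide, Fintype.sum_prod_type]
    exact ⟨m + 1, by ring⟩
  have h2 := hH.1.odd_cut ⟨m, rfl⟩ {x | bridgeSide m x = true} (by convert hodd)
  rw [fibreInstance_bool_weight]
  obtain ⟨k, hk⟩ := h2
  have : 3 ≤ cut H {x | bridgeSide m x = true} := by omega
  exact_mod_cast this

/-- A Hamiltonian cycle crosses between the sides at least twice. -/
theorem isTight_TSP_RCS_odd {d : ℕ} (hd : Odd d) (h3 : 3 ≤ d) : IsTight TSP (RCS d) 2 := by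
  obtain ⟨m, rfl⟩ := hd
  refine isTight_of fun ε hε => ⟨_, inferInstance, fibreInstance (bridgeSide m), 2, 1,
    (TSP_le_two_mul_RCS (by omega)).exists (bridgeGraph_RCS (by omega)), fun H hH => ?_,
    ⟨_, bridgeGraph_RCS (by omega), (bridgeGraph_weight m).le⟩, by norm_num, by linarith⟩
  rw [fibreInstance_bool_weight]
  exact_mod_cast two_le_cut_bridgeSide (TSP.twoEdgeConnected hH)

end Bridge

/-! ### Connected regular graphs of prescribed degree, needed for the smaller degree in the star
example. -/

section Circulant

/-- The bipartite Cayley graph of the differences in `A`. -/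
def bipartiteCayley {G : Type*} [AddGroup G] (A : Finset G) : SimpleGraph (G × Bool) where
  Adj x y := (x.2 = false ∧ y.2 = true ∧ y.1 - x.1 ∈ A) ∨ (x.2 = true ∧ y.2 = false ∧ x.1 - y.1 ∈ A)
  symm := ⟨by
    rintro x y (⟨h1, h2, h⟩ | ⟨h1, h2, h⟩)
    · exact Or.inr ⟨h2, h1, h⟩
    · exact Or.inl ⟨h2, h1, h⟩⟩
  loopless := ⟨by
    rintro x (⟨h1, h2, h⟩ | ⟨h1, h2, h⟩) <;> simp [h1] at h2⟩

lemma bipartiteCayley_factor {G : Type*} [AddGroup G] [Fintype G] (A : Finset G) :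
    Factor A.card _ (bipartiteCayley A) := by
  rw [factor_iff]
  rintro ⟨i, s⟩
  rw [Fintype.sum_prod_type]
  cases s
  · rw [← Equiv.sum_comp (Equiv.addRight i)]
    simp [bipartiteCayley, -Finset.sum_boole]
  · rw [← Equiv.sum_comp ((Equiv.neg G).trans (Equiv.addRight i))]
    simp [bipartiteCayley, sub_eq_add_neg, -Finset.sum_boole]

/-- The differences 0 and 1 alone form a zigzag through all vertices. -/
lemma bipartiteCayley_connected {M : ℕ} [NeZero M] {A : Finset (ZMod M)} (h0 : 0 ∈ A)
    (h1 : 1 ∈ A) : (bipartiteCayley A).Connected := by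
  have step0 : ∀ i : ZMod M, (bipartiteCayley A).Reachable (i, false) (i, true) := fun i =>
    SimpleGraph.Adj.reachable (Or.inl ⟨rfl, rfl, by simpa using h0⟩)
  have step1 : ∀ i : ZMod M, (bipartiteCayley A).Reachable (i, false) (i + 1, true) := fun i =>
    SimpleGraph.Adj.reachable (Or.inl ⟨rfl, rfl, by simpa using h1⟩)
  have h2 : ∀ n : ℕ, (bipartiteCayley A).Reachable (0, false) ((n : ZMod M), false) := by
    intro n
    induction n with
    | zero => simp
    | succ n ih =>
      push_cast
      exact (ih.trans (step1 _)).trans (step0 _).symm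
  have h3 : ∀ x, (bipartiteCayley A).Reachable (0, false) x := by
    rintro ⟨i, s⟩
    obtain ⟨n, rfl⟩ := ZMod.natCast_zmod_surjective i
    cases s
    · exact h2 n
    · exact (h2 n).trans (step0 _)
  have : Nonempty (ZMod M × Bool) := ⟨(0, false)⟩
  exact ⟨fun x y => (h3 x).symm.trans (h3 y)⟩

lemma exists_RCS {V : Type*} [Fintype V] {k M : ℕ} (hV : Fintype.card V = 2 * M) (h2 : 2 ≤ k)
    (hk : k ≤ M) : ∃ H, RCS k V H := by
  have : NeZero M := ⟨by omega⟩
  have : Fact (1 < M) := ⟨by omega⟩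
  obtain ⟨A, hA, hcard⟩ := Finset.exists_superset_card_eq (s := ({0, 1} : Finset (ZMod M)))
    (n := k) (Finset.card_le_two.trans h2) (by rw [ZMod.card]; exact hk)
  let e : V ≃ ZMod M × Bool := Fintype.equivOfCardEq (by
    rw [hV, Fintype.card_prod, ZMod.card, Fintype.card_bool, mul_comm])
  refine ⟨(bipartiteCayley A).comap e, factor_iff.2 fun x => ?_,
    (SimpleGraph.Iso.comap e _).connected_iff.2
      (bipartiteCayley_connected (hA (by simp)) (hA (by simp)))⟩
  have h := factor_iff.1 (bipartiteCayley_factor A) (e x)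
  rw [← Equiv.sum_comp e, hcard] at h
  exact h

end Circulant

/-! ### A star of odd clusters: failure of monotonicity for odd degree. -/

section Star

/-- The distance in a star whose leg to the fibre of `n` has length `h n`. -/
noncomputable def starInstance {V N : Type*} (L : V → N) (h : N → ℝ) (h0 : ∀ n, 0 ≤ h n) :
    MetricInstance V :=
  MetricInstance.ofDist (fun x y => if L x = L y then 0 else h (L x) + h (L y))
    (fun x y => by simp only [eq_comm, add_comm])
    (fun x y => by
      have := h0 (L x)
      have := h0 (L y)
      split_ifs <;> linarith)
    (fun x y z => by
      have := h0 (L x)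
      have := h0 (L y)
      have := h0 (L z)
      by_cases h1 : L x = L y
      · simp [h1]
      · by_cases h2 : L y = L z
        · simp [h2]
        · rw [if_neg h1, if_neg h2]
          split_ifs <;> linarith)

lemma starInstance_w {V N : Type*} (L : V → N) (h : N → ℝ) (h0 : ∀ n, 0 ≤ h n) (x y : V) :
    (starInstance L h h0).w s(x, y) = if L x = L y then 0 else h (L x) + h (L y) := rfl

/-- A centre `none` joined to the port `(a, 0)` of each of the `d` clusters. -/
def starPorts (d : ℕ) : SimpleGraph (Option (Fin d × Fin 3)) where
  Adj x y := match x, y with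
    | none, none => False
    | none, some p => p.2 = 0
    | some p, none => p.2 = 0
    | some p, some q => p.1 = q.1 ∧ p.2 ≠ 0 ∧ q.2 ≠ 0 ∧ p.2 ≠ q.2
  symm := ⟨by
    rintro (_ | p) (_ | q) h
    · exact h
    · exact h
    · exact h
    · exact ⟨h.1.symm, h.2.2.1, h.2.1, h.2.2.2.symm⟩⟩
  loopless := ⟨by
    rintro (_ | p) h
    · exact h
    · exact h.2.2.2 rfl⟩

lemma starPorts_none_none {d : ℕ} : (starPorts d).Adj none none ↔ False := Iff.rfl

lemma starPorts_none_some {d : ℕ} {p : Fin d × Fin 3} :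
    (starPorts d).Adj none (some p) ↔ p.2 = 0 := Iff.rfl

lemma starPorts_some_none {d : ℕ} {p : Fin d × Fin 3} :
    (starPorts d).Adj (some p) none ↔ p.2 = 0 := Iff.rfl

lemma starPorts_some_some {d : ℕ} {p q : Fin d × Fin 3} :
    (starPorts d).Adj (some p) (some q) ↔ p.1 = q.1 ∧ p.2 ≠ 0 ∧ q.2 ≠ 0 ∧ p.2 ≠ q.2 := Iff.rfl

/-- Vertices of the connected `(2 * m + 1)`-factor with a central cut vertex. -/
abbrev StarVertex (m : ℕ) := Option (Fin (2 * m + 1) × Fin 3) ⊕ Fin (2 * m + 1) × Fin m × Bool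

def starCluster (m : ℕ) : Option (Fin (2 * m + 1) × Fin 3) → Option (Fin (2 * m + 1)) :=
  Option.map Prod.fst

def starGraph (m : ℕ) : SimpleGraph (StarVertex m) :=
  gadget m (starPorts (2 * m + 1)) (starCluster m) fun _ => False

/-- Distance `1` between the centre and a cluster and distance `2` between two clusters. -/
noncomputable def starMetric (m : ℕ) : MetricInstance (StarVertex m) :=
  starInstance (clusterOf m (starCluster m)) (fun n => if n = none then 0 else 1)
    fun n => by split_ifs <;> norm_num

lemma starMetric_w {m : ℕ} (x y : StarVertex m) : (starMetric m).w s(x, y) =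
    if clusterOf m (starCluster m) x = clusterOf m (starCluster m) y then 0 else
      (if clusterOf m (starCluster m) x = none then 0 else 1) +
      if clusterOf m (starCluster m) y = none then 0 else 1 := by
  unfold starMetric
  rw [starInstance_w]
  congr

lemma starGraph_weight (m : ℕ) : (starMetric m).weight (starGraph m) = 2 * m + 1 := by
  rw [weight_eq_pairSum, starGraph, pairSum_gadget]
  · have h1 : ∀ p q : Fin (2 * m + 1) × Fin 3,
        (if (starPorts (2 * m + 1)).Adj (some p) (some q) then
          (starMetric m).w s(Sum.inl (some p), Sum.inl (some q)) else 0) = 0 := by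
      intro p q
      split_ifs with h
      · rw [starMetric_w, if_pos]
        exact congrArg some h.1
      · rfl
    have h2 : ∀ p : Fin (2 * m + 1) × Fin 3,
        (if (starPorts (2 * m + 1)).Adj (some p) none then
          (starMetric m).w s(Sum.inl (some p), Sum.inl none) else 0) =
        if p.2 = 0 then 1 else 0 := by
      intro p
      simp only [starPorts_some_none, starMetric_w, clusterOf, Sum.elim_inl, starCluster]
      simp
    have h3 : ∀ p : Fin (2 * m + 1) × Fin 3,
        (if (starPorts (2 * m + 1)).Adj none (some p) then
          (starMetric m).w s(Sum.inl none, Sum.inl (some p)) else 0) =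
        if p.2 = 0 then 1 else 0 := by
      intro p
      simp only [starPorts_none_some, starMetric_w, clusterOf, Sum.elim_inl, starCluster]
      simp
    have h4 : ∑ p : Fin (2 * m + 1) × Fin 3, (if p.2 = 0 then (1 : ℝ) else 0) = 2 * m + 1 := by
      rw [Fintype.sum_prod_type]
      simp
    simp only [pairSum, Fintype.sum_option, starPorts_none_none, if_false, h1, h2, h3,
      Finset.sum_const_zero, add_zero, zero_add, h4]
    ring
  · intro x y n hx hy
    rw [starMetric_w, if_pos (hx.trans hy.symm)]

lemma starGraph_RCS {m : ℕ} (hm : 0 < m) : RCS (2 * m + 1) _ (starGraph m) := by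
  have hne : Nonempty (StarVertex m) := ⟨Sum.inl none⟩
  refine ⟨gadget_factor ?_ ?_, connected_of_cut fun S a ha b hb => ?_⟩
  · rintro (_ | ⟨a, i⟩)
    · rw [Fintype.sum_option]
      simp only [starPorts_none_none, starPorts_none_some]
      rw [Fintype.sum_prod_type]
      simp [starCluster]
    · rw [Fintype.sum_option]
      simp only [starPorts_some_none, starPorts_some_some]
      rw [Fintype.sum_prod_type, Finset.sum_eq_single a]
      · fin_cases i <;> simp [starCluster, Fin.sum_univ_three, -Finset.sum_boole]
      · intro b _ hb
        simp [hb.symm]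
      · simp
  · intro n
    rw [Fintype.sum_option, Fintype.sum_prod_type, Finset.sum_eq_single n]
    · simp [starCluster]
    · intro b _ hb
      simp [starCluster, hb]
    · simp
  · by_contra h0
    have h1 : ∀ n : Fin (2 * m + 1),
        ((Sum.inl (some (n, 0)) : StarVertex m) ∈ S ↔ Sum.inl none ∈ S) := by
      intro n
      have hadj : (starGraph m).Adj (Sum.inl (some (n, 0))) (Sum.inl none) := rfl
      refine ⟨fun h => ?_, fun h => ?_⟩
      · by_contra h'
        exact h0 (cut_pos_iff.2 ⟨_, h, _, h', hadj⟩)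
      · by_contra h'
        exact h0 (cut_pos_iff.2 ⟨_, h, _, h', hadj.symm⟩)
    have h2 : ∀ (x : StarVertex m) (n : Fin (2 * m + 1)),
        clusterOf m (starCluster m) x = some n →
        (x ∈ S ↔ (Sum.inl (some (n, 0)) : StarVertex m) ∈ S) := fun x n hx =>
      mem_iff_of_clusterOf_eq (Y := starPorts (2 * m + 1)) (two := fun _ => False) hm
        (fun n => ⟨some (n, 0), some (n, 1), by simp, rfl, rfl⟩) (by
          change cut (starGraph m) S < 2
          omega) hx rfl
    have h3 : ∀ x : StarVertex m, (x ∈ S ↔ Sum.inl none ∈ S) := by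
      rintro ((_ | p) | q)
      · rfl
      · exact (h2 _ p.1 rfl).trans (h1 p.1)
      · exact (h2 _ q.1 rfl).trans (h1 q.1)
    exact hb ((h3 b).2 ((h3 a).1 ha))

lemma clusterOf_star_surjective (m : ℕ) :
    Function.Surjective (clusterOf m (starCluster m)) := by
  rintro (_ | n)
  · exact ⟨Sum.inl none, rfl⟩
  · exact ⟨Sum.inl (some (n, 0)), rfl⟩

lemma le_starMetric_weight {m : ℕ} {H : SimpleGraph (StarVertex m)} (hH : H.Connected) :
    2 * (m : ℝ) + 1 ≤ (starMetric m).weight H := by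
  have := card_sub_one_le_weight hH (clusterOf_star_surjective m) (starMetric m) fun x y h => by
    rw [starMetric_w, if_neg h]
    split_ifs with h1 h2
    · exact absurd (h1.trans h2.symm) h
    all_goals norm_num
  rw [Fintype.card_option, Fintype.card_fin] at this
  push_cast at this
  linarith

lemma clusterOf_star_eq_none {m : ℕ} {x : StarVertex m} :
    clusterOf m (starCluster m) x = none ↔ x = Sum.inl none := by
  rcases x with (_ | p) | q <;> simp [clusterOf, starCluster]

/-- A connected factor of degree `k` uses few of the short links of the star metric. -/
lemma RCS.le_starMetric_weight {m k : ℕ} {H : SimpleGraph (StarVertex m)} (hH : RCS k _ H) :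
    4 * (m : ℝ) + 2 - k ≤ (starMetric m).weight H := by
  have h1 : 2 * (2 * (m : ℝ) + 2) ≤ pairSum H (fun x y => if clusterOf m (starCluster m) x =
      clusterOf m (starCluster m) y then (0 : ℝ) else 1) + 2 := by
    have h := card_le_crossing hH.2 _ (clusterOf_star_surjective m)
    rw [Fintype.card_option, Fintype.card_fin] at h
    push_cast at h
    refine (by ring : 2 * (2 * (m : ℝ) + 2) = 2 * (2 * m + 1 + 1)).trans_le (h.trans_eq ?_)
    congr! 5
  set z : StarVertex m := Sum.inl none with hz
  have hdeg : (∑ y, if H.Adj z y then (1 : ℝ) else 0) = k := by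
    have := congrArg (Nat.cast : ℕ → ℝ) (factor_iff.1 hH.1 z)
    push_cast at this
    exact this
  have h2 : pairSum H (fun x _ => if x = z then (1 : ℝ) else 0) = k := by
    rw [pairSum, Finset.sum_eq_single z, ← hdeg]
    · simp
    · intro x _ hx
      simp [hx]
    · simp
  have h3 : pairSum H (fun _ y => if y = z then (1 : ℝ) else 0) = k := by
    rw [pairSum, Finset.sum_comm, Finset.sum_eq_single z, ← hdeg]
    · simp [H.adj_comm]
    · intro x _ hx
      simp [hx]
    · simp
  -- Links between fibres have weight 2, except those at the centre `z`, which have weight 1, and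
  -- there are only `k` of these. With at least `2 * m + 1` links the weight is at least `2 * (2 * m
  -- + 1) - k`.
  have h4 : 2 * pairSum H (fun x y => if clusterOf m (starCluster m) x =
      clusterOf m (starCluster m) y then (0 : ℝ) else 1) ≤
      pairSum H (fun x y => (starMetric m).w s(x, y)) +
        pairSum H (fun x _ => if x = z then (1 : ℝ) else 0) +
        pairSum H (fun _ y => if y = z then (1 : ℝ) else 0) := by
    simp only [pairSum, Finset.mul_sum, ← Finset.sum_add_distrib]
    refine Finset.sum_le_sum fun x _ => Finset.sum_le_sum fun y _ => ?_
    by_cases hxy : H.Adj x y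
    · simp only [if_pos hxy, starMetric_w, clusterOf_star_eq_none, ← hz]
      split_ifs <;> norm_num
    · simp [hxy]
  rw [weight_eq_pairSum]
  linarith

lemma card_starVertex (m : ℕ) : Fintype.card (StarVertex m) = 2 * (2 * (m + 1) ^ 2) := by
  simp only [Fintype.card_sum, Fintype.card_option, Fintype.card_prod, Fintype.card_fin,
    Fintype.card_bool]
  ring

/-- With `d` clusters, the star attains weight `d` by using all `d` short links at the centre. A
factor of degree `d - 2` has at most `d - 2` short links, so it costs at least `2 * d - (d - 2) = d
+ 2`. -/
theorem exists_RCS_not_monotone {d : ℕ} (hd : Odd d) (h5 : 5 ≤ d) :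
    ∃ (V : Type) (_ : Fintype V) (I : MetricInstance V) (s r : ℝ),
      IsOpt I (RCS (d - 2)) s ∧ IsOpt I (RCS d) r ∧ 0 < r ∧ ((d : ℝ) + 2) / d * r ≤ s := by
  obtain ⟨m, rfl⟩ := hd
  obtain ⟨H, hH⟩ := exists_RCS (card_starVertex m) (k := 2 * m + 1 - 2) (by omega) (by
    have : m + 1 ≤ (m + 1) ^ 2 := Nat.le_self_pow two_ne_zero _
    omega)
  obtain ⟨s, hs, -⟩ := exists_isOpt (starMetric m) hH
  obtain ⟨r, hr, hle⟩ := exists_isOpt (starMetric m) (starGraph_RCS (m := m) (by omega))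
  have hm : (0 : ℝ) ≤ m := m.cast_nonneg
  refine ⟨_, inferInstance, starMetric m, s, r, hs, hr, ?_, ?_⟩
  · obtain ⟨H', hH', rfl⟩ := hr.1
    have := le_starMetric_weight hH'.2
    linarith
  · obtain ⟨H', hH', rfl⟩ := hs.1
    have h1 := hH'.le_starMetric_weight
    rw [starGraph_weight] at hle
    rw [Nat.cast_sub (by omega)] at h1
    push_cast at h1 ⊢
    rw [div_mul_eq_mul_div, div_le_iff₀ (by positivity)]
    nlinarith

end Star

/-! ### Graph metrics as quotients of Hamming spaces by cycle spaces. -/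

section HammingQuotient
variable {E V : Type*} [Fintype E]

lemma hammingNorm_add_le (x y : E → ZMod 2) :
    hammingNorm (x + y) ≤ hammingNorm x + hammingNorm y := by
  have h := hammingDist_triangle x 0 (-y)
  have hneg : ∀ z : E → ZMod 2, hammingNorm (-z) = hammingNorm z := fun z => by
    simp [hammingNorm]
  rwa [hammingDist_zero_right, hammingDist_zero_left, hammingDist_eq_hammingNorm, ← neg_add,
    hneg, hneg] at h

lemma add_self_zmod_two {E : Type*} (x : E → ZMod 2) : x + x = 0 := by
  ext e
  exact CharTwo.add_self_eq_zero _

/-- The least Hamming norm in the coset of `z`. -/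
noncomputable def cosetNorm (C : AddSubgroup (E → ZMod 2)) (z : E → ZMod 2) : ℕ :=
  sInf {k | ∃ J, J - z ∈ C ∧ hammingNorm J = k}

lemma exists_cosetNorm (C : AddSubgroup (E → ZMod 2)) (z : E → ZMod 2) :
    ∃ J, J - z ∈ C ∧ hammingNorm J = cosetNorm C z :=
  Nat.sInf_mem (s := {k | ∃ J, J - z ∈ C ∧ hammingNorm J = k}) ⟨_, z, by simp, rfl⟩

lemma cosetNorm_le {C : AddSubgroup (E → ZMod 2)} {z J : E → ZMod 2} (h : J - z ∈ C) :
    cosetNorm C z ≤ hammingNorm J :=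
  Nat.sInf_le ⟨J, h, rfl⟩

/-- The metric on `V` obtained from a map to a quotient of a Hamming space. -/
noncomputable def cosetInstance (C : AddSubgroup (E → ZMod 2)) (ℓ : V → E → ZMod 2) :
    MetricInstance V :=
  MetricInstance.ofDist (fun x y => cosetNorm C (ℓ x + ℓ y)) (fun x y => by rw [add_comm])
    (fun x y => Nat.cast_nonneg _)
    (fun x y z => by
      obtain ⟨J, hJ, h1⟩ := exists_cosetNorm C (ℓ x + ℓ y)
      obtain ⟨K, hK, h2⟩ := exists_cosetNorm C (ℓ y + ℓ z)
      have h : J + K - (ℓ x + ℓ z) ∈ C := by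
        have h3 : J + K - (ℓ x + ℓ z) = J - (ℓ x + ℓ y) + (K - (ℓ y + ℓ z)) + (ℓ y + ℓ y) := by
          abel
        rw [h3, add_self_zmod_two, add_zero]
        exact C.add_mem hJ hK
      have h4 := (cosetNorm_le h).trans (hammingNorm_add_le J K)
      rw [h1, h2] at h4
      exact_mod_cast h4)

lemma cosetInstance_w (C : AddSubgroup (E → ZMod 2)) (ℓ : V → E → ZMod 2) (x y : V) :
    (cosetInstance C ℓ).w s(x, y) = cosetNorm C (ℓ x + ℓ y) := rfl

lemma sum_endpoints [Fintype V] {M : Type*} [AddCommMonoid M] (f : V → M) {x y : V} (h : x ≠ y) :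
    (∑ z, if z ∈ s(x, y) then f z else 0) = f x + f y := by
  rw [← Finset.sum_pair h, ← Finset.sum_filter]
  congr 1
  ext z
  simp

lemma sum_edges_endpoints [Fintype V] {M : Type*} [AddCommMonoid M] (H : SimpleGraph V)
    (f : V → M) :
    (∑ e ∈ H.edgeFinset, ∑ z, if z ∈ e then f z else 0) = ∑ z, H.degree z • f z := by
  rw [Finset.sum_comm]
  refine Finset.sum_congr rfl fun z _ => ?_
  rw [← Finset.sum_filter, Finset.sum_const, ← SimpleGraph.card_incidenceFinset_eq_degree,
    SimpleGraph.incidenceFinset_eq_filter]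

/-- The edges of a graph with even degrees, routed through the Hamming space, form a cycle. -/
lemma exists_routing [Fintype V] (C : AddSubgroup (E → ZMod 2)) (ℓ : V → E → ZMod 2) {d : ℕ}
    (hd : Even d) {H : SimpleGraph V} (hH : Factor d V H) :
    ∃ n : E → ℕ, (cosetInstance C ℓ).weight H = ∑ e, (n e : ℝ) ∧
      (fun e => (n e : ZMod 2)) ∈ C ∧
      ∀ x y, H.Adj x y → ∃ J : E → ZMod 2, J - (ℓ x + ℓ y) ∈ C ∧ ∀ e, n e = 0 → J e = 0 := by
  -- Each edge of `H` is routed along a shortest representative of its coset; `n e` will count the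
  -- routes through the coordinate `e`.
  have hex : ∀ h : Sym2 V, ∃ J : E → ZMod 2, h ∈ H.edgeSet →
      (J - ∑ z, if z ∈ h then ℓ z else 0) ∈ C ∧ (hammingNorm J : ℝ) = (cosetInstance C ℓ).w h := by
    intro h
    induction h using Sym2.ind with
    | _ x y =>
      obtain ⟨J, hJ, h1⟩ := exists_cosetNorm C (ℓ x + ℓ y)
      refine ⟨J, fun h => ?_⟩
      rw [sum_endpoints _ (H.ne_of_adj h), cosetInstance_w, h1]
      exact ⟨hJ, rfl⟩
  choose J hJ using hex
  have hmem : ∀ h ∈ H.edgeFinset, h ∈ H.edgeSet := fun h hh => by simpa using hh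
  refine ⟨fun e => (H.edgeFinset.filter fun h => J h e ≠ 0).card, ?_, ?_, fun x y hxy => ?_⟩
  · rw [MetricInstance.weight, Finset.sum_congr rfl fun h hh => (hJ h (hmem h hh)).2.symm]
    simp only [hammingNorm, Finset.card_filter]
    push_cast
    rw [Finset.sum_comm]
  -- Modulo 2, the routes sum to an element of `C` plus the labels weighted by the degrees, and
  -- these cancel because the degrees are even.
  · have h1 : (fun e => (((H.edgeFinset.filter fun h => J h e ≠ 0).card : ℕ) : ZMod 2)) =
        ∑ h ∈ H.edgeFinset, (J h - ∑ z, if z ∈ h then ℓ z else 0) := by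
      rw [Finset.sum_sub_distrib, sum_edges_endpoints]
      have h2 : ∑ z, H.degree z • ℓ z = 0 := by
        refine Finset.sum_eq_zero fun z _ => ?_
        obtain ⟨k, hk⟩ := hd
        have : H.degree z = k + k := by
          rw [← hk]
          convert hH z
        rw [this, add_smul, add_self_zmod_two]
      rw [h2, sub_zero]
      ext e
      rw [Finset.sum_apply, Finset.card_filter]
      push_cast
      refine Finset.sum_congr rfl fun h _ => ?_
      generalize J h e = a
      revert a
      decide
    rw [h1]
    exact C.sum_mem fun h hh => (hJ h (hmem h hh)).1
  · have h1 := (hJ s(x, y) hxy).1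
    rw [sum_endpoints _ hxy.ne] at h1
    refine ⟨_, h1, fun e he => ?_⟩
    by_contra h2
    rw [Finset.card_eq_zero] at he
    have : s(x, y) ∈ H.edgeFinset.filter fun h => J h e ≠ 0 := by simp [hxy, h2]
    rw [he] at this
    exact Finset.notMem_empty _ this

lemma TSP.factor_two [Fintype V] {H : SimpleGraph V} (hH : TSP V H) : Factor 2 V H := by
  obtain ⟨v, p, hp, hall⟩ := hH
  rw [factor_iff]
  intro x
  have h1 := hp.isCycle.ncard_neighborSet_toSubgraph_eq_two (hp.mem_support x)
  have h2 : p.toSubgraph.neighborSet x = ((univ.filter fun y => H.Adj x y : Finset V) : Set V) := by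
    ext y
    simp only [SimpleGraph.Subgraph.mem_neighborSet, coe_filter, mem_univ, true_and,
      Set.mem_ofPred_eq]
    refine ⟨fun h => h.adj_sub, fun h => ?_⟩
    rw [SimpleGraph.Walk.adj_toSubgraph_iff_mem_edges]
    exact hall _ h
  rw [h2, Set.ncard_coe_finset] at h1
  rw [← Finset.card_filter, h1]

end HammingQuotient

/-! ### The theta graph and the lower bound for tours in its metric. -/

section Theta

/-- The cycle space of three internally disjoint paths with `k + 1` edges and common ends. -/
def thetaCycles (k : ℕ) : AddSubgroup (Fin 3 × Fin (k + 1) → ZMod 2) where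
  carrier := {z | (∀ p e e', z (p, e) = z (p, e')) ∧ ∑ p, z (p, 0) = 0}
  zero_mem' := by simp
  add_mem' := by
    rintro x y ⟨h1, h2⟩ ⟨h3, h4⟩
    refine ⟨fun p e e' => ?_, ?_⟩
    · rw [Pi.add_apply, Pi.add_apply, h1 p e e', h3 p e e']
    · simp only [Pi.add_apply]
      rw [Finset.sum_add_distrib, h2, h4, add_zero]
  neg_mem' := by
    rintro x ⟨h1, h2⟩
    refine ⟨fun p e e' => ?_, ?_⟩
    · rw [Pi.neg_apply, Pi.neg_apply, h1 p e e']
    · simp only [Pi.neg_apply]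
      rw [Finset.sum_neg_distrib, h2, neg_zero]

lemma mem_thetaCycles {k : ℕ} {z : Fin 3 × Fin (k + 1) → ZMod 2} : z ∈ thetaCycles k ↔
    (∀ p e e', z (p, e) = z (p, e')) ∧ ∑ p, z (p, 0) = 0 := Iff.rfl

/-- All edges of a path are used with the same parity, and at most one is unused. Odd usage costs at
least 1 per edge, even usage at least 2 on all edges but one; `2 * k` is at least `k + 1` since `1 ≤
k`. -/
lemma le_sum_of_parity {k : ℕ} (hk : 1 ≤ k) {f : Fin (k + 1) → ℕ}
    (hpar : ∀ e e', (f e : ZMod 2) = f e') (hz : ∀ e e', e < e' → f e = 0 → f e' ≠ 0) :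
    k + 1 ≤ ∑ e, f e ∧ ((f 0 : ZMod 2) = 0 → 2 * k ≤ ∑ e, f e) := by
  have heven : ∀ e₀, (f e₀ : ZMod 2) = 0 → ∀ e, Even (f e) := fun e₀ h e =>
    (ZMod.natCast_eq_zero_iff_even).1 ((hpar e e₀).trans h)
  have key : ∀ e₀, (∀ e, Even (f e)) → (∀ e ≠ e₀, f e ≠ 0) → 2 * k ≤ ∑ e, f e := by
    intro e₀ he hne
    have h1 : ∑ e ∈ univ.erase e₀, 2 ≤ ∑ e ∈ univ.erase e₀, f e :=
      Finset.sum_le_sum fun e h => by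
        have h2 := hne e (Finset.ne_of_mem_erase h)
        obtain ⟨j, hj⟩ := he e
        omega
    have h3 := Finset.sum_le_sum_of_subset (f := f) (Finset.erase_subset e₀ univ)
    rw [Finset.sum_const, Finset.card_erase_of_mem (mem_univ _), Finset.card_univ,
      Fintype.card_fin, smul_eq_mul] at h1
    omega
  by_cases h0 : ∃ e₀, f e₀ = 0
  · obtain ⟨e₀, h0⟩ := h0
    have h1 := key e₀ (heven e₀ (by rw [h0, Nat.cast_zero])) fun e hne he => by
      rcases lt_or_gt_of_ne hne with h | h
      · exact hz _ _ h he h0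
      · exact hz _ _ h h0 he
    exact ⟨by omega, fun _ => h1⟩
  · push Not at h0
    refine ⟨?_, fun h => key 0 (heven 0 h) fun e _ => h0 e⟩
    have h1 : ∑ e : Fin (k + 1), 1 ≤ ∑ e, f e :=
      Finset.sum_le_sum fun e _ => Nat.one_le_iff_ne_zero.2 (h0 e)
    simpa using h1

/-- The parities of the three paths sum to zero, so they are not all odd: one path costs at least `2
* k` and the other two at least `k + 1` each. -/
lemma le_sum_theta {k : ℕ} (hk : 1 ≤ k) {n : Fin 3 × Fin (k + 1) → ℕ}
    (hC : (fun e => (n e : ZMod 2)) ∈ thetaCycles k)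
    (hz : ∀ p e e', e < e' → n (p, e) = 0 → n (p, e') ≠ 0) : 4 * k + 2 ≤ ∑ e, n e := by
  rw [mem_thetaCycles] at hC
  have h := fun p => le_sum_of_parity hk (f := fun e => n (p, e)) (hC.1 p) (hz p)
  have h2 : ∃ p, (n (p, 0) : ZMod 2) = 0 := by
    by_contra! h2
    have h3 : ∀ a : ZMod 2, a ≠ 0 → a = 1 := by decide
    have h4 := hC.2
    simp only [fun p => h3 _ (h2 p)] at h4
    revert h4
    decide
  rw [Fintype.sum_prod_type, Fin.sum_univ_three]
  have h0 := h 0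
  have h1 := h 1
  have h3 := h 2
  obtain ⟨p, hp⟩ := h2
  fin_cases p
  · have := h0.2 hp
    omega
  · have := h1.2 hp
    omega
  · have := h3.2 hp
    omega

/-- The vertices of the theta graph: two ends and three paths of `k` inner vertices. -/
abbrev ThetaNode (k : ℕ) := Bool ⊕ Fin 3 × Fin k

/-- The vertex at distance `i` from the first end on path `p`. -/
def thetaNode (k : ℕ) (p : Fin 3) (i : ℕ) : ThetaNode k :=
  if i = 0 then Sum.inl false else if h : i - 1 < k then Sum.inr (p, ⟨i - 1, h⟩) else Sum.inl true

lemma thetaNode_zero (k : ℕ) (p : Fin 3) : thetaNode k p 0 = Sum.inl false := rfl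

lemma thetaNode_succ {k : ℕ} (p : Fin 3) (i : Fin k) : thetaNode k p (i + 1) = Sum.inr (p, i) := by
  simp [thetaNode]

lemma thetaNode_last (k : ℕ) (p : Fin 3) : thetaNode k p (k + 1) = Sum.inl true := by
  simp [thetaNode]

/-- A path from the first end to a vertex of the theta graph. -/
def thetaPath (k : ℕ) : ThetaNode k → Fin 3 × Fin (k + 1) → ZMod 2
  | Sum.inl false => 0
  | Sum.inl true => fun q => if q.1 = 0 then 1 else 0
  | Sum.inr (p, i) => fun q => if q.1 = p ∧ (q.2 : ℕ) ≤ i then 1 else 0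

abbrev ThetaPort (k : ℕ) := Fin 3 × Fin (k + 1) × Bool

/-- The two ports of each edge of the theta graph are linked. -/
def thetaPorts (k : ℕ) : SimpleGraph (ThetaPort k) where
  Adj x y := x.1 = y.1 ∧ x.2.1 = y.2.1 ∧ x.2.2 ≠ y.2.2
  symm := ⟨fun _ _ h => ⟨h.1.symm, h.2.1.symm, h.2.2.symm⟩⟩
  loopless := ⟨fun _ h => h.2.2 rfl⟩

def thetaCluster (k : ℕ) (x : ThetaPort k) : Option (ThetaNode k) :=
  some (thetaNode k x.1 (x.2.1 + x.2.2.toNat))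

abbrev ThetaVertex (k m : ℕ) := ThetaPort k ⊕ ThetaNode k × Fin m × Bool

/-- A 2-edge-connected `(2 * m + 1)`-factor in the shape of a theta graph. -/
def thetaGraph (k m : ℕ) : SimpleGraph (ThetaVertex k m) :=
  gadget m (thetaPorts k) (thetaCluster k) fun n => n.isRight

/-- The vertex of the theta graph that a vertex of `thetaGraph` belongs to. -/
def thetaLabel (k m : ℕ) : ThetaVertex k m → ThetaNode k :=
  Sum.elim (fun x => thetaNode k x.1 (x.2.1 + x.2.2.toNat)) Prod.fst

lemma clusterOf_theta {k m : ℕ} (x : ThetaVertex k m) :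
    clusterOf m (thetaCluster k) x = some (thetaLabel k m x) := by
  cases x <;> rfl

/-- The metric of the theta graph. -/
noncomputable def thetaMetric (k m : ℕ) : MetricInstance (ThetaVertex k m) :=
  cosetInstance (thetaCycles k) fun x => thetaPath k (thetaLabel k m x)

/-- Route the 2-factor through the theta graph. If two edges of one path were unused, the part of
the path between them would be cut off from the rest, against connectedness. -/
lemma le_thetaMetric_weight {k m : ℕ} (hk : 1 ≤ k) {H : SimpleGraph (ThetaVertex k m)}
    (hF : Factor 2 _ H) (hH : H.Connected) : 4 * (k : ℝ) + 2 ≤ (thetaMetric k m).weight H := by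
  obtain ⟨n, hw, hC, hn⟩ := exists_routing (thetaCycles k)
    (fun x : ThetaVertex k m => thetaPath k (thetaLabel k m x)) even_two hF
  have h := le_sum_theta hk hC fun p e e' hee h1 h2 => by
    -- This detects the part of path `p` between `e` and `e'`. Elements of the cycle space agree at
    -- `e` and `e'`, and no route uses either edge, so `g` is constant along the edges of `H`.
    set g : ThetaVertex k m → ZMod 2 := fun x =>
      thetaPath k (thetaLabel k m x) (p, e) - thetaPath k (thetaLabel k m x) (p, e') with hg
    have hadj : ∀ x y, H.Adj x y → g x = g y := by
      intro x y hxy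
      obtain ⟨J, hJ, hJn⟩ := hn x y hxy
      have h3 := (mem_thetaCycles.1 hJ).1 p e e'
      simp only [Pi.sub_apply, Pi.add_apply, hJn _ h1, hJn _ h2, zero_sub, neg_add] at h3
      rw [← sub_eq_zero] at h3
      simp only [hg]
      rw [← sub_eq_zero]
      generalize thetaPath k (thetaLabel k m x) (p, e) = a at *
      generalize thetaPath k (thetaLabel k m x) (p, e') = b at *
      generalize thetaPath k (thetaLabel k m y) (p, e) = a' at *
      generalize thetaPath k (thetaLabel k m y) (p, e') = b' at *
      clear hJ hJn hg g hxy
      revert a b a' b'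
      decide
    have hconst : ∀ x y, g x = g y := by
      intro x y
      obtain ⟨w⟩ := hH.preconnected x y
      induction w with
      | nil => rfl
      | cons h _ ih => exact (hadj _ _ h).trans ih
    have h3 := hconst (Sum.inl (p, 0, false)) (Sum.inl (p, e, true))
    have hek : (e : ℕ) < k := lt_of_lt_of_le (Fin.lt_def.1 hee) (Nat.lt_succ_iff.1 e'.2)
    have h4 : thetaLabel k m (Sum.inl (p, 0, false)) = Sum.inl false := rfl
    have h5 : thetaLabel k m (Sum.inl (p, e, true)) = Sum.inr (p, ⟨e, hek⟩) :=
      thetaNode_succ p ⟨e, hek⟩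
    have h6 : ¬ (e' : ℕ) ≤ e := not_le.2 (Fin.lt_def.1 hee)
    simp only [hg, h4, h5, thetaPath] at h3
    simp [h6] at h3
  unfold thetaMetric
  rw [hw]
  exact_mod_cast h

end Theta

/-! ### The theta-shaped factor and the ratio 4/3. -/

section ThetaFactor
variable {k m : ℕ}

lemma thetaPath_node (p q : Fin 3) (i : ℕ) (hi : i ≤ k) (e : Fin (k + 1)) :
    thetaPath k (thetaNode k p i) (q, e) = if q = p ∧ (e : ℕ) < i then 1 else 0 := by
  rcases i with _ | i
  · simp [thetaNode_zero, thetaPath]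
  · have h := thetaNode_succ p ⟨i, hi⟩
    simp only at h
    simp only [h, thetaPath, Nat.lt_succ_iff]

/-- The chosen paths to consecutive nodes differ by the edge between them. Only at the last edge of
path `p` is there a correction, because the second end is reached along path 0: the cycle formed by
the paths `p` and 0. -/
lemma thetaLink_mem (p : Fin 3) (e : Fin (k + 1)) :
    Pi.single (p, e) 1 - (thetaPath k (thetaNode k p e) + thetaPath k (thetaNode k p (e + 1))) ∈
      thetaCycles k := by
  rw [mem_thetaCycles]
  rcases (Nat.lt_succ_iff.1 e.2).lt_or_eq with he | he
  · have h : ∀ q f, (Pi.single (p, e) 1 - (thetaPath k (thetaNode k p e) +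
        thetaPath k (thetaNode k p (e + 1))) : Fin 3 × Fin (k + 1) → ZMod 2) (q, f) = 0 := by
      intro q f
      rw [Pi.sub_apply, Pi.add_apply, thetaPath_node p q e he.le, thetaPath_node p q (e + 1) he,
        Pi.single_apply]
      simp only [Prod.mk.injEq, Fin.ext_iff (a := f)]
      by_cases hq : q = p
      · rcases lt_trichotomy (f : ℕ) e with h | h | h
        · simp [hq, h, h.ne, h.trans (Nat.lt_succ_self _)]
          decide
        · simp [hq, h]
        · simp [hq, h.ne', not_lt.2 h.le, not_lt.2 (Nat.succ_le_of_lt h)]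
      · simp [hq]
    exact ⟨fun q f f' => by rw [h, h], Finset.sum_eq_zero fun q _ => h q 0⟩
  · have h : ∀ q f, (Pi.single (p, e) 1 - (thetaPath k (thetaNode k p e) +
        thetaPath k (thetaNode k p (e + 1))) : Fin 3 × Fin (k + 1) → ZMod 2) (q, f) =
        (if q = p then 1 else 0) + if q = 0 then 1 else 0 := by
      intro q f
      rw [Pi.sub_apply, Pi.add_apply, thetaPath_node p q e he.le, he, thetaNode_last,
        Pi.single_apply]
      simp only [Prod.mk.injEq, Fin.ext_iff (a := f), he]
      by_cases hq : q = p
      · rcases (Nat.lt_succ_iff.1 f.2).lt_or_eq with h | h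
        · by_cases h0 : q = 0
          · simp [thetaPath, ← hq, h, h.ne, h0]
          · simp [thetaPath, ← hq, h, h.ne, h0]
        · by_cases h0 : q = 0
          · simp [thetaPath, ← hq, h, h0]
            decide
          · simp [thetaPath, ← hq, h, h0]
      · by_cases h0 : q = 0
        · have h0p : ¬ 0 = p := h0 ▸ hq
          simp [thetaPath, h0, h0p]
        · simp [thetaPath, hq, h0]
    refine ⟨fun q f f' => by rw [h, h], ?_⟩
    rw [Finset.sum_congr rfl fun q _ => h q 0, Finset.sum_add_distrib]
    simp
    decide

lemma thetaMetric_link (p : Fin 3) (e : Fin (k + 1)) :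
    (thetaMetric k m).w s(Sum.inl (p, e, false), Sum.inl (p, e, true)) ≤ 1 := by
  unfold thetaMetric
  rw [cosetInstance_w]
  have h1 := cosetNorm_le (thetaLink_mem p e)
  have h2 : hammingNorm (Pi.single (p, e) 1 : Fin 3 × Fin (k + 1) → ZMod 2) ≤ 1 := by
    rw [hammingNorm, Finset.card_le_one]
    intro a ha b hb
    simp [Pi.single_apply] at ha hb
    rw [ha, hb]
  exact_mod_cast h1.trans h2

lemma thetaMetric_eq_zero {x y : ThetaVertex k m} (h : thetaLabel k m x = thetaLabel k m y) :
    (thetaMetric k m).w s(x, y) = 0 := by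
  unfold thetaMetric
  rw [cosetInstance_w, h, add_self_zmod_two]
  have h1 := cosetNorm_le (C := thetaCycles k) (z := 0) (J := 0) (by simp)
  rw [hammingNorm_zero] at h1
  exact_mod_cast Nat.le_zero.1 h1

lemma thetaGraph_weight (k m : ℕ) :
    (thetaMetric k m).weight (thetaGraph k m) ≤ 3 * ((k : ℝ) + 1) := by
  have h : pairSum (thetaGraph k m) (fun x y => (thetaMetric k m).w s(x, y)) ≤
      2 * (3 * ((k : ℝ) + 1)) := by
    rw [thetaGraph, pairSum_gadget]
    · have h1 : ∀ x : ThetaPort k, (∑ y, if (thetaPorts k).Adj x y then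
          (thetaMetric k m).w s(Sum.inl x, Sum.inl y) else 0) ≤ 1 := by
        rintro ⟨p, e, s⟩
        rw [Finset.sum_eq_single (p, e, !s)]
        · rw [if_pos ⟨rfl, rfl, by simp⟩]
          cases s
          · exact thetaMetric_link p e
          · rw [Sym2.eq_swap]
            exact thetaMetric_link p e
        · rintro ⟨q, f, t⟩ _ hne
          rw [if_neg]
          rintro ⟨h1, h2, h3⟩
          simp only at h1 h2 h3
          refine hne (by rw [h1, h2, ← Bool.not_eq.2 h3])
        · simp
      refine (Finset.sum_le_sum fun x _ => h1 x).trans (le_of_eq ?_)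
      simp
      ring
    · intro x y n hx hy
      rw [clusterOf_theta] at hx hy
      exact thetaMetric_eq_zero (Option.some_injective _ (hx.trans hy.symm))
  rw [weight_eq_pairSum]
  linarith

/-- The two ends have three ports and the inner nodes two, in accordance with the choice of
`isRight` for the clusters with joined couples. -/
lemma thetaGraph_factor (k m : ℕ) : Factor (2 * m + 1) _ (thetaGraph k m) := by
  refine gadget_factor ?_ ?_
  · rintro ⟨p, e, s⟩
    rw [Finset.sum_eq_single (p, e, !s)]
    · rw [if_pos ⟨rfl, rfl, by simp⟩]
      simp [thetaCluster]
    · rintro ⟨q, f, t⟩ _ hne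
      rw [if_neg]
      rintro ⟨h1, h2, h3⟩
      simp only at h1 h2 h3
      refine hne (by rw [h1, h2, ← Bool.not_eq.2 h3])
    · simp
  · intro n
    have h1 : ∀ p : Fin 3, (∑ e : Fin (k + 1), if thetaNode k p e = n then 1 else 0) =
        (if Sum.inl false = n then 1 else 0) + ∑ i : Fin k, if Sum.inr (p, i) = n then 1 else 0 := by
      intro p
      rw [Fin.sum_univ_succ]
      simp only [Fin.val_zero, Fin.val_succ, thetaNode_zero, thetaNode_succ]
      congr!
    have h2 : ∀ p : Fin 3, (∑ e : Fin (k + 1), if thetaNode k p (e + 1) = n then 1 else 0) =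
        (∑ i : Fin k, if Sum.inr (p, i) = n then 1 else 0) + if Sum.inl true = n then 1 else 0 := by
      intro p
      rw [Fin.sum_univ_castSucc]
      simp only [Fin.val_castSucc, Fin.val_last, thetaNode_last, thetaNode_succ]
    have h3 : (∑ x, if thetaCluster k x = some n then 1 else 0) =
        ∑ p : Fin 3, ((∑ e : Fin (k + 1), if thetaNode k p (e + 1) = n then 1 else 0) +
          ∑ e : Fin (k + 1), if thetaNode k p e = n then 1 else 0) := by
      simp only [Fintype.sum_prod_type, ← Finset.sum_add_distrib]
      refine Finset.sum_congr rfl fun p _ => Finset.sum_congr rfl fun e _ => ?_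
      rw [Fintype.sum_bool]
      simp [thetaCluster, -Option.some.injEq, Option.some_inj]
    refine Eq.trans (by congr!) (h3.trans ?_)
    simp only [h1, h2]
    rcases n with s | ⟨q, j⟩
    · cases s <;> simp
    · rw [Finset.sum_eq_single q]
      · simp
      · intro p _ hp
        simp [hp]
      · simp

/-- Along a path, the sides of a cut change across some link. -/
lemma exists_link_crossing {S : Set (ThetaVertex k m)} (f : ThetaNode k → Prop)
    (hf : ∀ x, (x ∈ S ↔ f (thetaLabel k m x))) (p : Fin 3) {a b : ℕ} (hab : a ≤ b)
    (hb : b ≤ k + 1) (hne : ¬ (f (thetaNode k p a) ↔ f (thetaNode k p b))) :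
    ∃ (e : Fin (k + 1)) (s : Bool), a ≤ e ∧ (e : ℕ) < b ∧
      (Sum.inl (p, e, s), Sum.inl (p, e, !s)) ∈ cutPairs (thetaGraph k m) S := by
  obtain ⟨e, h1, h2, h3⟩ : ∃ e, a ≤ e ∧ e < b ∧
      ¬ (f (thetaNode k p e) ↔ f (thetaNode k p (e + 1))) := by
    by_contra! h
    have : ∀ j, a ≤ j → j ≤ b → (f (thetaNode k p a) ↔ f (thetaNode k p j)) := by
      intro j haj
      induction j, haj using Nat.le_induction with
      | base => exact fun _ => Iff.rfl
      | succ j haj ih => exact fun hj => (ih (by omega)).trans (h j haj (by omega))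
    exact hne (this b hab le_rfl)
  have he : e < k + 1 := by omega
  have hl : ∀ s : Bool, ((Sum.inl (p, ⟨e, he⟩, s) : ThetaVertex k m) ∈ S ↔
      f (thetaNode k p (e + s.toNat))) := fun s => hf _
  have hadj : ∀ s : Bool, (thetaGraph k m).Adj (Sum.inl (p, ⟨e, he⟩, s))
      (Sum.inl (p, ⟨e, he⟩, !s)) := fun s => ⟨rfl, rfl, by simp⟩
  have hfalse := hl false
  have htrue := hl true
  simp only [Bool.toNat_false, Bool.toNat_true, add_zero] at hfalse htrue
  by_cases h4 : f (thetaNode k p e)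
  · have h5 : ¬ f (thetaNode k p (e + 1)) := fun h => h3 (by simp [h4, h])
    exact ⟨⟨e, he⟩, false, h1, h2, mem_cutPairs.2 ⟨hfalse.2 h4, fun h => h5 (htrue.1 h), hadj _⟩⟩
  · have h5 : f (thetaNode k p (e + 1)) := by
      by_contra h
      exact h3 (by simp [h4, h])
    exact ⟨⟨e, he⟩, true, h1, h2, mem_cutPairs.2 ⟨htrue.2 h5, fun h => h4 (hfalse.1 h), hadj _⟩⟩

/-- A smaller cut splits no cluster, so it comes from a set of nodes of the theta graph. If it
separates the ends, all three paths cross it; if it separates an inner node from both ends, its path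
crosses it on either side of that node. -/
lemma thetaGraph_two_le_cut (hm : 0 < m) {S : Set (ThetaVertex k m)}
    {a b : ThetaVertex k m} (ha : a ∈ S) (hb : b ∉ S) : 2 ≤ cut (thetaGraph k m) S := by
  by_contra hlt
  have hports : ∀ n, ∃ x y, x ≠ y ∧ thetaCluster k x = some n ∧ thetaCluster k y = some n := by
    rintro ((_ | _) | ⟨p, i⟩)
    · exact ⟨(0, 0, false), (1, 0, false), by simp, rfl, rfl⟩
    · refine ⟨(0, Fin.last k, true), (1, Fin.last k, true), by simp, ?_, ?_⟩ <;>
        exact congrArg some (thetaNode_last k _)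
    · refine ⟨(p, i.succ, false), (p, i.castSucc, true), by simp, ?_, ?_⟩ <;>
        exact congrArg some (thetaNode_succ p i)
  have hone : ∀ {x y x' y' : ThetaPort k}, (Sum.inl x, Sum.inl y) ∈ cutPairs (thetaGraph k m) S →
      (Sum.inl x', Sum.inl y') ∈ cutPairs (thetaGraph k m) S → x = x' := by
    intro x y x' y' h h'
    by_contra hne
    refine hlt (Finset.one_lt_card.2 ⟨_, h, _, h', fun h => hne ?_⟩)
    exact Sum.inl_injective (congrArg Prod.fst h)
  obtain ⟨f, hf⟩ : ∃ f : ThetaNode k → Prop, ∀ x, (x ∈ S ↔ f (thetaLabel k m x)) := by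
    refine ⟨fun n => ∃ x, thetaLabel k m x = n ∧ x ∈ S, fun x => ⟨fun h => ⟨x, rfl, h⟩, ?_⟩⟩
    rintro ⟨y, hy, hyS⟩
    exact (mem_iff_of_clusterOf_eq hm hports (not_le.1 hlt) (clusterOf_theta x)
      ((clusterOf_theta y).trans (congrArg some hy))).2 hyS
  have hends : f (Sum.inl false) ↔ f (Sum.inl true) := by
    by_contra hne
    have hcross : ∀ p, ∃ (e : Fin (k + 1)) (s : Bool),
        (Sum.inl (p, e, s), Sum.inl (p, e, !s)) ∈ cutPairs (thetaGraph k m) S := by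
      intro p
      obtain ⟨e, s, -, -, h⟩ := exists_link_crossing f hf p (Nat.zero_le (k + 1)) le_rfl
        (by rwa [thetaNode_zero, thetaNode_last])
      exact ⟨e, s, h⟩
    obtain ⟨e, s, h⟩ := hcross 0
    obtain ⟨e', s', h'⟩ := hcross 1
    exact absurd (congrArg Prod.fst (hone h h')) (by simp)
  have hall : ∀ n, f n ↔ f (Sum.inl false) := by
    rintro ((_ | _) | ⟨p, i⟩)
    · rfl
    · exact hends.symm
    · by_contra hne
      obtain ⟨e, s, -, h1, h⟩ := exists_link_crossing f hf p (Nat.zero_le (i + 1)) (by omega)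
        (by rw [thetaNode_zero, thetaNode_succ]; exact fun h => hne h.symm)
      obtain ⟨e', s', h2, -, h'⟩ := exists_link_crossing f hf p (a := i + 1) (b := k + 1)
        (by omega) le_rfl (by
          rw [thetaNode_last, thetaNode_succ, ← hends]
          exact hne)
      have := congrArg (fun x : ThetaPort k => (x.2.1 : ℕ)) (hone h h')
      simp only at this
      omega
  exact hb ((hf b).2 ((hall _).2 ((hall _).1 ((hf a).1 ha))))

lemma thetaGraph_RTwoCS (hm : 0 < m) : RTwoCS (2 * m + 1) _ (thetaGraph k m) := by
  have hne : Nonempty (ThetaVertex k m) := ⟨Sum.inl (0, 0, false)⟩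
  exact ⟨thetaGraph_factor k m,
    twoEdgeConnected_of_cut fun S a ha b hb => thetaGraph_two_le_cut hm ha hb⟩

end ThetaFactor

/-- A tour costs at least `4 * k + 2` and the theta-shaped factor at most `3 * (k + 1)`; their ratio
tends to 4/3 with `k`. -/
theorem exists_TSP_RTwoCS_ratio {d : ℕ} (hd : Odd d) (h3 : 3 ≤ d) {ε : ℝ} (hε : 0 < ε) (N : ℕ) :
    ∃ (V : Type) (_ : Fintype V) (I : MetricInstance V) (t r : ℝ),
      N ≤ Fintype.card V ∧ IsOpt I TSP t ∧ IsOpt I (RTwoCS d) r ∧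
        0 < r ∧ (4 / 3 - ε) * r ≤ t := by
  obtain ⟨m, rfl⟩ := hd
  obtain ⟨j, hj⟩ := exists_nat_gt (1 / ε)
  set k := N + j + 1 with hk
  have hG := thetaGraph_RTwoCS (k := k) (m := m) (by omega)
  have hG' : RCS (2 * m + 1) _ (thetaGraph k m) := ⟨hG.1, hG.2.1⟩
  obtain ⟨r, hr, hle⟩ := exists_isOpt (thetaMetric k m) hG
  obtain ⟨H, hH, hHr⟩ := hr.1
  -- The optimum of `RCS` provides a tour and also positivity of `r`: the tour has positive length
  -- at most `2 * b`, and `b ≤ r`.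
  obtain ⟨b, hb, hbr⟩ := exists_isOpt (thetaMetric k m)
    (show RCS (2 * m + 1) _ H from ⟨hH.1, hH.2.1⟩)
  obtain ⟨t, ht, htb⟩ := TSP_le_two_mul_RCS (d := 2 * m + 1) (by omega) _ _ b hb
  obtain ⟨H', hH', hHt⟩ := ht.1
  have h1 := le_thetaMetric_weight (k := k) (by omega) (TSP.factor_two hH')
    (TSP.twoEdgeConnected hH').1
  have h2 := hle.trans (thetaGraph_weight k m)
  rw [hHt] at h1
  rw [hHr] at hbr
  have hk0 : (0 : ℝ) ≤ k := k.cast_nonneg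
  refine ⟨_, inferInstance, thetaMetric k m, t, r, ?_, ht, hr, by linarith, ?_⟩
  · simp only [Fintype.card_sum, Fintype.card_prod, Fintype.card_fin, Fintype.card_bool]
    omega
  · rcases le_total (4 / 3 - ε) 0 with h | h
    · nlinarith
    · have h4 : (4 / 3 - ε) * r ≤ (4 / 3 - ε) * (3 * (k + 1)) := mul_le_mul_of_nonneg_left h2 h
      have h5 : 1 ≤ ε * k := by
        have : (j : ℝ) ≤ k := by exact_mod_cast (by omega : j ≤ k)
        rw [div_lt_iff₀ hε] at hj
        nlinarith
      nlinarith

theorem isTight_TSP_RTwoCS_three : IsTight TSP (RTwoCS 3) (4 / 3) := by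
  intro ε hε
  obtain ⟨V, _, I, t, r, -, ht, hr, hpos, hle⟩ :=
    exists_TSP_RTwoCS_ratio (d := 3) (by decide) le_rfl (half_pos hε) 0
  exact ⟨V, _, I, t, r, ht, hr, by nlinarith⟩

end FactorComparison

open FactorComparison in
theorem mainTheorem8 :
    -- MST ≤ RCS d ≤ RTwoCS d
    ((∀ d : ℕ, BoundedBy.{u} MST (RCS d) 1 ∧ BoundedBy.{u} (RCS d) (RTwoCS d) 1) ∧
      (∀ d : ℕ, 1 ≤ d → IsTight MST (RCS d) 1) ∧
      (∀ d : ℕ, 2 ≤ d → IsTight (RCS d) (RTwoCS d) 1 ∧ IsTight MST (RTwoCS d) 1)) ∧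
    -- Factor d ≤ RCS d
    ((∀ d : ℕ, BoundedBy.{u} (Factor d) (RCS d) 1) ∧
      (∀ d : ℕ, 1 ≤ d → IsTight (Factor d) (RCS d) 1)) ∧
    -- RTwoCS d ≤ 3 RCS d for odd d
    (∀ d : ℕ, Odd d → 3 ≤ d →
      BoundedBy.{u} (RTwoCS d) (RCS d) 3 ∧ IsTight (RTwoCS d) (RCS d) 3) ∧
    -- TSP ≤ RCS d for even d
    (∀ d : ℕ, Even d → 2 ≤ d → BoundedBy.{u} TSP (RCS d) 1 ∧ IsTight TSP (RCS d) 1) ∧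
    -- TSP ≤ 2 RCS d for odd d
    (∀ d : ℕ, Odd d → 3 ≤ d → BoundedBy.{u} TSP (RCS d) 2 ∧ IsTight TSP (RCS d) 2) ∧
    -- TSP ≤ (4/3) RTwoCS 3
    (BoundedBy.{u} TSP (RTwoCS 3) (4 / 3) ∧ IsTight TSP (RTwoCS 3) (4 / 3)) ∧
    -- TSP ≥ (4/3 - o(1)) RTwoCS d for odd d, as the number of vertices grows
    (∀ d : ℕ, Odd d → 3 ≤ d → ∀ ε : ℝ, 0 < ε → ∀ N : ℕ,
      ∃ (V : Type) (_ : Fintype V) (I : MetricInstance V) (t r : ℝ),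
        N ≤ Fintype.card V ∧ IsOpt I TSP t ∧ IsOpt I (RTwoCS d) r ∧
          0 < r ∧ (4 / 3 - ε) * r ≤ t) ∧
    -- monotonicity for even d
    (∀ d : ℕ, Even d → 4 ≤ d →
      (BoundedBy.{u} (Factor (d - 2)) (Factor d) (((d : ℝ) - 2) / d) ∧
        IsTight (Factor (d - 2)) (Factor d) (((d : ℝ) - 2) / d)) ∧
      (BoundedBy.{u} (RCS (d - 2)) (RCS d) 1 ∧ IsTight (RCS (d - 2)) (RCS d) 1)) ∧
    -- failure of monotonicity for odd d
    (∀ d : ℕ, Odd d → 5 ≤ d →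
      ∃ (V : Type) (_ : Fintype V) (I : MetricInstance V) (s r : ℝ),
        IsOpt I (RCS (d - 2)) s ∧ IsOpt I (RCS d) r ∧
          0 < r ∧ ((d : ℝ) + 2) / d * r ≤ s) := by
  refine ⟨⟨fun d => ⟨MST_le_RCS d, RCS_le_RTwoCS d⟩, fun d hd => isTight_MST_RCS hd,
      fun d hd => ⟨isTight_RCS_RTwoCS hd, isTight_MST_RTwoCS hd⟩⟩,
    ⟨Factor_le_RCS, fun d hd => isTight_Factor_RCS hd⟩,
    fun d hd h3 => ⟨RTwoCS_le_three_mul_RCS (by omega), isTight_RTwoCS_RCS hd h3⟩,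
    fun d hd h2 => ⟨TSP_le_RCS_even hd h2, isTight_TSP_RCS_even hd h2⟩,
    fun d hd h3 => ⟨TSP_le_two_mul_RCS (by omega), isTight_TSP_RCS_odd hd h3⟩,
    ⟨TSP_le_RTwoCS_three, isTight_TSP_RTwoCS_three⟩,
    fun d hd h3 ε hε N => exists_TSP_RTwoCS_ratio hd h3 hε N,
    fun d hd h4 => ⟨⟨Factor_sub_two_le hd h4, isTight_Factor_sub_two hd h4⟩,
      RCS_sub_two_le hd h4, isTight_RCS_sub_two hd h4⟩,
    fun d hd h5 => exists_RCS_not_monotone hd h5⟩
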